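/- Let $k$ be a field of characteristic $0$ and $A=k\langle x,y,z\rangle/(x^2+yx,\;xz,\;zy)$. Let $HH_p(A)=\mathrm{Tor}_p^{A^e}(A,A)$ and $HH^{-n}(A)=\mathrm{Ext}^{n}_{A^e}(A,A)$ be the Hochschild homology and cohomology, computed by the Hochschild complexes with chains $A\otimes A^{\otimes p}$ and cochains $\mathrm{Hom}(A^{\otimes n},A)$, and let $\cap:HH^{-n}(A)\otimes HH_p(A)\to HH_{p-n}(A)$ $(p\ge n)$ be the cap product, induced by $f\cap(a_0\otimes\cdots\otimes a_p)=a_0f(a_1,\dots,a_n)\otimes a_{n+1}\otimes\cdots\otimes a_p$. **Notation.** All parameters $n,n_j,n',n_0,r_j,m_j,s_j,p,q$ are integers $\ge1$ unless stated otherwise. We write $n_{a,\dots,b}$ for $n_a,\dots,n_b$ (empty if $a>b$), and $z^{m_1}\cdots z^{m_p}$ stands for $z^{m_1}xy^{n_2}z^{m_2}xy^{n_3}z^{m_3}\cdots xy^{n_p}z^{m_p}$. Indices of pairs $(n_i,m_i)$, $1\le i\le p$, are read cyclically. *Classes in $HH_0(A)=A/[A,A]$.* $\zeta_0=[1]$,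 $\alpha_0=[x]$, $\beta_0(n)=[y^nx]$, $\gamma_0(n)=[y^n]$, $\delta_0(n)=[z^n]$ and $\bar\epsilon_0(n_{1,\dots,p};m_{1,\dots,p})=[y^{n_1}z^{m_1}xy^{n_2}z^{m_2}x\cdots y^{n_p}z^{m_p}x]$. The last formula defines $\bar\epsilon_0$ also when some $n_j$ or $m_j$ is $0$. *Classes in $HH_1(A)$.* $\alpha_1=[1\otimes x]$, $\beta_1=[x\otimes x]$, $\gamma_1(n_0)=[y^{n_0}x\otimes x]$, $\delta_1=[1\otimes y]$, $\epsilon_1(n_0)=[y^{n_0}\otimes y]$, $\zeta_1=[1\otimes z]$, $\eta_1(n_1)=[z^{n_1}\otimes z]$, and $\theta_1(n_{1,\dots,p};m_{1,\dots,p})$ is the class of $$\sum_{i=1}^p\Big(u_i\otimes x+\sum_{t=1}^{n_i}y^{n_i-t}v_i\,x\,y^{t-1}\otimes y+\sum_{s=1}^{m_i}z^{m_i-s}w_i\,x\,y^{n_i}z^{s-1}\otimes z\Big),$$ where $w_i=xy^{n_{i+1}}z^{m_{i+1}}\cdots xy^{n_p}z^{m_p}xy^{n_1}z^{m_1}\cdots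 xy^{n_{i-1}}z^{m_{i-1}}$ (so $w_i=1$ if $p=1$), $v_i=z^{m_i}w_i$ and $u_i=y^{n_i}v_i$. *Classes in $HH^{-1}(A)$.* Each is the class of the derivation of $A$ with the given values on $x,y,z$ (values not mentioned are $0$): $A^{-1}$: $x\mapsto x,\ y\mapsto y$; $B^{-1}(n)$: $x\mapsto y^nx,\ y\mapsto-y^nx$; $C^{-1}(n+1)$: $y\mapsto y^{n+1}x-xy^{n+1},\ z\mapsto zxy^n$; $D^{-1}(n,i)$ $(1\le i\le n-2)$: $y\mapsto y^nx-y^ixy^{n-i}$; $E^{-1}(n)$: $y\mapsto y^nx+y^{n+1}$; $F^{-1}(n_{0,\dots,p};m_{1,\dots,p})$: $y\mapsto y^{n_0}xy^{n_1}z^{m_1}\cdots z^{m_p}x$; $G^{-1}(n_{1,\dots,p};m_{1,\dots,p})$: $y\mapsto y^{n_1}z^{m_1}\cdots z^{m_p}x$; $H^{-1}(n_{0,\dots,p+1};m_{1,\dots,p})$: $y\mapsto y^{n_0}xy^{n_1}z^{m_1}\cdots z^{m_p}xy^{n_{p+1}}$; $I^{-1}(n_{1,\dots,p+1};m_{1,\dots,p})$: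 $y\mapsto y^{n_1}z^{m_1}\cdots z^{m_p}xy^{n_{p+1}}$; $J^{-1}(n_{1,\dots,p+1};m_{1,\dots,p})$: $y\mapsto xy^{n_1}z^{m_1}\cdots z^{m_p}xy^{n_{p+1}}$, $z\mapsto-zxy^{n_1}z^{m_1}\cdots z^{m_p}xy^{n_{p+1}-1}$; $K^{-1}(n_{2,\dots,p};m_{1,\dots,p})$: $z\mapsto z^{m_1}\cdots z^{m_p}$. **Proposition.** (1) The classes $\zeta_0,\alpha_0,\beta_0,\gamma_0,\delta_0,\bar\epsilon_0$ (all parameters positive) form a basis of $HH_0(A)$ and the classes $\alpha_1,\dots,\theta_1$ form a basis of $HH_1(A)$, where two classes $\bar\epsilon_0$, respectively $\theta_1$, coincide exactly if their lists of pairs $(n_j,m_j)$ differ by a cyclic permutation; the classes $A^{-1},\dots,K^{-1}$, with distinct parameters giving distinct classes, form a basis of $HH^{-1}(A)$. (2) The cap product $HH^{-1}(A)\otimes HH_1(A)\to HH_0(A)$ is nonzero and is given by - $A^{-1}\cap\alpha_1=\alpha_0$, $B^{-1}(n)\cap\alpha_1=\beta_0(n)$; - $A^{-1}\cap\beta_1=-\beta_0(1)$,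 $B^{-1}(n)\cap\beta_1=-\beta_0(n+1)$; - $A^{-1}\cap\gamma_1(n_0)=-\beta_0(n_0+1)$, $B^{-1}(n)\cap\gamma_1(n_0)=-\beta_0(n_0+n+1)$; - $A^{-1}\cap\delta_1=\gamma_0(1)$, $B^{-1}(n)\cap\delta_1=-\beta_0(n)$, $E^{-1}(n)\cap\delta_1=\beta_0(n)+\gamma_0(n+1)$; - $G^{-1}(n_{1,\dots,p};m_{1,\dots,p})\cap\delta_1=\bar\epsilon_0(n_{1,\dots,p};m_{1,\dots,p})$, $I^{-1}(n_{1,\dots,p+1};m_{1,\dots,p})\cap\delta_1=\bar\epsilon_0(n_1+n_{p+1},n_{2,\dots,p};m_{1,\dots,p})$; - $A^{-1}\cap\epsilon_1(n_0)=\gamma_0(n_0+1)$, $B^{-1}(n)\cap\epsilon_1(n_0)=-\beta_0(n_0+n)$, $E^{-1}(n)\cap\epsilon_1(n_0)=\beta_0(n_0+n)+\gamma_0(n_0+n+1)$; - $G^{-1}(n_{1,\dots,p};m_{1,\dots,p})\cap\epsilon_1(n_0)=\bar\epsilon_0(n_0+n_1,n_{2,\dots,p};m_{1,\dots,p})$,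 $I^{-1}(n_{1,\dots,p+1};m_{1,\dots,p})\cap\epsilon_1(n_0)=\bar\epsilon_0(n_0+n_1+n_{p+1},n_{2,\dots,p};m_{1,\dots,p})$; - $C^{-1}(n+1)\cap\zeta_1=\bar\epsilon_0(n;1)$, $J^{-1}(n_{1,\dots,p+1};m_{1,\dots,p})\cap\zeta_1=-\bar\epsilon_0(n_{p+1}-1,n_{1,\dots,p};1,m_{1,\dots,p})$; - $K^{-1}(n_{2,\dots,p};m_{1,\dots,p})\cap\zeta_1=\bar\epsilon_0(n_{2,\dots,p};m_{2,\dots,p-1},m_p+m_1)$ if $p\ge2$, and $K^{-1}(\,;m_1)\cap\zeta_1=\delta_0(m_1)$; - $C^{-1}(n+1)\cap\eta_1(n_1)=\bar\epsilon_0(n;n_1+1)$, $J^{-1}(n_{1,\dots,p+1};m_{1,\dots,p})\cap\eta_1(n')=-\bar\epsilon_0(n_{p+1}-1,n_{1,\dots,p};n'+1,m_{1,\dots,p})$; - $K^{-1}(n_{2,\dots,p};m_{1,\dots,p})\cap\eta_1(n')=\bar\epsilon_0(n_{2,\dots,p};m_{2,\dots,p-1},m_p+m_1+n')$ if $p\ge2$,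 and $K^{-1}(\,;m_1)\cap\eta_1(n')=\delta_0(m_1+n')$; and, with $\theta_1=\theta_1(n_{1,\dots,p};m_{1,\dots,p})$, - $A^{-1}\cap\theta_1=\sum_{i=1}^p(n_i+1)\,\bar\epsilon_0(n_{1,\dots,p};m_{1,\dots,p})$; - $C^{-1}(n+1)\cap\theta_1=\sum_{i=1}^p\sum_{s=1}^{m_i}\bar\epsilon_0(n_{1,\dots,i},n,n_{i+1,\dots,p};m_{1,\dots,i-1},s,m_i-s,m_{i+1,\dots,p})$; - $E^{-1}(n)\cap\theta_1=\sum_{i=1}^pn_i\,\bar\epsilon_0(n_{1,\dots,i-1},n_i+n,n_{i+1,\dots,p};m_{1,\dots,p})$; - $G^{-1}(r_{1,\dots,q};s_{1,\dots,q})\cap\theta_1=\sum_{i=1}^p\sum_{t=1}^{n_i}\bar\epsilon_0(n_{1,\dots,i-1},t+r_1-1,r_{2,\dots,q},n_i-t,n_{i+1,\dots,p};m_{1,\dots,i-1},s_{1,\dots,q},m_{i,\dots,p})$; - $I^{-1}(r_{1,\dots,q+1};s_{1,\dots,q})\cap\theta_1=\sum_{i=1}^p\sum_{t=1}^{n_i}\bar\epsilon_0(n_{1,\dots,i-1},t+r_1-1,r_{2,\dots,q},n_i+r_{q+1}-t,n_{i+1,\dots,p};m_{1,\dots,i-1},s_{1,\dots,q},m_{i,\dots,p})$;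 - $J^{-1}(r_{1,\dots,q+1};s_{1,\dots,q})\cap\theta_1=-\sum_{i=1}^p\sum_{s=1}^{m_i}\bar\epsilon_0(n_{1,\dots,i},r_{1,\dots,q},r_{q+1}-1,n_{i+1,\dots,p};m_{1,\dots,i-1},s,s_{1,\dots,q},m_i-s,m_{i+1,\dots,p})$; - $K^{-1}(r_{2,\dots,q};s_{1,\dots,q})\cap\theta_1=\sum_{i=1}^p\sum_{s=1}^{m_i}\bar\epsilon_0(n_{1,\dots,i},r_{2,\dots,q},n_{i+1,\dots,p};m_{1,\dots,i-1},s+s_1-1,s_{2,\dots,q-1},m_i+s_q-s,m_{i+1,\dots,p})$ if $q\ge2$, and $K^{-1}(\,;s_1)\cap\theta_1=\sum_{i=1}^pm_i\,\bar\epsilon_0(n_{1,\dots,p};m_{1,\dots,i-1},m_i+s_1-1,m_{i+1,\dots,p})$. All other cap products of a class $A^{-1},\dots,K^{-1}$ with a class $\alpha_1,\dots,\theta_1$ are $0$. (3) In these formulas, every term $\bar\epsilon_0$ with a parameter equal to $0$ is $0$: $\bar\epsilon_0(n_{1,\dots,p};m_{1,\dots,p})=0$ for all integers $n_j,m_j\ge0$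 such that some $m_j$ is positive and at least one of the $n_j,m_j$ is $0$. (4) For $n\ge1$ and $p\ge n$ the cap product $HH^{-n}(A)\otimes HH_p(A)\to HH_{p-n}(A)$ is zero unless $n=p=1$. Moreover $HH^0(A)$ is one-dimensional, spanned by the class of $1$, which acts on every $HH_p(A)$ as the identity. -/

import Mathlib

namespace Hochschild

section Subquotient

variable {k M M₁ M₂ : Type*} [CommRing k] [AddCommGroup M] [Module k M]
  [AddCommGroup M₁] [Module k M₁] [AddCommGroup M₂] [Module k M₂]

/-- The subquotient `Z / (Z ∩ B)` of a module. -/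
def Subquotient (Z B : Submodule k M) := Z ⧸ B.comap Z.subtype

instance (Z B : Submodule k M) : AddCommGroup (Subquotient Z B) :=
  inferInstanceAs (AddCommGroup (Z ⧸ B.comap Z.subtype))

instance (Z B : Submodule k M) : Module k (Subquotient Z B) :=
  inferInstanceAs (Module k (Z ⧸ B.comap Z.subtype))

/-- The class of an element of `Z` in `Z / (Z ∩ B)`. -/
def Subquotient.mk (Z B : Submodule k M) : Z →ₗ[k] Subquotient Z B :=
  (B.comap Z.subtype).mkQ

theorem Subquotient.mk_surjective (Z B : Submodule k M) :
    Function.Surjective (Subquotient.mk Z B) :=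
  Submodule.mkQ_surjective _

theorem Subquotient.mk_eq_zero (Z B : Submodule k M) (z : Z) :
    Subquotient.mk Z B z = 0 ↔ (z : M) ∈ B :=
  Submodule.Quotient.mk_eq_zero _

/-- The bilinear map of subquotients induced by a bilinear map. -/
def Subquotient.map₂ {Z B : Submodule k M} {Z₁ B₁ : Submodule k M₁} {Z₂ B₂ : Submodule k M₂}
    (F : M₁ →ₗ[k] M₂ →ₗ[k] M) (hZ : ∀ f ∈ Z₁, ∀ c ∈ Z₂, F f c ∈ Z)
    (hB₂ : ∀ f ∈ Z₁, ∀ c ∈ B₂, F f c ∈ B) (hB₁ : ∀ f ∈ B₁, ∀ c ∈ Z₂, F f c ∈ B) :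
    Subquotient Z₁ B₁ →ₗ[k] Subquotient Z₂ B₂ →ₗ[k] Subquotient Z B :=
  Submodule.liftQ _
    (Submodule.liftQ _
      (LinearMap.mk₂ k
        (fun (c : Z₂) (f : Z₁) => Subquotient.mk Z B ⟨F f c, hZ f f.2 c c.2⟩)
        (fun c c' f => by rw [← map_add]; congr 1; ext1; simp)
        (fun r c f => by rw [← map_smul]; congr 1; ext1; simp)
        (fun c f f' => by rw [← map_add]; congr 1; ext1; simp)
        (fun r c f => by rw [← map_smul]; congr 1; ext1; simp))
      (fun c hc => by
        ext f
        exact (Subquotient.mk_eq_zero _ _ _).2 (hB₂ f f.2 c hc))).flip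
    (fun f hf => by
      refine LinearMap.ext fun ξ => ?_
      obtain ⟨c, rfl⟩ := Subquotient.mk_surjective _ _ ξ
      exact (Subquotient.mk_eq_zero _ _ _).2 (hB₁ f hf c c.2))

theorem Subquotient.map₂_mk {Z B : Submodule k M} {Z₁ B₁ : Submodule k M₁}
    {Z₂ B₂ : Submodule k M₂} (F : M₁ →ₗ[k] M₂ →ₗ[k] M) (hZ : ∀ f ∈ Z₁, ∀ c ∈ Z₂, F f c ∈ Z)
    (hB₂ : ∀ f ∈ Z₁, ∀ c ∈ B₂, F f c ∈ B) (hB₁ : ∀ f ∈ B₁, ∀ c ∈ Z₂, F f c ∈ B)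
    (f : Z₁) (c : Z₂) :
    Subquotient.map₂ F hZ hB₂ hB₁ (Subquotient.mk Z₁ B₁ f) (Subquotient.mk Z₂ B₂ c) =
      Subquotient.mk Z B ⟨F f c, hZ f f.2 c c.2⟩ := rfl

end Subquotient

section General

variable (k : Type*) (A : Type*) [CommRing k] [Ring A] [Algebra k A]

/-- The module `A ⊗ A ^ ⊗ p` of Hochschild `p`-chains. -/
abbrev Chain (p : ℕ) := PiTensorProduct k (fun _ : Fin (p + 1) => A)

/-- The module `Hom (A ^ ⊗ n, A)` of Hochschild `n`-cochains. -/
abbrev Cochain (n : ℕ) := MultilinearMap k (fun _ : Fin n => A) A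

variable {k A}

/-- Precomposition of a multilinear map with a map of tuples that is linear in each entry. -/
def precompSlots {M : Type*} [AddCommGroup M] [Module k M] {p q : ℕ}
    (g : MultilinearMap k (fun _ : Fin q => A) M) (F : (Fin p → A) → Fin q → A)
    (hF : ∀ (a : Fin p → A) (s : Fin p), ∃ (t : Fin q) (L : A →ₗ[k] A), ∀ u : A,
      F (Function.update a s u) = Function.update (F a) t (L u)) :
    MultilinearMap k (fun _ : Fin p => A) M where
  toFun a := g (F a)
  map_update_add' := by
    intro inst a s u v
    obtain rfl : inst = instDecidableEqFin p := Subsingleton.elim _ _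
    obtain ⟨t, L, h⟩ := hF a s
    simp only [h, map_add, MultilinearMap.map_update_add]
  map_update_smul' := by
    intro inst a s c u
    obtain rfl : inst = instDecidableEqFin p := Subsingleton.elim _ _
    obtain ⟨t, L, h⟩ := hF a s
    simp only [h, map_smul, MultilinearMap.map_update_smul]

/-- `(a₀, …, aₚ) ↦ (a₀, …, aᵢ aᵢ₊₁, …, aₚ)`. -/
def mulFace {p : ℕ} (i : Fin p) (a : Fin (p + 1) → A) : Fin p → A := fun j =>
  if (j : ℕ) < i then a j.castSucc
  else if (j : ℕ) = i then a j.castSucc * a j.succ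
  else a j.succ

/-- `(a₀, …, aₚ₊₁) ↦ (aₚ₊₁ a₀, a₁, …, aₚ)`. -/
def lastFace {p : ℕ} (a : Fin (p + 2) → A) : Fin (p + 1) → A := fun j =>
  if (j : ℕ) = 0 then a (Fin.last (p + 1)) * a 0 else a j.castSucc

/-- `(a₀, …, aₙ₊ₘ) ↦ (a₀ f(a₁, …, aₙ), aₙ₊₁, …, aₙ₊ₘ)`. -/
def capTuple {n m p : ℕ} (h : p = n + m) (f : Cochain k A n) (a : Fin (p + 1) → A) :
    Fin (m + 1) → A := fun j =>
  if (j : ℕ) = 0 then a 0 * f (fun i => a ⟨i + 1, by omega⟩) else a ⟨n + j, by omega⟩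

theorem mulFace_update {p : ℕ} (i : Fin p) (a : Fin (p + 1) → A) (s : Fin (p + 1)) :
    ∃ (t : Fin p) (L : A →ₗ[k] A), ∀ u : A,
      mulFace i (Function.update a s u) = Function.update (mulFace i a) t (L u) := by
  rcases lt_trichotomy (s : ℕ) i with h | h | h
  · refine ⟨⟨s, by omega⟩, LinearMap.id, fun u => ?_⟩
    ext j
    simp only [mulFace, Function.update_apply, Fin.ext_iff, Fin.val_castSucc, Fin.val_succ,
      LinearMap.id_apply]
    split_ifs <;> first | rfl | omega
  · refine ⟨i, (LinearMap.mulRight k (a i.succ)), fun u => ?_⟩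
    ext j
    simp only [mulFace, Function.update_apply, Fin.ext_iff, Fin.val_castSucc, Fin.val_succ,
      LinearMap.mulRight_apply]
    split_ifs with h1 h2 h3 h4 h5 h6 <;> first | rfl | omega | skip
    obtain rfl : j = i := Fin.ext (by omega)
    rfl
  · by_cases h' : (s : ℕ) = i + 1
    · refine ⟨i, (LinearMap.mulLeft k (a i.castSucc)), fun u => ?_⟩
      ext j
      simp only [mulFace, Function.update_apply, Fin.ext_iff, Fin.val_castSucc, Fin.val_succ,
        LinearMap.mulLeft_apply]
      split_ifs with h1 h2 h3 h4 h5 h6 <;> first | rfl | omega | skip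
      obtain rfl : j = i := Fin.ext (by omega)
      rfl
    · refine ⟨⟨s - 1, by omega⟩, LinearMap.id, fun u => ?_⟩
      ext j
      simp only [mulFace, Function.update_apply, Fin.ext_iff, Fin.val_castSucc, Fin.val_succ,
        LinearMap.id_apply]
      split_ifs <;> first | rfl | omega

theorem lastFace_update {p : ℕ} (a : Fin (p + 2) → A) (s : Fin (p + 2)) :
    ∃ (t : Fin (p + 1)) (L : A →ₗ[k] A), ∀ u : A,
      lastFace (Function.update a s u) = Function.update (lastFace a) t (L u) := by
  by_cases h0 : (s : ℕ) = 0
  · refine ⟨0, LinearMap.mulLeft k (a (Fin.last _)), fun u => ?_⟩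
    ext j
    simp only [lastFace, Function.update_apply, Fin.ext_iff, Fin.val_castSucc, Fin.val_last,
      Fin.val_zero, LinearMap.mulLeft_apply]
    split_ifs <;> first | rfl | omega
  · by_cases h1 : (s : ℕ) = p + 1
    · refine ⟨0, LinearMap.mulRight k (a 0), fun u => ?_⟩
      ext j
      simp only [lastFace, Function.update_apply, Fin.ext_iff, Fin.val_castSucc, Fin.val_last,
        Fin.val_zero, LinearMap.mulRight_apply]
      split_ifs <;> first | rfl | omega
    · refine ⟨⟨s, by omega⟩, LinearMap.id, fun u => ?_⟩
      ext j
      simp only [lastFace, Function.update_apply, Fin.ext_iff, Fin.val_castSucc, Fin.val_last,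
        Fin.val_zero, LinearMap.id_apply]
      split_ifs <;> first | rfl | omega

theorem capTuple_update {n m p : ℕ} (h : p = n + m) (f : Cochain k A n) (a : Fin (p + 1) → A)
    (s : Fin (p + 1)) :
    ∃ (t : Fin (m + 1)) (L : A →ₗ[k] A), ∀ u : A,
      capTuple h f (Function.update a s u) = Function.update (capTuple h f a) t (L u) := by
  by_cases h0 : (s : ℕ) = 0
  · refine ⟨0, LinearMap.mulRight k (f (fun i => a ⟨i + 1, by omega⟩)), fun u => ?_⟩
    ext j
    simp only [capTuple, Function.update_apply, Fin.ext_iff, Fin.val_zero,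
      LinearMap.mulRight_apply, h0]
    split_ifs <;> first | rfl | omega | simp_all
  · by_cases h1 : (s : ℕ) ≤ n
    · refine ⟨0, (LinearMap.mulLeft k (a 0)).comp
        (f.toLinearMap (fun i => a ⟨i + 1, by omega⟩) ⟨s - 1, by omega⟩), fun u => ?_⟩
      have key : (fun i : Fin n => Function.update a s u ⟨i + 1, by omega⟩) =
          Function.update (fun i : Fin n => a ⟨i + 1, by omega⟩) ⟨s - 1, by omega⟩ u := by
        ext i
        simp only [Function.update_apply, Fin.ext_iff]
        split_ifs <;> first | rfl | omega
      ext j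
      simp only [capTuple, key]
      simp only [Function.update_apply, Fin.ext_iff, Fin.val_zero, LinearMap.comp_apply,
        LinearMap.mulLeft_apply, MultilinearMap.toLinearMap_apply]
      split_ifs <;> first | rfl | omega | simp_all [capTuple]
    · refine ⟨⟨s - n, by omega⟩, LinearMap.id, fun u => ?_⟩
      have key : (fun i : Fin n => Function.update a s u ⟨i + 1, by omega⟩) =
          (fun i : Fin n => a ⟨i + 1, by omega⟩) := by
        ext i
        simp only [Function.update_apply, Fin.ext_iff]
        split_ifs <;> first | rfl | omega
      ext j
      simp only [capTuple, key]
      simp only [Function.update_apply, Fin.ext_iff, Fin.val_zero, LinearMap.id_apply]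
      split_ifs <;> first | rfl | omega | simp_all [capTuple]

variable (k A)

/-- The Hochschild differential `A ^ ⊗ (p + 2) → A ^ ⊗ (p + 1)`:
`a₀ ⊗ ⋯ ⊗ aₚ₊₁ ↦ ∑ (-1)ⁱ a₀ ⊗ ⋯ ⊗ aᵢ aᵢ₊₁ ⊗ ⋯ ⊗ aₚ₊₁ + (-1)ᵖ⁺¹ aₚ₊₁ a₀ ⊗ a₁ ⊗ ⋯ ⊗ aₚ`. -/
noncomputable def boundary (p : ℕ) : Chain k A (p + 1) →ₗ[k] Chain k A p :=
  PiTensorProduct.lift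
    (∑ i : Fin (p + 1), (-1 : k) ^ (i : ℕ) •
        precompSlots (PiTensorProduct.tprod k) (mulFace i) (mulFace_update i)
      + (-1 : k) ^ (p + 1) • precompSlots (PiTensorProduct.tprod k) lastFace lastFace_update)

theorem boundary_tprod (p : ℕ) (a : Fin (p + 2) → A) :
    boundary k A p (PiTensorProduct.tprod k a) =
      ∑ i : Fin (p + 1), (-1 : k) ^ (i : ℕ) • PiTensorProduct.tprod k (mulFace i a)
        + (-1 : k) ^ (p + 1) • PiTensorProduct.tprod k (lastFace a) := by
  simp [boundary, precompSlots]

variable {k A}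

/-- A function of tuples that is linear in each entry, as a multilinear map. -/
def ofSlots {p : ℕ} (G : (Fin p → A) → A)
    (hG : ∀ (a : Fin p → A) (s : Fin p), ∃ L : A →ₗ[k] A, ∀ u : A,
      G (Function.update a s u) = L u) : Cochain k A p where
  toFun := G
  map_update_add' := by
    intro inst a s u v
    obtain rfl : inst = instDecidableEqFin p := Subsingleton.elim _ _
    obtain ⟨L, h⟩ := hG a s
    simp only [h, map_add]
  map_update_smul' := by
    intro inst a s c u
    obtain rfl : inst = instDecidableEqFin p := Subsingleton.elim _ _
    obtain ⟨L, h⟩ := hG a s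
    simp only [h, map_smul]

theorem headMul_update {n : ℕ} (f : Cochain k A n) (a : Fin (n + 1) → A) (s : Fin (n + 1)) :
    ∃ L : A →ₗ[k] A, ∀ u : A,
      (fun b : Fin (n + 1) → A => b 0 * f (fun i => b i.succ)) (Function.update a s u) = L u := by
  induction s using Fin.cases with
  | zero =>
    refine ⟨LinearMap.mulRight k (f (fun i => a i.succ)), fun u => ?_⟩
    simp [Fin.succ_ne_zero]
  | succ s =>
    refine ⟨(LinearMap.mulLeft k (a 0)).comp (f.toLinearMap (fun i => a i.succ) s), fun u => ?_⟩
    have key : (fun i : Fin n => Function.update a s.succ u i.succ) =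
        Function.update (fun i : Fin n => a i.succ) s u := by
      ext i
      simp [Function.update_apply]
    have h0 : Function.update a s.succ u 0 = a 0 := by simp [(Fin.succ_ne_zero s).symm]
    simp only [key, h0, LinearMap.comp_apply, LinearMap.mulLeft_apply,
      MultilinearMap.toLinearMap_apply]

theorem mulLast_update {n : ℕ} (f : Cochain k A n) (a : Fin (n + 1) → A) (s : Fin (n + 1)) :
    ∃ L : A →ₗ[k] A, ∀ u : A,
      (fun b : Fin (n + 1) → A => f (fun i => b i.castSucc) * b (Fin.last n))
        (Function.update a s u) = L u := by
  induction s using Fin.lastCases with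
  | last =>
    refine ⟨LinearMap.mulLeft k (f (fun i => a i.castSucc)), fun u => ?_⟩
    simp [Fin.castSucc_ne_last]
  | cast s =>
    refine ⟨(LinearMap.mulRight k (a (Fin.last n))).comp
      (f.toLinearMap (fun i => a i.castSucc) s), fun u => ?_⟩
    have key : (fun i : Fin n => Function.update a s.castSucc u i.castSucc) =
        Function.update (fun i : Fin n => a i.castSucc) s u := by
      ext i
      simp [Function.update_apply]
    have h0 : Function.update a s.castSucc u (Fin.last n) = a (Fin.last n) := by
      simp [(Fin.castSucc_ne_last s).symm]
    simp only [key, h0, LinearMap.comp_apply, LinearMap.mulRight_apply,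
      MultilinearMap.toLinearMap_apply]

variable (k A)

/-- The Hochschild codifferential: `(df)(a₁, …, aₙ₊₁) = a₁ f(a₂, …, aₙ₊₁)
+ ∑ (-1)ⁱ f(a₁, …, aᵢ aᵢ₊₁, …, aₙ₊₁) + (-1)ⁿ⁺¹ f(a₁, …, aₙ) aₙ₊₁`. -/
def coboundary (n : ℕ) : Cochain k A n →ₗ[k] Cochain k A (n + 1) where
  toFun f := ofSlots (fun a => a 0 * f (fun i => a i.succ)) (headMul_update f)
    + ∑ i : Fin n, (-1 : k) ^ ((i : ℕ) + 1) • precompSlots f (mulFace i) (mulFace_update i)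
    + (-1 : k) ^ (n + 1) •
        ofSlots (fun a => f (fun i => a i.castSucc) * a (Fin.last n)) (mulLast_update f)
  map_add' f g := by
    ext a
    simp [ofSlots, precompSlots, mul_add, add_mul, Finset.sum_add_distrib]
    abel
  map_smul' c f := by
    ext a
    simp [ofSlots, precompSlots, Finset.smul_sum, smul_comm c]

theorem coboundary_apply (n : ℕ) (f : Cochain k A n) (a : Fin (n + 1) → A) :
    coboundary k A n f a = a 0 * f (fun i => a i.succ)
      + ∑ i : Fin n, (-1 : k) ^ ((i : ℕ) + 1) • f (mulFace i a)
      + (-1 : k) ^ (n + 1) • (f (fun i => a i.castSucc) * a (Fin.last n)) := by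
  simp [coboundary, ofSlots, precompSlots]

/-- Hochschild cycles. -/
noncomputable def cycles : (p : ℕ) → Submodule k (Chain k A p)
  | 0 => ⊤
  | p + 1 => LinearMap.ker (boundary k A p)

/-- Hochschild boundaries. -/
noncomputable def boundaries (p : ℕ) : Submodule k (Chain k A p) :=
  LinearMap.range (boundary k A p)

/-- Hochschild cocycles. -/
def cocycles (n : ℕ) : Submodule k (Cochain k A n) := LinearMap.ker (coboundary k A n)

/-- Hochschild coboundaries. -/
def coboundaries : (n : ℕ) → Submodule k (Cochain k A n)
  | 0 => ⊥
  | n + 1 => LinearMap.range (coboundary k A n)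

/-- Hochschild homology `HH_p(A)`. -/
abbrev Homology (p : ℕ) := Subquotient (cycles k A p) (boundaries k A p)

/-- Hochschild cohomology of `A` in cohomological degree `n`. -/
abbrev Cohomology (n : ℕ) := Subquotient (cocycles k A n) (coboundaries k A n)

variable {A}

/-- The cap product of cochains and chains,
`f ∩ (a₀ ⊗ ⋯ ⊗ aₙ₊ₘ) = a₀ f(a₁, …, aₙ) ⊗ aₙ₊₁ ⊗ ⋯ ⊗ aₙ₊ₘ`. -/
noncomputable def capChain {n m p : ℕ} (h : p = n + m) :
    Cochain k A n →ₗ[k] Chain k A p →ₗ[k] Chain k A m where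
  toFun f := PiTensorProduct.lift
    (precompSlots (PiTensorProduct.tprod k) (capTuple h f) (capTuple_update h f))
  map_add' f g := by
    ext a
    have h0 : capTuple h (f + g) a = Function.update (capTuple h f a) 0
        (a 0 * f (fun i => a ⟨i + 1, by omega⟩) + a 0 * g (fun i => a ⟨i + 1, by omega⟩)) := by
      ext j
      simp only [capTuple, Function.update_apply, Fin.ext_iff, Fin.val_zero]
      split_ifs <;> simp [mul_add]
    have h1 : Function.update (capTuple h f a) 0 (a 0 * f (fun i => a ⟨i + 1, by omega⟩)) =
        capTuple h f a := by
      ext j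
      simp only [capTuple, Function.update_apply, Fin.ext_iff, Fin.val_zero]
      split_ifs <;> simp
    have h2 : Function.update (capTuple h f a) 0 (a 0 * g (fun i => a ⟨i + 1, by omega⟩)) =
        capTuple h g a := by
      ext j
      simp only [capTuple, Function.update_apply, Fin.ext_iff, Fin.val_zero]
      split_ifs <;> simp
    simp only [LinearMap.compMultilinearMap_apply, PiTensorProduct.lift.tprod, LinearMap.add_apply]
    simp only [precompSlots, MultilinearMap.coe_mk]
    rw [h0, MultilinearMap.map_update_add, h1, h2]
  map_smul' c f := by
    ext a
    have h0 : capTuple h (c • f) a = Function.update (capTuple h f a) 0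
        (c • (a 0 * f (fun i => a ⟨i + 1, by omega⟩))) := by
      ext j
      simp only [capTuple, Function.update_apply, Fin.ext_iff, Fin.val_zero]
      split_ifs <;> simp
    have h1 : Function.update (capTuple h f a) 0 (a 0 * f (fun i => a ⟨i + 1, by omega⟩)) =
        capTuple h f a := by
      ext j
      simp only [capTuple, Function.update_apply, Fin.ext_iff, Fin.val_zero]
      split_ifs <;> simp
    simp only [LinearMap.compMultilinearMap_apply, PiTensorProduct.lift.tprod,
      LinearMap.smul_apply, RingHom.id_apply]
    simp only [precompSlots, MultilinearMap.coe_mk]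
    rw [h0, MultilinearMap.map_update_smul, h1]

theorem capChain_tprod {n m p : ℕ} (h : p = n + m) (f : Cochain k A n) (a : Fin (p + 1) → A) :
    capChain k h f (PiTensorProduct.tprod k a) = PiTensorProduct.tprod k (capTuple h f a) := by
  simp [capChain, precompSlots]

theorem capChain_coboundary {n m p : ℕ} (h : p = n + m) (h' : p + 1 = n + 1 + m)
    (h'' : p + 1 = n + (m + 1)) (f : Cochain k A n) (c : Chain k A (p + 1)) :
    capChain k h' (coboundary k A n f) c = capChain k h f (boundary k A p c)
      - (-1 : k) ^ n • boundary k A m (capChain k h'' f c) := by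
  suffices hs : capChain k h' (coboundary k A n f) =
      capChain k h f ∘ₗ boundary k A p - (-1 : k) ^ n • boundary k A m ∘ₗ capChain k h'' f by
    rw [hs]; rfl
  ext a
  let base : Fin (m + 1) → A := fun j => a ⟨n + 1 + j, by omega⟩
  let ψ : A →ₗ[k] Chain k A m := (PiTensorProduct.tprod k).toLinearMap base 0
  have hψ : ∀ (F : Fin (m + 1) → A) (v : A), F 0 = v →
      (∀ j : Fin (m + 1), (j : ℕ) ≠ 0 → F j = a ⟨n + 1 + j, by omega⟩) →
      PiTensorProduct.tprod k F = ψ v := by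
    intro F v h1 h2
    have : F = Function.update base 0 v := by
      ext j
      by_cases hj : j = 0
      · subst hj; simp [h1]
      · rw [h2 j (fun h => hj (Fin.ext h))]; simp [hj, base]
    rw [this]; rfl
  let a' : Fin (n + 1) → A := fun i => a ⟨i + 1, by omega⟩
  have e1 : PiTensorProduct.tprod k (capTuple h' (coboundary k A n f) a) =
      ψ (a 0 * a' 0 * f (fun i => a' i.succ))
      + ∑ i : Fin n, (-1 : k) ^ ((i : ℕ) + 1) • ψ (a 0 * f (mulFace i a'))
      + (-1 : k) ^ (n + 1) • ψ (a 0 * f (fun i => a' i.castSucc) * a' (Fin.last n)) := by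
    rw [hψ _ (a 0 * coboundary k A n f a') (by simp [capTuple, a'])
      (by intro j hj; simp [capTuple, hj])]
    rw [coboundary_apply]
    simp only [mul_add, map_add, Finset.mul_sum, map_sum, mul_smul_comm, map_smul, mul_assoc]
  have e2 : ∀ hp : 0 < p + 1, PiTensorProduct.tprod k (capTuple h f (mulFace ⟨0, hp⟩ a)) =
      ψ (a 0 * a' 0 * f (fun i => a' i.succ)) := by
    intro hp
    apply hψ
    · simp only [capTuple, mulFace, a']
      simp
    · intro j hj
      simp only [capTuple, mulFace, hj, if_false]
      have : ¬ (n + (j : ℕ) = 0) := by omega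
      simp only [this, if_false, not_lt_zero]
      exact congrArg a (Fin.ext (by simp; omega))
  have e3 : ∀ (i : Fin n) (hi : (i : ℕ) + 1 < p + 1),
      PiTensorProduct.tprod k (capTuple h f (mulFace ⟨i + 1, hi⟩ a)) =
      ψ (a 0 * f (mulFace i a')) := by
    intro i hi
    apply hψ
    · have : (fun l : Fin n => mulFace ⟨(i : ℕ) + 1, hi⟩ a ⟨(l : ℕ) + 1, by omega⟩) =
          mulFace i a' := by
        ext l
        simp only [mulFace, a', add_lt_add_iff_right, add_left_inj]
        rfl
      simp only [capTuple, this]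
      simp [mulFace]
    · intro j hj
      simp only [capTuple, mulFace, hj, if_false]
      have h1 : ¬ (n + (j : ℕ) < i + 1) := by omega
      have h2 : ¬ (n + (j : ℕ) = i + 1) := by omega
      simp only [h1, h2, if_false]
      exact congrArg a (Fin.ext (by simp; omega))
  have e4 : ∀ (j : Fin m) (hj : n + 1 + (j : ℕ) < p + 1),
      capTuple h f (mulFace ⟨n + 1 + j, hj⟩ a) = mulFace j.succ (capTuple h'' f a) := by
    intro i hi
    ext j
    have : (fun l : Fin n => mulFace ⟨n + 1 + (i : ℕ), hi⟩ a ⟨(l : ℕ) + 1, by omega⟩) =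
        fun l : Fin n => a ⟨(l : ℕ) + 1, by omega⟩ := by
      ext l
      have h1 : (l : ℕ) + 1 < n + 1 + i := by omega
      simp only [mulFace, h1, if_true]
      rfl
    by_cases h0 : (j : ℕ) = 0
    · have h1 : (0 : ℕ) < n + 1 + i := by omega
      have h2 : (j : ℕ) < i + 1 := by omega
      simp only [capTuple, this, h0, if_true]
      have r : capTuple h'' f a j.castSucc = a 0 * f (fun i => a ⟨i + 1, by omega⟩) := by
        simp only [capTuple, Fin.val_castSucc, h0, if_true]
      simp only [mulFace, Fin.val_zero, h1, if_true, Fin.val_succ, h2, r]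
      rfl
    · have q1 : n + (j : ℕ) < n + 1 + i ↔ (j : ℕ) < i + 1 := by omega
      have q2 : n + (j : ℕ) = n + 1 + i ↔ (j : ℕ) = i + 1 := by omega
      have r1 : (capTuple h'' f a j.castSucc) = a ⟨n + j, by omega⟩ := by
        simp only [capTuple, Fin.val_castSucc, h0, if_false]
      have r2 : (capTuple h'' f a j.succ) = a ⟨n + (j + 1), by omega⟩ := by
        simp only [capTuple, Fin.val_succ, Nat.succ_ne_zero, if_false]
      simp only [capTuple, h0, if_false]
      simp only [mulFace, Fin.val_succ, q1, q2, r1, r2]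
      rfl
  have e5 : capTuple h f (lastFace a) = lastFace (capTuple h'' f a) := by
    ext j
    have : (fun l : Fin n => lastFace a ⟨(l : ℕ) + 1, by omega⟩) =
        fun l : Fin n => a ⟨(l : ℕ) + 1, by omega⟩ := by
      ext l
      simp only [lastFace, Nat.succ_ne_zero, if_false]
      rfl
    by_cases h0 : (j : ℕ) = 0
    · have r1 : capTuple h'' f a (Fin.last (m + 1)) = a (Fin.last (p + 1)) := by
        simp only [capTuple, Fin.val_last, Nat.succ_ne_zero, if_false]
        exact congrArg a (Fin.ext (by simp; omega))
      have r2 : capTuple h'' f a 0 = a 0 * f (fun i => a ⟨i + 1, by omega⟩) := by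
        simp [capTuple]
      simp only [capTuple, h0, if_true, this]
      simp only [lastFace, Fin.val_zero, h0, if_true, r1, r2, mul_assoc]
    · have q : ¬ (n + (j : ℕ) = 0) := by omega
      simp only [capTuple, h0, if_false, lastFace, q, Fin.val_castSucc]
      rfl
  have e6 : PiTensorProduct.tprod k (mulFace 0 (capTuple h'' f a)) =
      ψ (a 0 * f (fun i => a' i.castSucc) * a' (Fin.last n)) := by
    apply hψ
    · have r1 : capTuple h'' f a (Fin.succ 0) = a ⟨n + 1, by omega⟩ := by
        simp only [capTuple, Fin.val_succ, Nat.succ_ne_zero, if_false, Fin.val_zero]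
      have r2 : capTuple h'' f a (Fin.castSucc 0) = a 0 * f (fun i => a ⟨i + 1, by omega⟩) := by
        simp [capTuple]
      simp only [mulFace, Fin.val_zero, lt_irrefl, if_false, if_true, r1, r2]
      rfl
    · intro j hj
      simp only [mulFace, capTuple, Fin.val_zero, not_lt_zero, hj, if_false, Fin.val_succ]
      rw [if_neg (by omega)]
      exact congrArg a (Fin.ext (by simp; omega))
  simp only [LinearMap.compMultilinearMap_apply, LinearMap.sub_apply, LinearMap.smul_apply,
    LinearMap.comp_apply, boundary_tprod, capChain_tprod, map_add, map_sum, map_smul]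
  rw [e1, e5, Fin.sum_univ_succ (n := m), e6]
  have e7 : ∑ i : Fin (p + 1), (-1 : k) ^ (i : ℕ) •
      PiTensorProduct.tprod k (capTuple h f (mulFace i a)) =
      ψ (a 0 * a' 0 * f (fun i => a' i.succ))
      + ∑ i : Fin n, (-1 : k) ^ ((i : ℕ) + 1) • ψ (a 0 * f (mulFace i a'))
      + ∑ j : Fin m, (-1 : k) ^ (n + 1 + (j : ℕ)) •
          PiTensorProduct.tprod k (mulFace j.succ (capTuple h'' f a)) := by
    let G : ℕ → Chain k A m := fun i => if hi : i < p + 1 then (-1 : k) ^ i •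
      PiTensorProduct.tprod k (capTuple h f (mulFace ⟨i, hi⟩ a)) else 0
    have g1 : ∑ i : Fin (p + 1), (-1 : k) ^ (i : ℕ) •
        PiTensorProduct.tprod k (capTuple h f (mulFace i a)) = ∑ i ∈ Finset.range (p + 1), G i := by
      rw [Finset.sum_range]
      refine Finset.sum_congr rfl fun i _ => ?_
      simp only [G, i.isLt, dif_pos]
    have g2 : p + 1 = (n + 1) + m := by omega
    have g3 : ∑ i ∈ Finset.range (p + 1), G i = ∑ i ∈ Finset.range ((n + 1) + m), G i := by
      rw [← g2]
    rw [g1, g3, Finset.sum_range_add, Finset.sum_range_succ', Finset.sum_range, Finset.sum_range]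
    rw [add_comm (∑ i : Fin n, G (i + 1))]
    congr 1
    · congr 1
      · simp only [G, Nat.succ_pos, dif_pos, pow_zero, one_smul]
        exact e2 _
      · refine Finset.sum_congr rfl fun i _ => ?_
        have : (i : ℕ) + 1 < p + 1 := by omega
        simp only [G, this, dif_pos]
        rw [e3]
    · refine Finset.sum_congr rfl fun j _ => ?_
      have : n + 1 + (j : ℕ) < p + 1 := by omega
      simp only [G, this, dif_pos]
      rw [e4]
  have e9 : (-1 : k) ^ (p + 1) = (-1) ^ (n + (m + 1)) := by rw [h'']
  rw [e7, e9]
  simp only [Fin.val_zero, pow_zero, one_smul, smul_add, Finset.smul_sum, smul_smul, Fin.val_succ,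
    ← pow_add]
  have e8 : ∀ j : Fin m, n + 1 + (j : ℕ) = n + ((j : ℕ) + 1) := fun j => by omega
  simp only [e8, add_assoc, pow_succ, mul_neg, mul_one, neg_smul]
  abel

theorem capChain_mem_cycles {n m p : ℕ} (h : p = n + m) {f : Cochain k A n}
    (hf : f ∈ cocycles k A n) {c : Chain k A p} (hc : c ∈ cycles k A p) :
    capChain k h f c ∈ cycles k A m := by
  cases m with
  | zero => exact Submodule.mem_top
  | succ m =>
    subst h
    have hf' : coboundary k A n f = 0 := hf
    have hc' : boundary k A (n + m) c = 0 := hc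
    have := capChain_coboundary k (A := A) (n := n) (m := m) (p := n + m) rfl (by omega) rfl f c
    rw [hf', hc', map_zero, map_zero, LinearMap.zero_apply, zero_sub, eq_comm, neg_eq_zero] at this
    have h2 : (-1 : k) ^ n * (-1 : k) ^ n = 1 := by rw [← mul_pow]; simp
    have h3 := congrArg (fun v => (-1 : k) ^ n • v) this
    simp only [smul_smul, h2, one_smul, smul_zero] at h3
    exact h3

theorem capChain_mem_boundaries {n m p : ℕ} (h : p = n + m) {f : Cochain k A n}
    (hf : f ∈ cocycles k A n) {c : Chain k A p} (hc : c ∈ boundaries k A p) :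
    capChain k h f c ∈ boundaries k A m := by
  obtain ⟨e, rfl⟩ := hc
  have hf' : coboundary k A n f = 0 := hf
  have := capChain_coboundary k (A := A) h (by omega) (by omega) f e
  rw [hf', map_zero, LinearMap.zero_apply, eq_comm, sub_eq_zero] at this
  rw [this]
  exact Submodule.smul_mem _ _ ⟨_, rfl⟩

theorem capChain_coboundaries {n m p : ℕ} (h : p = n + m) {f : Cochain k A n}
    (hf : f ∈ coboundaries k A n) {c : Chain k A p} (hc : c ∈ cycles k A p) :
    capChain k h f c ∈ boundaries k A m := by
  cases n with
  | zero =>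
    have : f = 0 := hf
    rw [this, map_zero, LinearMap.zero_apply]
    exact Submodule.zero_mem _
  | succ n =>
    obtain ⟨g, rfl⟩ := hf
    obtain ⟨p, rfl⟩ : ∃ q, p = q + 1 := ⟨n + m, by omega⟩
    have hc' : boundary k A p c = 0 := hc
    rw [capChain_coboundary k (by omega) h (by omega), hc', map_zero, zero_sub]
    exact Submodule.neg_mem _ (Submodule.smul_mem _ _ ⟨_, rfl⟩)

/-- The cap product `HH^{-n}(A) ⊗ HH_p(A) → HH_m(A)`, `p = n + m`, induced by `capChain`. -/
noncomputable def cap {n m p : ℕ} (h : p = n + m) :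
    Cohomology k A n →ₗ[k] Homology k A p →ₗ[k] Homology k A m :=
  Subquotient.map₂ (capChain k h) (fun _ hf _ hc => capChain_mem_cycles k h hf hc)
    (fun _ hf _ hc => capChain_mem_boundaries k h hf hc)
    (fun _ hf _ hc => capChain_coboundaries k h hf hc)

end General
end Hochschild

namespace IyuduShkarin

open Hochschild

section Algebra

variable (k : Type*) [Field k]

/-- The relations `x² + yx = 0`, `xz = 0`, `zy = 0` between the generators
`x = ι 0`, `y = ι 1`, `z = ι 2`. -/
inductive Rel : FreeAlgebra k (Fin 3) → FreeAlgebra k (Fin 3) → Prop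
  | xx : Rel (FreeAlgebra.ι k 0 * FreeAlgebra.ι k 0 + FreeAlgebra.ι k 1 * FreeAlgebra.ι k 0) 0
  | xz : Rel (FreeAlgebra.ι k 0 * FreeAlgebra.ι k 2) 0
  | zy : Rel (FreeAlgebra.ι k 2 * FreeAlgebra.ι k 1) 0

/-- The algebra `k⟨x, y, z⟩ / (x² + yx, xz, zy)`. -/
def Alg := RingQuot (Rel k)

instance : Ring (Alg k) := inferInstanceAs (Ring (RingQuot (Rel k)))

instance : Algebra k (Alg k) := inferInstanceAs (Algebra k (RingQuot (Rel k)))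

/-- The quotient map from the free algebra. -/
def proj : FreeAlgebra k (Fin 3) →ₐ[k] Alg k := RingQuot.mkAlgHom k (Rel k)

theorem proj_rel {a b : FreeAlgebra k (Fin 3)} (h : Rel k a b) : proj k a = proj k b :=
  RingQuot.mkAlgHom_rel k h

variable {k}

/-- The generators of the algebra. -/
def gen (i : Fin 3) : Alg k := proj k (FreeAlgebra.ι k i)

/-- The generator `x`. -/
abbrev x : Alg k := gen 0
/-- The generator `y`. -/
abbrev y : Alg k := gen 1
/-- The generator `z`. -/
abbrev z : Alg k := gen 2

theorem x_mul_x : (x * x : Alg k) = -(y * x) := by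
  have := proj_rel k (Rel.xx (k := k))
  simp only [map_add, map_mul, map_zero] at this
  exact eq_neg_of_add_eq_zero_left this

theorem x_mul_z : (x * z : Alg k) = 0 := by
  have := proj_rel k (Rel.xz (k := k))
  rwa [map_mul, map_zero] at this

theorem z_mul_y : (z * y : Alg k) = 0 := by
  have := proj_rel k (Rel.zy (k := k))
  rwa [map_mul, map_zero] at this

theorem x_mul_y_pow_mul_x (n : ℕ) : (x * y ^ n * x : Alg k) = -(y ^ (n + 1) * x) := by
  induction n with
  | zero => simp [x_mul_x]
  | succ n ih =>
    have h1 : (x * x * y ^ n * x : Alg k) = x * (x * y ^ n * x) := by noncomm_ring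
    rw [ih, x_mul_x] at h1
    have h2 : (-(y * x) * y ^ n * x : Alg k) = -(y * (x * y ^ n * x)) := by noncomm_ring
    rw [h2, ih] at h1
    have h3 : (x * -(y ^ (n + 1) * x) : Alg k) = -(x * y ^ (n + 1) * x) := by noncomm_ring
    rw [h3] at h1
    have h4 : (-(y * -(y ^ (n + 1) * x)) : Alg k) = y ^ (n + 1 + 1) * x := by
      rw [pow_succ' y (n + 1)]; noncomm_ring
    rw [h4] at h1
    rw [h1, neg_neg]

theorem z_mul_y_pow (n : ℕ) (hn : n ≠ 0) : (z * y ^ n : Alg k) = 0 := by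
  obtain ⟨m, rfl⟩ := Nat.exists_eq_succ_of_ne_zero hn
  rw [pow_succ', ← mul_assoc, z_mul_y, zero_mul]

theorem x_mul_z_pow (n : ℕ) (hn : n ≠ 0) : (x * z ^ n : Alg k) = 0 := by
  obtain ⟨m, rfl⟩ := Nat.exists_eq_succ_of_ne_zero hn
  rw [pow_succ', ← mul_assoc, x_mul_z, zero_mul]

theorem z_pow_mul_y (n : ℕ) (hn : n ≠ 0) : (z ^ n * y : Alg k) = 0 := by
  obtain ⟨m, rfl⟩ := Nat.exists_eq_succ_of_ne_zero hn
  rw [pow_succ, mul_assoc, z_mul_y, mul_zero]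

/-! ### Classes in Hochschild homology of degrees `0` and `1` -/

/-- The class of `a` in `HH_0`. -/
noncomputable def zeroClass (a : Alg k) : Homology k (Alg k) 0 :=
  Subquotient.mk _ _ ⟨PiTensorProduct.tprod k (fun _ => a), Submodule.mem_top⟩

/-- The Hochschild chain `a ⊗ x + b ⊗ y + c ⊗ z`. -/
noncomputable def oneChain (v : Fin 3 → Alg k) : Chain k (Alg k) 1 :=
  ∑ i, PiTensorProduct.tprod k ![v i, gen i]

theorem oneChain_mem_cycles (v : Fin 3 → Alg k)
    (h : ∑ i, (v i * gen i - gen i * v i) = 0) : oneChain v ∈ cycles k (Alg k) 1 := by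
  change boundary k (Alg k) 0 (oneChain v) = 0
  have key : ∀ a b : Alg k, boundary k (Alg k) 0 (PiTensorProduct.tprod k ![a, b]) =
      (PiTensorProduct.subsingletonEquiv (R := k) (s := fun _ => Alg k) (0 : Fin 1)).symm (a * b - b * a) := by
    intro a b
    rw [boundary_tprod, map_sub]
    simp only [PiTensorProduct.subsingletonEquiv_symm_apply']
    have h1 : ∀ i : Fin (0 + 1), mulFace i ![a, b] = fun _ : Fin 1 => a * b := by
      intro i; ext j; fin_cases i; fin_cases j; simp [mulFace]
    have h2 : lastFace ![a, b] = fun _ : Fin 1 => b * a := by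
      ext j; fin_cases j; simp [lastFace]
    simp only [h1, h2]
    simp [sub_eq_add_neg]
  simp only [oneChain, map_sum, key]
  rw [← map_sum, h, map_zero]

/-- The class of `a ⊗ x + b ⊗ y + c ⊗ z` in `HH_1`. -/
noncomputable def oneClass (v : Fin 3 → Alg k)
    (h : ∑ i, (v i * gen i - gen i * v i) = 0) : Homology k (Alg k) 1 :=
  Subquotient.mk _ _ ⟨oneChain v, oneChain_mem_cycles v h⟩

/-! ### Classes in Hochschild cohomology of degrees `0` and `1` -/

/-- The class of the `0`-cocycle `1`, the unit of Hochschild cohomology. -/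
def unitClass : Cohomology k (Alg k) 0 :=
  Subquotient.mk _ _ ⟨MultilinearMap.constOfIsEmpty k _ 1, by
    change coboundary k (Alg k) 0 _ = 0
    ext a
    simp [coboundary_apply]⟩

/-- The condition on `v = (v_x, v_y, v_z)` for `x ↦ v_x`, `y ↦ v_y`, `z ↦ v_z` to be compatible
with the relations of the algebra. -/
structure IsDer (v : Fin 3 → Alg k) : Prop where
  xx : (x + y) * v 0 + v 0 * x + v 1 * x = 0
  xz : x * v 2 + v 0 * z = 0
  zy : z * v 1 + v 2 * y = 0

/-- The homomorphism `a ↦ a + D(a) ε` to the dual numbers of the algebra, for the derivation `D`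
with `D x = v_x`, `D y = v_y` and `D z = v_z`. -/
noncomputable def dualLift (v : Fin 3 → Alg k) (h : IsDer v) :
    Alg k →ₐ[k] TrivSqZeroExt (Alg k) (Alg k) :=
  RingQuot.liftAlgHom k ⟨FreeAlgebra.lift k
    (fun i => TrivSqZeroExt.inl (gen i) + TrivSqZeroExt.inr (v i)), by
      intro a b hab
      induction hab with
      | xx =>
        simp only [map_add, map_mul, map_zero, FreeAlgebra.lift_ι_apply]
        ext
        · simp [x_mul_x]
        · have := h.xx
          simp only [add_mul] at this
          simp
          rw [← this]; abel
      | xz =>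
        simp only [map_mul, map_zero, FreeAlgebra.lift_ι_apply]
        ext
        · simp [x_mul_z]
        · simpa using h.xz
      | zy =>
        simp only [map_mul, map_zero, FreeAlgebra.lift_ι_apply]
        ext
        · simp [z_mul_y]
        · simpa using h.zy⟩

/-- The derivation with `D x = v_x`, `D y = v_y` and `D z = v_z`. -/
noncomputable def derivation (v : Fin 3 → Alg k) (h : IsDer v) : Alg k →ₗ[k] Alg k :=
  TrivSqZeroExt.sndHom (Alg k) (Alg k) ∘ₗ (dualLift v h).toLinearMap

theorem dualLift_gen (v : Fin 3 → Alg k) (h : IsDer v) (i : Fin 3) :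
    dualLift v h (gen i) = TrivSqZeroExt.inl (gen i) + TrivSqZeroExt.inr (v i) := by
  refine (RingQuot.liftAlgHom_mkAlgHom_apply k _ _ _).trans ?_
  rw [FreeAlgebra.lift_ι_apply]

theorem derivation_gen (v : Fin 3 → Alg k) (h : IsDer v) (i : Fin 3) :
    derivation v h (gen i) = v i := by
  simp only [derivation, LinearMap.comp_apply, AlgHom.toLinearMap_apply, dualLift_gen]
  simp

theorem fst_dualLift (v : Fin 3 → Alg k) (h : IsDer v) (a : Alg k) :
    (dualLift v h a).fst = a := by
  have : (TrivSqZeroExt.fstHom k (Alg k) (Alg k)).comp (dualLift v h) = AlgHom.id k (Alg k) := by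
    refine RingQuot.ringQuot_ext' k _ _ (FreeAlgebra.hom_ext (funext fun i => ?_))
    change (dualLift v h (gen i)).fst = gen i
    simp [dualLift_gen]
  exact DFunLike.congr_fun this a

theorem derivation_mul (v : Fin 3 → Alg k) (h : IsDer v) (a b : Alg k) :
    derivation v h (a * b) = a * derivation v h b + derivation v h a * b := by
  simp [derivation, fst_dualLift]

/-- The class in `HH^{-1}` of the cocycle with `x ↦ v_x`, `y ↦ v_y` and `z ↦ v_z`. -/
noncomputable def derClass (v : Fin 3 → Alg k) (h : IsDer v) : Cohomology k (Alg k) 1 :=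
  Subquotient.mk _ _ ⟨MultilinearMap.ofSubsingleton k (Alg k) (Alg k) 0 (derivation v h), by
    change coboundary k (Alg k) 1 _ = 0
    ext a
    simp [coboundary_apply, mulFace, derivation_mul]⟩

/-! ### Words -/

/-- The product `x y^{n_1} z^{m_1} x y^{n_2} z^{m_2} ⋯` over the pairs `(n_j, m_j)` of a list. -/
def block (l : List (ℕ × ℕ)) : Alg k := (l.map fun e => x * y ^ e.1 * z ^ e.2).prod

/-- The product `y^{n_1} z^{m_1} x y^{n_2} z^{m_2} x ⋯` over the pairs `(n_j, m_j)` of a list. -/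
def cyclicWord (l : List (ℕ × ℕ)) : Alg k := (l.map fun e => y ^ e.1 * z ^ e.2 * x).prod

theorem block_nil : (block [] : Alg k) = 1 := rfl

theorem block_cons (e : ℕ × ℕ) (l : List (ℕ × ℕ)) :
    (block (e :: l) : Alg k) = x * y ^ e.1 * z ^ e.2 * block l := by
  simp [block]

theorem block_append (l l' : List (ℕ × ℕ)) :
    (block (l ++ l') : Alg k) = block l * block l' := by
  simp [block]

/-- A list of pairs of positive integers, as a list of pairs of natural numbers. -/
def toNat (l : List (ℕ+ × ℕ+)) : List (ℕ × ℕ) := l.map fun e => ((e.1 : ℕ), (e.2 : ℕ))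

/-! ### Labelled classes in `HH_0` -/

/-- `ζ₀`, the class of `1`. -/
noncomputable def zeta₀ : Homology k (Alg k) 0 := zeroClass 1
/-- `α₀`, the class of `x`. -/
noncomputable def alpha₀ : Homology k (Alg k) 0 := zeroClass x
/-- `β₀(n)`, the class of `yⁿ x`. -/
noncomputable def beta₀ (n : ℕ) : Homology k (Alg k) 0 := zeroClass (y ^ n * x)
/-- `γ₀(n)`, the class of `yⁿ`. -/
noncomputable def gamma₀ (n : ℕ) : Homology k (Alg k) 0 := zeroClass (y ^ n)
/-- `δ₀(n)`, the class of `zⁿ`. -/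
noncomputable def delta₀ (n : ℕ) : Homology k (Alg k) 0 := zeroClass (z ^ n)
/-- `ε₀((n_1, m_1), …, (n_p, m_p))`, the class of `y^{n_1} z^{m_1} x y^{n_2} ⋯ z^{m_p} x`. -/
noncomputable def eps₀ (l : List (ℕ × ℕ)) : Homology k (Alg k) 0 := zeroClass (cyclicWord l)

/-- Labels of the basis of `HH_0`; a nonempty list of pairs is given by its head and its tail. -/
inductive Label₀
  | zeta
  | alpha
  | beta (n : ℕ+)
  | gamma (n : ℕ+)
  | delta (n : ℕ+)
  | eps (e : ℕ+ × ℕ+) (r : List (ℕ+ × ℕ+))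

/-- Two labels are identified if they agree up to a cyclic permutation of the list of pairs. -/
inductive Label₀.Same : Label₀ → Label₀ → Prop
  | refl (i : Label₀) : Label₀.Same i i
  | rot {e e' : ℕ+ × ℕ+} {r r' : List (ℕ+ × ℕ+)} (h : (e :: r) ~r (e' :: r')) :
      Label₀.Same (.eps e r) (.eps e' r')

/-- The labelled classes in `HH_0`. -/
noncomputable def class₀ : Label₀ → Homology k (Alg k) 0
  | .zeta => zeta₀
  | .alpha => alpha₀
  | .beta n => beta₀ n
  | .gamma n => gamma₀ n
  | .delta n => delta₀ n
  | .eps e r => eps₀ (toNat (e :: r))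

/-! ### Labelled classes in `HH_1` -/

/-- The summand of the coefficients of `x`, `y`, `z` in `θ₁` for a given initial pair:
`y^{n_1} z^{m_1} ⋯ z^{m_p}`, `∑ₜ y^{n_1-t} z^{m_1} ⋯ z^{m_p} x y^{t-1}` and
`∑ₛ z^{m_1-s} x y^{n_2} ⋯ z^{m_p} x y^{n_1} z^{s-1}`. -/
def thetaSummand : List (ℕ × ℕ) → Fin 3 → Alg k
  | [] => 0
  | (n, m) :: r =>
    ![y ^ n * (z ^ m * block r),
      ∑ t ∈ Finset.Icc 1 n, y ^ (n - t) * (z ^ m * block r) * x * y ^ (t - 1),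
      ∑ s ∈ Finset.Icc 1 m, z ^ (m - s) * block r * x * y ^ n * z ^ (s - 1)]

/-- The coefficients of `x`, `y`, `z` in `θ₁`: the sum over the cyclic rotations of the list. -/
def thetaValue (l : List (ℕ × ℕ)) : Fin 3 → Alg k :=
  ∑ i ∈ Finset.range l.length, thetaSummand (l.rotate i)

theorem sum_comm_pow (a g : Alg k) (n : ℕ) :
    ∑ t ∈ Finset.Icc 1 n, (g ^ (n - t) * a * g ^ (t - 1) * g - g * (g ^ (n - t) * a * g ^ (t - 1)))
      = a * g ^ n - g ^ n * a := by
  have h : ∀ j, j ≤ n → ∑ t ∈ Finset.Icc 1 j,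
      (g ^ (n - t) * a * g ^ (t - 1) * g - g * (g ^ (n - t) * a * g ^ (t - 1)))
      = g ^ (n - j) * a * g ^ j - g ^ n * a := by
    intro j
    induction j with
    | zero => simp
    | succ j ih =>
      intro hj
      rw [Finset.sum_Icc_succ_top (by omega), ih (by omega)]
      have h1 : n - j = n - (j + 1) + 1 := by omega
      have h2 : j + 1 - 1 = j := by omega
      rw [h1, h2, pow_succ' g (n - (j + 1)), pow_succ g j]
      simp only [mul_assoc]
      abel
  have := h n le_rfl
  simpa using this

theorem thetaSummand_boundary (e : ℕ × ℕ) (r : List (ℕ × ℕ)) :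
    ∑ i, ((thetaSummand (e :: r) i : Alg k) * gen i - gen i * thetaSummand (e :: r) i) =
      block (r ++ [e]) - block (e :: r) := by
  obtain ⟨n, m⟩ := e
  have hy := sum_comm_pow (z ^ m * block r * x : Alg k) y n
  have hz := sum_comm_pow (block r * x * y ^ n : Alg k) z m
  simp only [Finset.sum_sub_distrib] at hy hz
  simp only [thetaSummand, Fin.sum_univ_three, Matrix.cons_val_zero, Matrix.cons_val_one,
    Matrix.cons_val, Finset.sum_mul, Finset.mul_sum, block_append, block_cons, block_nil]
  simp only [mul_assoc, mul_one] at hy hz ⊢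
  rw [hy, hz]
  abel

theorem thetaValue_boundary (l : List (ℕ × ℕ)) :
    ∑ i, ((thetaValue l i : Alg k) * gen i - gen i * thetaValue l i) = 0 := by
  have h1 : ∀ l : List (ℕ × ℕ), l ≠ [] →
      ∑ i, ((thetaSummand l i : Alg k) * gen i - gen i * thetaSummand l i) =
        block (l.rotate 1) - block l := by
    intro l hl
    obtain ⟨e, r, rfl⟩ := List.exists_cons_of_ne_nil hl
    simpa using thetaSummand_boundary e r
  rcases eq_or_ne l [] with rfl | hl
  · simp [thetaValue]
  simp only [thetaValue, Finset.sum_apply, Finset.sum_mul, Finset.mul_sum]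
  simp only [← Finset.sum_sub_distrib]
  rw [Finset.sum_comm]
  have h2 : ∀ j ∈ Finset.range l.length,
      ∑ i, ((thetaSummand (l.rotate j) i : Alg k) * gen i - gen i * thetaSummand (l.rotate j) i) =
        block (l.rotate (j + 1)) - block (l.rotate j) := by
    intro j _
    rw [h1 _ (by simpa using hl), List.rotate_rotate]
  rw [Finset.sum_congr rfl h2, Finset.sum_range_sub (fun j => (block (l.rotate j) : Alg k))]
  simp

/-- Labels of the basis of `HH_1`; a nonempty list of pairs is given by its head and its tail. -/
inductive Label₁
  | alpha
  | beta
  | gamma (n : ℕ+)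
  | delta
  | eps (n : ℕ+)
  | zeta
  | eta (n : ℕ+)
  | theta (e : ℕ+ × ℕ+) (r : List (ℕ+ × ℕ+))

/-- Two labels are identified if they agree up to a cyclic permutation of the list of pairs. -/
inductive Label₁.Same : Label₁ → Label₁ → Prop
  | refl (i : Label₁) : Label₁.Same i i
  | rot {e e' : ℕ+ × ℕ+} {r r' : List (ℕ+ × ℕ+)} (h : (e :: r) ~r (e' :: r')) :
      Label₁.Same (.theta e r) (.theta e' r')

/-- The coefficients `(a, b, c)` of the cycle `a ⊗ x + b ⊗ y + c ⊗ z` with a given label. -/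
def value₁ : Label₁ → Fin 3 → Alg k
  | .alpha => ![1, 0, 0]
  | .beta => ![x, 0, 0]
  | .gamma n => ![y ^ (n : ℕ) * x, 0, 0]
  | .delta => ![0, 1, 0]
  | .eps n => ![0, y ^ (n : ℕ), 0]
  | .zeta => ![0, 0, 1]
  | .eta n => ![0, 0, z ^ (n : ℕ)]
  | .theta e r => thetaValue (toNat (e :: r))

theorem value₁_boundary (χ : Label₁) :
    ∑ i, ((value₁ χ i : Alg k) * gen i - gen i * value₁ χ i) = 0 := by
  cases χ with
  | theta e r => exact thetaValue_boundary _
  | gamma n =>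
    simp only [value₁, Fin.sum_univ_three, Matrix.cons_val_zero, Matrix.cons_val_one,
      Matrix.cons_val, zero_mul, mul_zero, sub_zero, add_zero]
    rw [← mul_assoc, x_mul_y_pow_mul_x, mul_assoc, x_mul_x, pow_succ, mul_neg, mul_assoc, sub_self]
  | eps n =>
    simp [value₁, Fin.sum_univ_three, ← pow_succ, ← pow_succ']
  | eta n =>
    simp [value₁, Fin.sum_univ_three, ← pow_succ, ← pow_succ']
  | _ => simp [value₁, Fin.sum_univ_three]

/-- The labelled classes in `HH_1`. -/
noncomputable def class₁ (χ : Label₁) : Homology k (Alg k) 1 :=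
  oneClass (value₁ χ) (value₁_boundary χ)

/-! ### Labelled classes in `HH^{-1}` -/

/-- Labels of the basis of `HH^{-1}`; here `C n` stands for the class denoted `C^{-1}(n + 1)`, and
a nonempty list of pairs is given by its head and its tail. -/
inductive CoLabel
  | A
  | B (n : ℕ+)
  | C (n : ℕ+)
  | D (n i : ℕ+) (h : (i : ℕ) + 2 ≤ n)
  | E (n : ℕ+)
  | F (n₀ : ℕ+) (e : ℕ+ × ℕ+) (r : List (ℕ+ × ℕ+))
  | G (e : ℕ+ × ℕ+) (r : List (ℕ+ × ℕ+))
  | H (n₀ : ℕ+) (e : ℕ+ × ℕ+) (r : List (ℕ+ × ℕ+)) (n' : ℕ+)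
  | I (e : ℕ+ × ℕ+) (r : List (ℕ+ × ℕ+)) (n' : ℕ+)
  | J (e : ℕ+ × ℕ+) (r : List (ℕ+ × ℕ+)) (n' : ℕ+)
  | K (m : ℕ+) (r : List (ℕ+ × ℕ+))

/-- The word `y^{n_1} z^{m_1} x y^{n_2} z^{m_2} ⋯ x y^{n_p} z^{m_p}`. -/
def yzWord (e : ℕ+ × ℕ+) (r : List (ℕ+ × ℕ+)) : Alg k :=
  y ^ (e.1 : ℕ) * (z ^ (e.2 : ℕ) * block (toNat r))

/-- The values on `x`, `y`, `z` of the cocycle with a given label. -/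
def coValue : CoLabel → Fin 3 → Alg k
  | .A => ![x, y, 0]
  | .B n => ![y ^ (n : ℕ) * x, -(y ^ (n : ℕ) * x), 0]
  | .C n => ![0, y ^ ((n : ℕ) + 1) * x - x * y ^ ((n : ℕ) + 1), z * x * y ^ (n : ℕ)]
  | .D n i _ => ![0, y ^ (n : ℕ) * x - y ^ (i : ℕ) * x * y ^ ((n : ℕ) - i), 0]
  | .E n => ![0, y ^ (n : ℕ) * x + y ^ ((n : ℕ) + 1), 0]
  | .F n₀ e r => ![0, y ^ (n₀ : ℕ) * x * yzWord e r * x, 0]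
  | .G e r => ![0, yzWord e r * x, 0]
  | .H n₀ e r n' => ![0, y ^ (n₀ : ℕ) * x * yzWord e r * x * y ^ (n' : ℕ), 0]
  | .I e r n' => ![0, yzWord e r * x * y ^ (n' : ℕ), 0]
  | .J e r n' => ![0, x * yzWord e r * x * y ^ (n' : ℕ),
      -(z * x * yzWord e r * x * y ^ ((n' : ℕ) - 1))]
  | .K m r => ![0, 0, z ^ (m : ℕ) * block (toNat r)]

theorem z_block_x (m : ℕ) (hm : m ≠ 0) (r : List (ℕ+ × ℕ+)) (j : ℕ) :
    (z ^ m * block (toNat r) * x * y ^ j * x : Alg k) = 0 := by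
  induction r generalizing m with
  | nil =>
    have h : (z ^ m * block (toNat []) * x * y ^ j * x : Alg k) = z ^ m * (x * y ^ j * x) := by
      simp only [toNat, List.map_nil, block_nil, mul_one, mul_assoc]
    rw [h, x_mul_y_pow_mul_x, mul_neg, pow_succ', ← mul_assoc, ← mul_assoc, z_pow_mul_y m hm]
    simp
  | cons e r ih =>
    have h : (z ^ m * block (toNat (e :: r)) * x * y ^ j * x : Alg k) =
        z ^ m * x * y ^ (e.1 : ℕ) * (z ^ (e.2 : ℕ) * block (toNat r) * x * y ^ j * x) := by
      simp only [toNat, List.map_cons, block_cons, mul_assoc]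
    rw [h, ih _ e.2.ne_zero, mul_zero]

theorem yzWord_x (e : ℕ+ × ℕ+) (r : List (ℕ+ × ℕ+)) (j : ℕ) :
    (yzWord e r * (x * (y ^ j * x)) : Alg k) = 0 := by
  have h := z_block_x (k := k) e.2 e.2.ne_zero r j
  have h' : (yzWord e r * (x * (y ^ j * x)) : Alg k) =
      y ^ (e.1 : ℕ) * (z ^ (e.2 : ℕ) * block (toNat r) * x * y ^ j * x) := by
    simp only [yzWord, mul_assoc]
  rw [h', h, mul_zero]

theorem yzWord_xx (e : ℕ+ × ℕ+) (r : List (ℕ+ × ℕ+)) :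
    (yzWord e r * (x * x) : Alg k) = 0 := by
  simpa using yzWord_x (k := k) e r 0

theorem z_yzWord (e : ℕ+ × ℕ+) (r : List (ℕ+ × ℕ+)) (a : Alg k) :
    z * (yzWord e r * a) = 0 := by
  rw [yzWord, ← mul_assoc, ← mul_assoc, z_mul_y_pow _ e.1.ne_zero, zero_mul, zero_mul]

theorem block_mul_y (m : ℕ) (hm : m ≠ 0) (r : List (ℕ+ × ℕ+)) :
    (z ^ m * block (toNat r) * y : Alg k) = 0 := by
  induction r generalizing m with
  | nil => simpa [toNat, block_nil] using z_pow_mul_y (k := k) m hm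
  | cons e r ih =>
    have h : (z ^ m * block (toNat (e :: r)) * y : Alg k) =
        z ^ m * x * y ^ (e.1 : ℕ) * (z ^ (e.2 : ℕ) * block (toNat r) * y) := by
      simp only [toNat, List.map_cons, block_cons, mul_assoc]
    rw [h, ih _ e.2.ne_zero, mul_zero]

theorem coValue_isDer (X : CoLabel) : IsDer (coValue X : Fin 3 → Alg k) := by
  have hx : ∀ n : ℕ, (x * (y ^ n * x) : Alg k) = -(y ^ (n + 1) * x) := fun n => by
    rw [← mul_assoc, x_mul_y_pow_mul_x]
  have hz : ∀ (n : ℕ+) (a : Alg k), z * (y ^ (n : ℕ) * a) = 0 := fun n a => by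
    rw [← mul_assoc, z_mul_y_pow _ n.ne_zero, zero_mul]
  have hxz : ∀ a : Alg k, x * (z * a) = 0 := fun a => by rw [← mul_assoc, x_mul_z, zero_mul]
  have hyy : ∀ (n : ℕ) (a : Alg k), y * (y ^ n * a) = y ^ (n + 1) * a := fun n a => by
    rw [← mul_assoc, pow_succ']
  cases X with
  | A =>
    constructor <;> simp [coValue, add_mul, x_mul_x, x_mul_z, z_mul_y]
  | B n =>
    constructor
    · simp [coValue, add_mul, mul_assoc, hx, hyy]
    · simp [coValue, mul_assoc, x_mul_z]
    · simp [coValue, hz]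
  | C n =>
    constructor
    · have e : (y ^ ((n : ℕ) + 1) * (y * x) : Alg k) = y ^ ((n : ℕ) + 1 + 1) * x := by
        rw [← mul_assoc, ← pow_succ]
      simp [coValue, sub_mul, mul_assoc, hx, x_mul_x, e]
    · simp [coValue, mul_assoc, hxz]
    · have h : (z * (y ^ ((n : ℕ) + 1) * x) : Alg k) = 0 := by
        rw [← mul_assoc, z_mul_y_pow _ (by omega), zero_mul]
      simp [coValue, mul_sub, mul_assoc, h, ← pow_succ]
  | D n i h =>
    constructor
    · have e : (i : ℕ) + ((n : ℕ) - i + 1) = n + 1 := by omega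
      have e' : (y ^ (i : ℕ) * (y ^ ((n : ℕ) - i + 1) * x) : Alg k) = y ^ (n : ℕ) * (y * x) := by
        rw [← mul_assoc, ← pow_add, e, pow_succ, mul_assoc]
      simp [coValue, sub_mul, mul_assoc, hx, x_mul_x, e']
    · simp [coValue]
    · simp [coValue, mul_sub, mul_assoc, hz]
  | E n =>
    constructor
    · simp [coValue, add_mul, mul_assoc, x_mul_x, pow_succ]
    · simp [coValue]
    · have h : (z * y ^ ((n : ℕ) + 1) : Alg k) = 0 := z_mul_y_pow _ (by omega)
      simp [coValue, mul_add, hz, h]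
  | F n₀ e r =>
    constructor
    · simp [coValue, mul_assoc, yzWord_xx]
    · simp [coValue]
    · simp [coValue, mul_assoc, hz]
  | G e r =>
    constructor
    · simp [coValue, mul_assoc, yzWord_xx]
    · simp [coValue]
    · simp [coValue, z_yzWord]
  | H n₀ e r n' =>
    constructor
    · simp [coValue, mul_assoc, yzWord_x]
    · simp [coValue]
    · simp [coValue, mul_assoc, hz]
  | I e r n' =>
    constructor
    · simp [coValue, mul_assoc, yzWord_x]
    · simp [coValue]
    · simp [coValue, mul_assoc, z_yzWord]
  | J e r n' =>
    constructor
    · simp [coValue, mul_assoc, yzWord_x]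
    · simp [coValue, mul_assoc, hxz]
    · have e : (y ^ ((n' : ℕ) - 1) * y : Alg k) = y ^ (n' : ℕ) := by
        rw [← pow_succ, Nat.sub_add_cancel n'.pos]
      simp [coValue, mul_assoc, e]
  | K m r =>
    constructor
    · simp [coValue]
    · simp [coValue, ← mul_assoc, x_mul_z_pow]
    · simp [coValue, block_mul_y]

/-- The labelled classes in `HH^{-1}`. -/
noncomputable def coClass (X : CoLabel) : Cohomology k (Alg k) 1 :=
  derClass (coValue X) (coValue_isDer X)

/-! ### The table of cap products -/

/-- Adds `d` to the second entry of the last pair of a list. -/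
def addLast : List (ℕ × ℕ) → ℕ → List (ℕ × ℕ)
  | [], _ => []
  | [e], d => [(e.1, e.2 + d)]
  | e :: e' :: l, d => e :: addLast (e' :: l) d

/-- `∑ᵢ f (e_1, …, e_{i-1}) n_i m_i (e_{i+1}, …, e_p)` over the entries `e_i = (n_i, m_i)` of a
list `e_1, …, e_p`. -/
noncomputable def sumSplit (l : List (ℕ × ℕ))
    (f : List (ℕ × ℕ) → ℕ → ℕ → List (ℕ × ℕ) → Homology k (Alg k) 0) : Homology k (Alg k) 0 :=
  ∑ i : Fin l.length, f (l.take i) l[i].1 l[i].2 (l.drop (i + 1))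

/-- The cap product of a labelled class in `HH^{-1}` and a labelled class in `HH_1`; all pairs
that are not listed have cap product zero. -/
noncomputable def capTable : CoLabel → Label₁ → Homology k (Alg k) 0
  | .A, .alpha => alpha₀
  | .B n, .alpha => beta₀ n
  | .A, .beta => -beta₀ 1
  | .B n, .beta => -beta₀ (n + 1)
  | .A, .gamma n₀ => -beta₀ (n₀ + 1)
  | .B n, .gamma n₀ => -beta₀ (n₀ + n + 1)
  | .A, .delta => gamma₀ 1
  | .B n, .delta => -beta₀ n
  | .E n, .delta => beta₀ n + gamma₀ (n + 1)
  | .G e r, .delta => eps₀ (toNat (e :: r))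
  | .I e r n', .delta => eps₀ ((e.1 + n', e.2) :: toNat r)
  | .A, .eps n₀ => gamma₀ (n₀ + 1)
  | .B n, .eps n₀ => -beta₀ (n₀ + n)
  | .E n, .eps n₀ => beta₀ (n₀ + n) + gamma₀ (n₀ + n + 1)
  | .G e r, .eps n₀ => eps₀ ((n₀ + e.1, e.2) :: toNat r)
  | .I e r n', .eps n₀ => eps₀ ((n₀ + e.1 + n', e.2) :: toNat r)
  | .C n, .zeta => eps₀ [((n : ℕ), 1)]
  | .J e r n', .zeta => -eps₀ (((n' : ℕ) - 1, 1) :: toNat (e :: r))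
  | .K m [], .zeta => delta₀ m
  | .K m (a :: r), .zeta => eps₀ (addLast (toNat (a :: r)) m)
  | .C n, .eta n₁ => eps₀ [((n : ℕ), n₁ + 1)]
  | .J e r n', .eta n₁ => -eps₀ (((n' : ℕ) - 1, n₁ + 1) :: toNat (e :: r))
  | .K m [], .eta n₁ => delta₀ (m + n₁)
  | .K m (a :: r), .eta n₁ => eps₀ (addLast (toNat (a :: r)) (m + n₁))
  | .A, .theta e r =>
    sumSplit (toNat (e :: r)) fun _ nᵢ _ _ => (nᵢ + 1) • eps₀ (toNat (e :: r))
  | .C n, .theta e r =>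
    sumSplit (toNat (e :: r)) fun u nᵢ mᵢ v => ∑ s ∈ Finset.Icc 1 mᵢ,
      eps₀ (u ++ [(nᵢ, s), ((n : ℕ), mᵢ - s)] ++ v)
  | .E n, .theta e r =>
    sumSplit (toNat (e :: r)) fun u nᵢ mᵢ v => nᵢ • eps₀ (u ++ [(nᵢ + n, mᵢ)] ++ v)
  | .G a b, .theta e r =>
    sumSplit (toNat (e :: r)) fun u nᵢ mᵢ v => ∑ t ∈ Finset.Icc 1 nᵢ,
      eps₀ (u ++ (t + (a.1 : ℕ) - 1, (a.2 : ℕ)) :: toNat b ++ [(nᵢ - t, mᵢ)] ++ v)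
  | .I a b n', .theta e r =>
    sumSplit (toNat (e :: r)) fun u nᵢ mᵢ v => ∑ t ∈ Finset.Icc 1 nᵢ,
      eps₀ (u ++ (t + (a.1 : ℕ) - 1, (a.2 : ℕ)) :: toNat b ++ [(nᵢ + (n' : ℕ) - t, mᵢ)] ++ v)
  | .J a b n', .theta e r =>
    -sumSplit (toNat (e :: r)) fun u nᵢ mᵢ v => ∑ s ∈ Finset.Icc 1 mᵢ,
      eps₀ (u ++ [(nᵢ, s)] ++ toNat (a :: b) ++ [((n' : ℕ) - 1, mᵢ - s)] ++ v)
  | .K s₁ b, .theta e r =>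
    sumSplit (toNat (e :: r)) fun u nᵢ mᵢ v => ∑ s ∈ Finset.Icc 1 mᵢ,
      eps₀ (u ++ addLast ((nᵢ, s + (s₁ : ℕ) - 1) :: toNat b) (mᵢ - s) ++ v)
  | _, _ => 0

end Algebra

/-- A family of vectors that is a basis once the indices related by `rel` are identified. -/
structure IsBasisUpTo (k : Type*) [Field k] {ι M : Type*} [AddCommGroup M] [Module k M]
    (rel : ι → ι → Prop) (v : ι → M) : Prop where
  eq_iff : ∀ i j, v i = v j ↔ rel i j
  linearIndependent : LinearIndependent k (Subtype.val : Set.range v → M)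
  span_eq_top : Submodule.span k (Set.range v) = ⊤

end IyuduShkarin

/-!
The words without a subword `x y^n x`, `x z` or `z y` form a basis of the algebra `A`
(`wordBasis`), and every computation takes place in the coordinates `coef` for this basis.

*Higher homology.* `HH_p(A)` vanishes for `p ≥ 2` (`cycles_le_boundaries`). By duality this is a
statement on Hochschild cohomology with coefficients in the dual bimodule `A^*`. Dimension shifting
along `0 → N → Hom (A, N) → B.hom → 0` carries cohomology of degree `p + 1` with coefficients in `N`
to degree `p`, both for the Hochschild complex (`Bimod.hom`) and for the complex of the Koszul
resolution (`KoszulVanish.hom`). In degree one the two complexes agree, so exactness of the Koszul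
complex implies exactness of the Hochschild complex (`bar_exact`), without a comparison of
resolutions; for `A^*` the Koszul complex is short and is treated directly (`koszulVanish_dual`).
All cap products that start in degree `p ≥ 2` are therefore zero.

*Degree zero.* Up to commutators every normal word is zero or a scalar multiple of a word of the
list, and the trace `traceMap`, with values in combinations of cyclic lists of exponents, separates
the words of the list.

*Degree one.* The Euler derivation multiplies a word by its length. By the Cartan homotopy formula
and `HH_2(A) = 0`, its action on `HH_1(A)` is the cap product with its class, followed by the Connes
operator. In characteristic zero this action is injective, hence so is the cap product
`HH_1(A) → HH_0(A)` with the Euler class (`capEuler_injective`). It carries each class of the list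
to a nonzero multiple of a basis class of `HH_0(A)` other than `[1]` (`capEuler_class₁`), and it
takes values in the span of these (`capEuler_mem`), so the basis of `HH_0(A)` yields that of
`HH_1(A)`.

*Cohomology.* A derivation is given by its values on the generators. Subtracting labelled and inner
derivations removes certain words from these values (`derivationSpan_sup_normalForms`), and a
derivation without these words is zero (`eq_zero_of_mem_normalForms`). Each labelled derivation has
a word that no other one contains (`coef_leadWord_of_ne`), and an inner derivation in the span of
the labelled ones is zero (`coef_eq_zero_of_inner_isFree`). The last fact also shows that the center
of `A` consists of scalars.

*Cap products in degree one.* The cap product of a derivation with `θ₁` is the sum over the letters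
of a cyclic word of the words in which one letter is replaced by its image
(`zeroHom_thetaSummand`); the table follows by cyclic rotation of these words.
-/

namespace IyuduShkarin

open Hochschild

/-! ### A basis of words -/

section Words

variable {k : Type*} [Field k]

/-- The homomorphism from the algebra given by three elements that satisfy its relations. -/
def algLift {B : Type*} [Ring B] [Algebra k B] (b : Fin 3 → B)
    (hxx : b 0 * b 0 + b 1 * b 0 = 0) (hxz : b 0 * b 2 = 0) (hzy : b 2 * b 1 = 0) :
    Alg k →ₐ[k] B :=
  RingQuot.liftAlgHom k ⟨FreeAlgebra.lift k b, by
    intro u v huv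
    induction huv <;> simpa using by assumption⟩

theorem algLift_gen {B : Type*} [Ring B] [Algebra k B] (b : Fin 3 → B)
    (hxx : b 0 * b 0 + b 1 * b 0 = 0) (hxz : b 0 * b 2 = 0) (hzy : b 2 * b 1 = 0) (i : Fin 3) :
    algLift b hxx hxz hzy (gen i : Alg k) = b i := by
  refine (RingQuot.liftAlgHom_mkAlgHom_apply k _ _ _).trans ?_
  rw [FreeAlgebra.lift_ι_apply]

/-- A property of elements of the algebra that is stable under linear combinations and left
multiplication by the generators holds everywhere as soon as it holds for `1`. -/
theorem alg_induction_left (p : Submodule k (Alg k)) (h1 : 1 ∈ p)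
    (hgen : ∀ i, ∀ a ∈ p, gen i * a ∈ p) (a : Alg k) : a ∈ p := by
  obtain ⟨f, rfl⟩ := RingQuot.mkAlgHom_surjective k (Rel k) a
  change proj k f ∈ p
  suffices h : ∀ b ∈ p, proj k f * b ∈ p by simpa using h 1 h1
  induction f using FreeAlgebra.induction with
  | grade0 r =>
    intro b hb
    rw [AlgHom.commutes, ← Algebra.smul_def]
    exact p.smul_mem r hb
  | grade1 i => exact hgen i
  | mul f g hf hg =>
    intro b hb
    rw [map_mul, mul_assoc]
    exact hf _ (hg b hb)
  | add f g hf hg =>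
    intro b hb
    rw [map_add, add_mul]
    exact p.add_mem (hf b hb) (hg b hb)

/-- A normal word `y^a (g_1 z) ⋯ (g_p z) g`, recorded as `(a, [c_1, …, c_p], e)`. Each gap `g_i` is
empty if `c_i = 0` and `x y^{c_i}` otherwise; the end `g` is empty if `e = none` and `x y^b` if
`e = some b`. These are the words without a subword `x y^n x`, `x z` or `z y`. -/
abbrev Word := ℕ × List ℕ × Option ℕ

/-- The factor `g z` of a normal word. -/
def gapZ : ℕ → Alg k
  | 0 => z
  | c + 1 => x * (y ^ (c + 1) * z)

/-- The product of the factors `g_i z` of a normal word. -/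
def gapProd (L : List ℕ) : Alg k := (L.map gapZ).prod

/-- The end `g` of a normal word. -/
def tailEnd : Option ℕ → Alg k
  | none => 1
  | some b => x * y ^ b

/-- The element of the algebra represented by a normal word. -/
def word (w : Word) : Alg k := y ^ w.1 * (gapProd w.2.1 * tailEnd w.2.2)

@[simp] theorem gapProd_nil : (gapProd [] : Alg k) = 1 := rfl

@[simp] theorem gapProd_cons (c : ℕ) (L : List ℕ) :
    (gapProd (c :: L) : Alg k) = gapZ c * gapProd L := by
  simp [gapProd]

@[simp] theorem gapProd_append (L L' : List ℕ) :
    (gapProd (L ++ L') : Alg k) = gapProd L * gapProd L' := by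
  simp [gapProd]

theorem z_mul_y_assoc (a : Alg k) : z * (y * a) = 0 := by
  rw [← mul_assoc, z_mul_y, zero_mul]

theorem x_mul_z_assoc (a : Alg k) : x * (z * a) = 0 := by
  rw [← mul_assoc, x_mul_z, zero_mul]

theorem x_mul_y_pow_mul_x_assoc (n : ℕ) (a : Alg k) :
    x * (y ^ n * (x * a)) = -(y ^ (n + 1) * (x * a)) := by
  have := congrArg (· * a) (x_mul_y_pow_mul_x (k := k) n)
  simpa only [mul_assoc, neg_mul] using this

theorem gapZ_mul_y (c : ℕ) : (gapZ c * y : Alg k) = 0 := by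
  cases c <;> simp [gapZ, mul_assoc, z_mul_y]

theorem gapProd_mul_y (c : ℕ) (L : List ℕ) : (gapProd (c :: L) * y : Alg k) = 0 := by
  induction L generalizing c with
  | nil => simp [gapZ_mul_y]
  | cons d L ih => rw [gapProd_cons, mul_assoc, ih, mul_zero]

theorem gapProd_mul_y_pow (c : ℕ) (L : List ℕ) (n : ℕ) (a : Alg k) :
    (gapProd (c :: L) * (y ^ (n + 1) * a) : Alg k) = 0 := by
  rw [pow_succ', mul_assoc, ← mul_assoc, gapProd_mul_y, zero_mul]

/-! Multiplication of normal words by the generators. -/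

theorem y_mul_word (a : ℕ) (L : List ℕ) (e : Option ℕ) :
    (y * word (a, L, e) : Alg k) = word (a + 1, L, e) := by
  simp [word, pow_succ', mul_assoc]

theorem z_mul_word_zero (L : List ℕ) (e : Option ℕ) :
    (z * word (0, L, e) : Alg k) = word (0, 0 :: L, e) := by
  simp [word, gapZ, mul_assoc]

theorem z_mul_word_succ (a : ℕ) (L : List ℕ) (e : Option ℕ) :
    (z * word (a + 1, L, e) : Alg k) = 0 := by
  simp [word, pow_succ', mul_assoc, z_mul_y_assoc]

theorem x_mul_word_nil_none (a : ℕ) : (x * word (a, [], none) : Alg k) = word (0, [], some a) := by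
  simp [word, tailEnd]

theorem x_mul_word_nil_some (a b : ℕ) :
    (x * word (a, [], some b) : Alg k) = -word (a + 1, [], some b) := by
  simp [word, tailEnd, x_mul_y_pow_mul_x_assoc]

theorem x_mul_word_zero_cons (L : List ℕ) (e : Option ℕ) :
    (x * word (0, 0 :: L, e) : Alg k) = 0 := by
  simp [word, gapZ, mul_assoc, x_mul_z_assoc]

theorem x_mul_word_succ_cons (a : ℕ) (L : List ℕ) (e : Option ℕ) :
    (x * word (a + 1, 0 :: L, e) : Alg k) = word (0, (a + 1) :: L, e) := by
  simp [word, gapZ, mul_assoc]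

theorem x_mul_word_cons_succ (a c : ℕ) (L : List ℕ) (e : Option ℕ) :
    (x * word (a, (c + 1) :: L, e) : Alg k) = -word (a + 1, (c + 1) :: L, e) := by
  simp [word, gapZ, mul_assoc, x_mul_y_pow_mul_x_assoc]

theorem word_nil_none_mul_y (a : ℕ) :
    (word (a, [], none) * y : Alg k) = word (a + 1, [], none) := by
  simp [word, tailEnd, pow_succ]

theorem word_cons_none_mul_y (a c : ℕ) (L : List ℕ) :
    (word (a, c :: L, none) * y : Alg k) = 0 := by
  simp only [word, tailEnd, mul_one, mul_assoc, gapProd_mul_y, mul_zero]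

theorem word_some_mul_y (a b : ℕ) (L : List ℕ) :
    (word (a, L, some b) * y : Alg k) = word (a, L, some (b + 1)) := by
  simp [word, tailEnd, pow_succ, mul_assoc]

theorem word_none_mul_z (a : ℕ) (L : List ℕ) :
    (word (a, L, none) * z : Alg k) = word (a, L ++ [0], none) := by
  simp [word, tailEnd, gapZ, mul_assoc]

theorem word_some_zero_mul_z (a : ℕ) (L : List ℕ) :
    (word (a, L, some 0) * z : Alg k) = 0 := by
  simp [word, tailEnd, mul_assoc, x_mul_z]

theorem word_some_succ_mul_z (a b : ℕ) (L : List ℕ) :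
    (word (a, L, some (b + 1)) * z : Alg k) = word (a, L ++ [b + 1], none) := by
  simp [word, tailEnd, gapZ, mul_assoc]

theorem word_none_mul_x (a : ℕ) (L : List ℕ) :
    (word (a, L, none) * x : Alg k) = word (a, L, some 0) := by
  simp [word, tailEnd, mul_assoc]

theorem word_nil_some_mul_x (a b : ℕ) :
    (word (a, [], some b) * x : Alg k) = -word (a + b + 1, [], some 0) := by
  have := x_mul_y_pow_mul_x_assoc b (1 : Alg k)
  rw [mul_one] at this
  simp [word, tailEnd, mul_assoc, this, pow_add]

theorem word_cons_some_mul_x (a b c : ℕ) (L : List ℕ) :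
    (word (a, c :: L, some b) * x : Alg k) = 0 := by
  have := x_mul_y_pow_mul_x_assoc b (1 : Alg k)
  rw [mul_one] at this
  simp only [word, tailEnd, mul_assoc, this, mul_neg, gapProd_mul_y_pow, mul_zero, neg_zero]

/-- The products of a generator and a normal word, in coordinates. -/
noncomputable def leftAct : Fin 3 → Word → Word →₀ k
  | 0, (a, [], none) => Finsupp.single (0, [], some a) 1
  | 0, (a, [], some b) => -Finsupp.single (a + 1, [], some b) 1
  | 0, (0, 0 :: _, _) => 0
  | 0, (a + 1, 0 :: L, e) => Finsupp.single (0, (a + 1) :: L, e) 1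
  | 0, (a, (c + 1) :: L, e) => -Finsupp.single (a + 1, (c + 1) :: L, e) 1
  | 1, (a, L, e) => Finsupp.single (a + 1, L, e) 1
  | 2, (0, L, e) => Finsupp.single (0, 0 :: L, e) 1
  | 2, (_ + 1, _, _) => 0

/-- The action of a generator on the space of formal combinations of normal words. -/
noncomputable def leftOp (i : Fin 3) : Module.End k (Word →₀ k) :=
  Finsupp.linearCombination k (leftAct i)

theorem leftOp_single (i : Fin 3) (w : Word) :
    leftOp i (Finsupp.single w (1 : k)) = leftAct i w := by
  simp [leftOp]

/-- The action of the algebra on the space of formal combinations of normal words. -/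
noncomputable def wordRep : Alg k →ₐ[k] Module.End k (Word →₀ k) :=
  algLift (B := Module.End k (Word →₀ k)) leftOp
    (by
      ext1 w
      obtain ⟨a, L, e⟩ := w
      ext1
      rcases L with _ | ⟨_ | c, L⟩ <;> rcases e with _ | b <;> rcases a with _ | a <;>
        simp [leftOp, leftAct])
    (by
      ext1 w
      obtain ⟨a, L, e⟩ := w
      ext1
      rcases a with _ | a <;> simp [leftOp, leftAct])
    (by
      ext1 w
      obtain ⟨a, L, e⟩ := w
      ext1
      simp [leftOp, leftAct])

theorem wordRep_gen (i : Fin 3) : wordRep (gen i : Alg k) = leftOp i := algLift_gen _ _ _ _ i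

theorem linearCombination_leftAct (i : Fin 3) (w : Word) :
    Finsupp.linearCombination k word (leftAct i w) = (gen i * word w : Alg k) := by
  obtain ⟨a, L, e⟩ := w
  fin_cases i
  · rcases L with _ | ⟨_ | c, L⟩
    · rcases e with _ | b
      · simp [leftAct, x_mul_word_nil_none]
      · simp [leftAct, x_mul_word_nil_some]
    · rcases a with _ | a
      · simp [leftAct, x_mul_word_zero_cons]
      · simp [leftAct, x_mul_word_succ_cons]
    · simp [leftAct, x_mul_word_cons_succ]
  · simp [leftAct, y_mul_word]
  · rcases a with _ | a
    · simp [leftAct, z_mul_word_zero]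
    · simp [leftAct, z_mul_word_succ]

/-- The coordinates of an element of the algebra with respect to the normal words. -/
noncomputable def toVec : Alg k →ₗ[k] (Word →₀ k) :=
  LinearMap.applyₗ (Finsupp.single (0, [], none) 1) ∘ₗ (wordRep (k := k)).toLinearMap

theorem toVec_gen_mul (i : Fin 3) (a : Alg k) : toVec (gen i * a) = leftOp i (toVec a) := by
  simp [toVec, wordRep_gen]

theorem linearCombination_leftOp (i : Fin 3) (v : Word →₀ k) :
    Finsupp.linearCombination k word (leftOp i v) =
      (gen i * Finsupp.linearCombination k word v : Alg k) := by
  induction v using Finsupp.induction_linear with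
  | zero => simp
  | add f g hf hg => simp only [map_add, hf, hg, mul_add]
  | single w c =>
    rw [← mul_one c, ← smul_eq_mul, ← Finsupp.smul_single, map_smul, map_smul, leftOp_single,
      linearCombination_leftAct]
    simp

theorem linearCombination_toVec (a : Alg k) :
    Finsupp.linearCombination k word (toVec a) = a := by
  refine alg_induction_left (LinearMap.eqLocus
    (Finsupp.linearCombination k word ∘ₗ toVec) LinearMap.id) ?_ ?_ a
  · simp [toVec, word, tailEnd]
  · intro i a ha
    have ha' : Finsupp.linearCombination k word (toVec a) = a := ha
    change Finsupp.linearCombination k word (toVec (gen i * a)) = gen i * a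
    rw [toVec_gen_mul, linearCombination_leftOp, ha']

theorem toVec_word (w : Word) : toVec (word w : Alg k) = Finsupp.single w 1 := by
  obtain ⟨a, L, e⟩ := w
  induction a with
  | succ a ih => rw [← y_mul_word, toVec_gen_mul, ih, leftOp_single]; rfl
  | zero =>
    have hy : ∀ n, toVec (word (n, [], none) : Alg k) = Finsupp.single (n, [], none) 1 := by
      intro n
      induction n with
      | zero => simp [toVec, word, tailEnd]
      | succ n ih => rw [← y_mul_word, toVec_gen_mul, ih, leftOp_single]; rfl
    induction L with
    | nil =>
      rcases e with _ | b
      · exact hy 0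
      · rw [← x_mul_word_nil_none, toVec_gen_mul, hy, leftOp_single]; rfl
    | cons c L ih =>
      have hz : toVec (word (0, 0 :: L, e) : Alg k) = Finsupp.single (0, 0 :: L, e) 1 := by
        rw [← z_mul_word_zero, toVec_gen_mul, ih, leftOp_single]; rfl
      have hyz : ∀ n, toVec (word (n, 0 :: L, e) : Alg k) = Finsupp.single (n, 0 :: L, e) 1 := by
        intro n
        induction n with
        | zero => exact hz
        | succ n ih => rw [← y_mul_word, toVec_gen_mul, ih, leftOp_single]; rfl
      rcases c with _ | c
      · exact hz
      · rw [← x_mul_word_succ_cons, toVec_gen_mul, hyz, leftOp_single]; rfl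

/-- The normal words form a basis of the algebra. -/
noncomputable def wordBasis : Module.Basis Word k (Alg k) :=
  Module.Basis.ofRepr (LinearEquiv.ofLinearMap toVec (Finsupp.linearCombination k word)
    (by ext1 w; ext1; simp [toVec_word])
    (by ext1 a; exact linearCombination_toVec a))

@[simp] theorem wordBasis_apply (w : Word) : wordBasis w = (word w : Alg k) := by
  simp [wordBasis, Module.Basis.coe_ofRepr]

/-- The coefficient of a normal word. -/
noncomputable def coef (w : Word) : Alg k →ₗ[k] k := wordBasis.coord w

theorem coef_word (w w' : Word) : coef w (word w' : Alg k) = if w' = w then 1 else 0 := by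
  rw [coef, Module.Basis.coord_apply, ← wordBasis_apply, Module.Basis.repr_self,
    Finsupp.single_apply]

/-- Linear maps on the algebra agree if they agree on normal words. -/
theorem word_ext {M : Type*} [AddCommGroup M] [Module k M] (f g : Alg k →ₗ[k] M)
    (h : ∀ a L e, f (word (a, L, e)) = g (word (a, L, e))) (a : Alg k) : f a = g a := by
  have : f = g := wordBasis.ext fun ⟨a, L, e⟩ => by simpa using h a L e
  rw [this]

theorem eq_zero_of_coef {a : Alg k} (h : ∀ w, coef w a = 0) : a = 0 :=
  wordBasis.ext_elem fun w => by simpa [coef] using h w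

/-! Coefficients of a product with a generator. -/

theorem coef_zero_y_mul (L : List ℕ) (e : Option ℕ) (a : Alg k) :
    coef (0, L, e) (y * a) = 0 := by
  refine word_ext (coef (0, L, e) ∘ₗ LinearMap.mulLeft k y) 0 (fun a' L' e' => ?_) a
  simp [y_mul_word, coef_word]

theorem coef_succ_y_mul (n : ℕ) (L : List ℕ) (e : Option ℕ) (a : Alg k) :
    coef (n + 1, L, e) (y * a) = coef (n, L, e) a := by
  refine word_ext (coef (n + 1, L, e) ∘ₗ LinearMap.mulLeft k y) (coef (n, L, e))
    (fun a' L' e' => ?_) a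
  simp [y_mul_word, coef_word]

theorem coef_z_mul (L : List ℕ) (e : Option ℕ) (a : Alg k) :
    coef (0, 0 :: L, e) (z * a) = coef (0, L, e) a := by
  refine word_ext (coef (0, 0 :: L, e) ∘ₗ LinearMap.mulLeft k z) (coef (0, L, e))
    (fun a' L' e' => ?_) a
  rcases a' with _ | a' <;> simp [z_mul_word_zero, z_mul_word_succ, coef_word]

theorem coef_nil_z_mul (n : ℕ) (e : Option ℕ) (a : Alg k) :
    coef (n, [], e) (z * a) = 0 := by
  refine word_ext (coef (n, [], e) ∘ₗ LinearMap.mulLeft k z) 0 (fun a' L' e' => ?_) a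
  rcases a' with _ | a' <;> simp [z_mul_word_zero, z_mul_word_succ, coef_word]

theorem coef_cons_z_mul (n c : ℕ) (h : n ≠ 0 ∨ c ≠ 0) (L : List ℕ) (e : Option ℕ) (a : Alg k) :
    coef (n, c :: L, e) (z * a) = 0 := by
  refine word_ext (coef (n, c :: L, e) ∘ₗ LinearMap.mulLeft k z) 0 (fun a' L' e' => ?_) a
  rcases a' with _ | a' <;> simp [z_mul_word_zero, z_mul_word_succ, coef_word]
  omega

theorem coef_x_mul_nil_none (n : ℕ) (a : Alg k) : coef (n, [], none) (x * a) = 0 := by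
  refine word_ext (coef (n, [], none) ∘ₗ LinearMap.mulLeft k x) 0 (fun a' L' e' => ?_) a
  rcases L' with _ | ⟨_ | c, L'⟩ <;> rcases e' with _ | b <;> rcases a' with _ | a' <;>
    simp [x_mul_word_nil_none, x_mul_word_nil_some, x_mul_word_zero_cons, x_mul_word_succ_cons,
      x_mul_word_cons_succ, coef_word]

theorem coef_x_mul_zero_nil_some (n : ℕ) (a : Alg k) :
    coef (0, [], some n) (x * a) = coef (n, [], none) a := by
  refine word_ext (coef (0, [], some n) ∘ₗ LinearMap.mulLeft k x) (coef (n, [], none))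
    (fun a' L' e' => ?_) a
  rcases L' with _ | ⟨_ | c, L'⟩ <;> rcases e' with _ | b <;> rcases a' with _ | a' <;>
    simp [x_mul_word_nil_none, x_mul_word_nil_some, x_mul_word_zero_cons, x_mul_word_succ_cons,
      x_mul_word_cons_succ, coef_word]

theorem coef_x_mul_succ_nil_some (n b : ℕ) (a : Alg k) :
    coef (n + 1, [], some b) (x * a) = -coef (n, [], some b) a := by
  refine word_ext (coef (n + 1, [], some b) ∘ₗ LinearMap.mulLeft k x) (-coef (n, [], some b))
    (fun a' L' e' => ?_) a
  rcases L' with _ | ⟨_ | c, L'⟩ <;> rcases e' with _ | b <;> rcases a' with _ | a' <;>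
    simp [x_mul_word_nil_none, x_mul_word_nil_some, x_mul_word_zero_cons, x_mul_word_succ_cons,
      x_mul_word_cons_succ, coef_word, eq_comm (a := n)]

theorem coef_x_mul_zero_cons_succ (n : ℕ) (L : List ℕ) (e : Option ℕ) (a : Alg k) :
    coef (0, (n + 1) :: L, e) (x * a) = coef (n + 1, 0 :: L, e) a := by
  refine word_ext (coef (0, (n + 1) :: L, e) ∘ₗ LinearMap.mulLeft k x) (coef (n + 1, 0 :: L, e))
    (fun a' L' e' => ?_) a
  rcases L' with _ | ⟨_ | c, L'⟩ <;> rcases e' with _ | b <;> rcases a' with _ | a' <;>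
    simp [x_mul_word_nil_none, x_mul_word_nil_some, x_mul_word_zero_cons, x_mul_word_succ_cons,
      x_mul_word_cons_succ, coef_word, and_assoc]

theorem coef_x_mul_succ_cons_succ (n c : ℕ) (L : List ℕ) (e : Option ℕ) (a : Alg k) :
    coef (n + 1, (c + 1) :: L, e) (x * a) = -coef (n, (c + 1) :: L, e) a := by
  refine word_ext (coef (n + 1, (c + 1) :: L, e) ∘ₗ LinearMap.mulLeft k x)
    (-coef (n, (c + 1) :: L, e)) (fun a' L' e' => ?_) a
  rcases L' with _ | ⟨_ | c, L'⟩ <;> rcases e' with _ | b <;> rcases a' with _ | a' <;>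
    simp [x_mul_word_nil_none, x_mul_word_nil_some, x_mul_word_zero_cons, x_mul_word_succ_cons,
      x_mul_word_cons_succ, coef_word, and_assoc, eq_comm (a := n)]

theorem coef_x_mul_cons_zero (n : ℕ) (L : List ℕ) (e : Option ℕ) (a : Alg k) :
    coef (n, 0 :: L, e) (x * a) = 0 := by
  refine word_ext (coef (n, 0 :: L, e) ∘ₗ LinearMap.mulLeft k x) 0 (fun a' L' e' => ?_) a
  rcases L' with _ | ⟨_ | c, L'⟩ <;> rcases e' with _ | b <;> rcases a' with _ | a' <;>
    simp [x_mul_word_nil_none, x_mul_word_nil_some, x_mul_word_zero_cons, x_mul_word_succ_cons,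
      x_mul_word_cons_succ, coef_word]

theorem coef_mul_y_some (n b : ℕ) (L : List ℕ) (a : Alg k) :
    coef (n, L, some (b + 1)) (a * y) = coef (n, L, some b) a := by
  refine word_ext (coef (n, L, some (b + 1)) ∘ₗ LinearMap.mulRight k y) (coef (n, L, some b))
    (fun a' L' e' => ?_) a
  rcases L' with _ | ⟨c, L'⟩ <;> rcases e' with _ | b <;>
    simp [word_nil_none_mul_y, word_cons_none_mul_y, word_some_mul_y, coef_word]

theorem coef_mul_y_some_zero (n : ℕ) (L : List ℕ) (a : Alg k) :
    coef (n, L, some 0) (a * y) = 0 := by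
  refine word_ext (coef (n, L, some 0) ∘ₗ LinearMap.mulRight k y) 0
    (fun a' L' e' => ?_) a
  rcases L' with _ | ⟨c, L'⟩ <;> rcases e' with _ | b <;>
    simp [word_nil_none_mul_y, word_cons_none_mul_y, word_some_mul_y, coef_word]

theorem coef_mul_z_some (n b : ℕ) (L : List ℕ) (a : Alg k) :
    coef (n, L, some b) (a * z) = 0 := by
  refine word_ext (coef (n, L, some b) ∘ₗ LinearMap.mulRight k z) 0 (fun a' L' e' => ?_) a
  rcases e' with _ | _ | b <;>
    simp [word_none_mul_z, word_some_zero_mul_z, word_some_succ_mul_z, coef_word]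

theorem coef_mul_z_zero (n : ℕ) (L : List ℕ) (a : Alg k) :
    coef (n, L ++ [0], none) (a * z) = coef (n, L, none) a := by
  refine word_ext (coef (n, L ++ [0], none) ∘ₗ LinearMap.mulRight k z) (coef (n, L, none))
    (fun a' L' e' => ?_) a
  rcases e' with _ | _ | b <;>
    simp [word_none_mul_z, word_some_zero_mul_z, word_some_succ_mul_z, coef_word]

theorem coef_mul_z_succ (n b : ℕ) (L : List ℕ) (a : Alg k) :
    coef (n, L ++ [b + 1], none) (a * z) = coef (n, L, some (b + 1)) a := by
  refine word_ext (coef (n, L ++ [b + 1], none) ∘ₗ LinearMap.mulRight k z)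
    (coef (n, L, some (b + 1))) (fun a' L' e' => ?_) a
  rcases e' with _ | _ | b <;>
    simp [word_none_mul_z, word_some_zero_mul_z, word_some_succ_mul_z, coef_word]

theorem coef_mul_x_cons (n c : ℕ) (L : List ℕ) (a : Alg k) :
    coef (n, c :: L, some 0) (a * x) = coef (n, c :: L, none) a := by
  refine word_ext (coef (n, c :: L, some 0) ∘ₗ LinearMap.mulRight k x)
    (coef (n, c :: L, none)) (fun a' L' e' => ?_) a
  rcases L' with _ | ⟨c, L'⟩ <;> rcases e' with _ | b <;>
    simp [word_none_mul_x, word_nil_some_mul_x, word_cons_some_mul_x, coef_word]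

theorem coef_mul_x_succ (n : ℕ) (a : Alg k) :
    coef (n + 1, [], some 0) (a * x) = coef (n + 1, [], none) a -
      ∑ p ∈ Finset.HasAntidiagonal.antidiagonal n, coef (p.1, [], some p.2) a := by
  refine (word_ext (coef (n + 1, [], some 0) ∘ₗ LinearMap.mulRight k x)
    (coef (n + 1, [], none) - ∑ p ∈ Finset.HasAntidiagonal.antidiagonal n, coef (p.1, [], some p.2))
    (fun a' L' e' => ?_) a).trans (by simp)
  rcases L' with _ | ⟨c, L'⟩ <;> rcases e' with _ | b <;>
    simp [word_none_mul_x, word_nil_some_mul_x, word_cons_some_mul_x, coef_word]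
  have h : ∀ p : ℕ × ℕ, (a' = p.1 ∧ b = p.2) ↔ (a', b) = p := fun p => by rw [Prod.ext_iff]
  simp only [h, Finset.filter_eq, Finset.HasAntidiagonal.mem_antidiagonal]
  split_ifs <;> simp

end Words

/-! ### Hochschild cocycles with coefficients in a bimodule -/

section Bimod

variable {k : Type*} [CommRing k]

/-- A bimodule structure on `N` over an algebra `A`: a unital left action and a right action that
is associative but need not be unital. Right actions with this weaker condition arise in
`Bimod.hom`. -/
structure Bimod (k A N : Type*) [CommRing k] [Ring A] [Algebra k A] [AddCommGroup N]
    [Module k N] where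
  /-- The left action. -/
  l : A →ₗ[k] N →ₗ[k] N
  /-- The right action, `r a n = n a`. -/
  r : A →ₗ[k] N →ₗ[k] N
  l_mul : ∀ a b n, l (a * b) n = l a (l b n)
  l_one : ∀ n, l 1 n = n
  r_mul : ∀ a b n, r (a * b) n = r b (r a n)
  comm : ∀ a b n, l a (r b n) = r b (l a n)

namespace Bimod

variable {A N : Type*} [Ring A] [Algebra k A] [AddCommGroup N] [Module k N] (B : Bimod k A N)

/-- The Hochschild coboundary of a cochain with coefficients in a bimodule. -/
def bar {p : ℕ} (f : MultilinearMap k (fun _ : Fin p => A) N) (a : Fin (p + 1) → A) : N :=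
  B.l (a 0) (f fun i => a i.succ) + ∑ i : Fin p, (-1 : k) ^ ((i : ℕ) + 1) • f (mulFace i a)
    + (-1 : k) ^ (p + 1) • B.r (a (Fin.last p)) (f fun i => a i.castSucc)

theorem r_one_r (a : A) (n : N) : B.r 1 (B.r a n) = B.r a n := by rw [← B.r_mul, mul_one]

theorem r_r_one (a : A) (n : N) : B.r a (B.r 1 n) = B.r a n := by rw [← B.r_mul, one_mul]

/-- The bimodule `Hom (A, N)` with `(c h)(a) = c h(a)` and `(h c)(a) = h(c a) - h(c) a`. Cochains
of degree `p + 1` with coefficients in `N` are cochains of degree `p` with coefficients in this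
bimodule. -/
def hom : Bimod k A (A →ₗ[k] N) where
  l := LinearMap.mk₂ k (fun c h => B.l c ∘ₗ h) (by intros; ext; simp) (by intros; ext; simp)
    (by intros; ext; simp) (by intros; ext; simp)
  r := LinearMap.mk₂ k (fun c h => h ∘ₗ LinearMap.mulLeft k c - B.r.flip (h c))
    (by intros; ext; simp [add_mul]; abel) (by intros; ext; simp [smul_sub])
    (by intros; ext; simp; abel) (by intros; ext; simp [smul_sub])
  l_mul a b h := by ext; simp [B.l_mul]
  l_one h := by ext; simp [B.l_one]
  r_mul a b h := by ext; simp [B.r_mul]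
  comm a b h := by ext; simp [B.comm]

@[simp] theorem hom_l (c : A) (h : A →ₗ[k] N) (a : A) : B.hom.l c h a = B.l c (h a) := rfl

@[simp] theorem hom_r (c : A) (h : A →ₗ[k] N) (a : A) :
    B.hom.r c h a = h (c * a) - B.r a (h c) := rfl

theorem bar_curryRight {p : ℕ} (f : MultilinearMap k (fun _ : Fin (p + 1) => A) N)
    (a : Fin (p + 1) → A) (b : A) :
    B.hom.bar f.curryRight a b = B.bar f (Fin.snoc (α := fun _ => A) a b) := by
  have h0 : (fun i : Fin (p + 1) => (Fin.snoc (α := fun _ => A) a b : Fin (p + 2) → A) i.succ) =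
      Fin.snoc (α := fun _ => A) (fun i : Fin p => a i.succ) b := by
    ext i
    induction i using Fin.lastCases with
    | last => rw [Fin.succ_last, Fin.snoc_last, Fin.snoc_last]
    | cast i => rw [Fin.snoc_castSucc, ← Fin.castSucc_succ, Fin.snoc_castSucc]
  have h1 : ∀ i : Fin p, mulFace i.castSucc (Fin.snoc (α := fun _ => A) a b : Fin (p + 2) → A) =
      Fin.snoc (α := fun _ => A) (mulFace i a) b := by
    intro i
    ext j
    induction j using Fin.lastCases with
    | last =>
      have h1 : ¬ (p < i) := by omega
      have h2 : ¬ (p = (i : ℕ)) := by omega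
      simp only [mulFace, Fin.val_last, Fin.val_castSucc, h1, h2, if_false, Fin.succ_last,
        Fin.snoc_last]
    | cast j => simp [mulFace, ← Fin.castSucc_succ]
  have h2 : mulFace (Fin.last p) (Fin.snoc (α := fun _ => A) a b : Fin (p + 2) → A) =
      Fin.snoc (α := fun _ => A) (fun i : Fin p => a i.castSucc) (a (Fin.last p) * b) := by
    ext j
    induction j using Fin.lastCases with
    | last => simp [mulFace]
    | cast j => simp [mulFace]
  have h3 : (Fin.snoc (α := fun _ => A) (fun i : Fin p => a i.castSucc) (a (Fin.last p)) :
      Fin (p + 1) → A) = a := Fin.snoc_init_self a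
  have h4 : (Fin.snoc (α := fun _ => A) a b : Fin (p + 2) → A) 0 = a 0 :=
    Fin.snoc_castSucc (α := fun _ => A) b a 0
  simp only [bar, LinearMap.add_apply, LinearMap.sum_apply, LinearMap.smul_apply, hom_l, hom_r,
    MultilinearMap.curryRight_apply, Fin.sum_univ_castSucc (n := p), h0, h1, h2, h3, h4,
    Fin.snoc_last, Fin.snoc_castSucc, Fin.val_castSucc, Fin.val_last]
  rw [pow_succ _ (p + 1)]
  module

/-- The projection of `Hom (A, N)` to the maps on which `1` acts as the identity. -/
def proj : (A →ₗ[k] N) →ₗ[k] (A →ₗ[k] N) := B.hom.r 1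

@[simp] theorem proj_apply (g : A →ₗ[k] N) (a : A) : B.proj g a = g a - B.r a (g 1) := by
  simp [proj]

/-- `proj` is a map of bimodules from `Hom (A, N)` with the right action `(g c)(a) = g(c a)`. -/
theorem hom_r_proj (c : A) (g : A →ₗ[k] N) :
    B.hom.r c (B.proj g) = B.proj (g ∘ₗ LinearMap.mulLeft k c) := by
  ext a; simp [B.r_mul]

theorem hom_l_proj (c : A) (g : A →ₗ[k] N) : B.hom.l c (B.proj g) = B.proj (B.l c ∘ₗ g) := by
  ext a; simp [B.comm]

theorem proj_sub_flip (g : A →ₗ[k] N) (m : N) : B.proj (g - B.r.flip m) = B.proj g := by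
  ext a; simp [← B.r_mul]

end Bimod

end Bimod

/-! ### Koszul cocycles with coefficients in a bimodule -/

section Koszul

universe u

variable {k : Type u} [Field k] {N : Type u} [AddCommGroup N] [Module k N]

/-- Vanishing of the `p`-th cohomology of the complex `N → N³ → N³ → N² → N` that is dual to the
Koszul bimodule resolution, with generators `x, y, z` in degree `1`, `(x + y)x, xz, zy` in
degree `2`, `(x + y)xz, xzy` in degree `3` and `(x + y)xzy` in degree `4`. Only cocycles on which
`1` acts as the identity from the right are considered. -/
def KoszulVanish (B : Bimod k (Alg k) N) : ℕ → Prop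
  | 1 => ∀ h : Fin 3 → N, (∀ i, B.r 1 (h i) = h i) →
      B.l (x + y) (h 0) + B.r x (h 0) + B.r x (h 1) = 0 →
      B.l x (h 2) + B.r z (h 0) = 0 → B.l z (h 1) + B.r y (h 2) = 0 →
      ∃ n, ∀ i, h i = B.l (gen i) n - B.r (gen i) n
  | 2 => ∀ u v w : N, B.r 1 u = u → B.r 1 v = v → B.r 1 w = w →
      B.l (x + y) v = B.r z u → B.l x w = B.r y v →
      ∃ h : Fin 3 → N, u = B.l (x + y) (h 0) + B.r x (h 0) + B.r x (h 1) ∧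
        v = B.l x (h 2) + B.r z (h 0) ∧ w = B.l z (h 1) + B.r y (h 2)
  | 3 => ∀ s t : N, B.r 1 s = s → B.r 1 t = t → B.l (x + y) t + B.r y s = 0 →
      ∃ u v w : N, s = B.l (x + y) v - B.r z u ∧ t = B.l x w - B.r y v
  | 4 => ∀ u : N, B.r 1 u = u → ∃ s t : N, u = B.l (x + y) t + B.r y s
  | _ => True

/-- The linear map that removes an initial letter `y` from words. -/
noncomputable def remY : Alg k →ₗ[k] Alg k :=
  wordBasis.constr k fun w => match w with
    | (0, _, _) => 0
    | (a + 1, L, e) => word (a, L, e)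

/-- The linear map that removes an initial letter `z` from words. -/
noncomputable def remZ : Alg k →ₗ[k] Alg k :=
  wordBasis.constr k fun w => match w with
    | (0, 0 :: L, e) => word (0, L, e)
    | _ => 0

/-- A linear section, up to words with initial letter `z`, of the multiplication by `x`. -/
noncomputable def remX : Alg k →ₗ[k] Alg k :=
  wordBasis.constr k fun w => match w with
    | (0, [], some a) => word (a, [], none)
    | (a + 1, [], some b) => -word (a, [], some b)
    | (0, (c + 1) :: L, e) => word (c + 1, 0 :: L, e)
    | (a + 1, (c + 1) :: L, e) => -word (a, (c + 1) :: L, e)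
    | _ => 0

theorem constr_word {M : Type*} [AddCommGroup M] [Module k M] (f : Word → M) (w : Word) :
    wordBasis.constr k f (word w : Alg k) = f w := by
  rw [← wordBasis_apply, Module.Basis.constr_basis]

theorem remY_y_mul (a : Alg k) : remY (y * a) = a := by
  refine word_ext (remY ∘ₗ LinearMap.mulLeft k y) LinearMap.id (fun a' L e => ?_) a
  simp [y_mul_word, remY, constr_word]

theorem remZ_z_mul (a : Alg k) : remZ (z * a) = a - y * remY a := by
  refine word_ext (remZ ∘ₗ LinearMap.mulLeft k z)
    (LinearMap.id - LinearMap.mulLeft k y ∘ₗ remY) (fun a' L e => ?_) a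
  rcases a' with _ | a' <;>
    simp [z_mul_word_zero, z_mul_word_succ, remY, remZ, constr_word, y_mul_word]

theorem remX_x_mul (a : Alg k) : remX (x * a) = a - z * remZ a := by
  refine word_ext (remX ∘ₗ LinearMap.mulLeft k x)
    (LinearMap.id - LinearMap.mulLeft k z ∘ₗ remZ) (fun a' L e => ?_) a
  rcases L with _ | ⟨_ | c, L⟩ <;> rcases e with _ | b <;> rcases a' with _ | a' <;>
    simp [x_mul_word_nil_none, x_mul_word_nil_some, x_mul_word_zero_cons, x_mul_word_succ_cons,
      x_mul_word_cons_succ, z_mul_word_zero, remX, remZ, constr_word]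

theorem remZ_x_mul (a : Alg k) : remZ (x * a) = 0 := by
  refine word_ext (remZ ∘ₗ LinearMap.mulLeft k x) 0 (fun a' L e => ?_) a
  rcases L with _ | ⟨_ | c, L⟩ <;> rcases e with _ | b <;> rcases a' with _ | a' <;>
    simp [x_mul_word_nil_none, x_mul_word_nil_some, x_mul_word_zero_cons, x_mul_word_succ_cons,
      x_mul_word_cons_succ, remZ, constr_word]

/-! Exactness of the Koszul complex with coefficients in `Hom (A, N)`, where `A` acts on the right
by `(g c)(a) = g(c a)`. -/

variable (B : Bimod k (Alg k) N)

/-- The cocycle `g` makes `N × A` an extension of left modules of `A` by `N`; the components in `N`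
of the elements `a (0, 1)` form the desired map. -/
theorem coinduced_exact_one (g : Fin 3 → Alg k →ₗ[k] N)
    (h0 : ∀ a, B.l (x + y) (g 0 a) + g 0 (x * a) + g 1 (x * a) = 0)
    (h1 : ∀ a, B.l x (g 2 a) + g 0 (z * a) = 0) (h2 : ∀ a, B.l z (g 1 a) + g 2 (y * a) = 0) :
    ∃ G : Alg k →ₗ[k] N, ∀ i, g i = B.l (gen i) ∘ₗ G - G ∘ₗ LinearMap.mulLeft k (gen i) := by
  let b : Fin 3 → Module.End k (N × Alg k) := fun i =>
    LinearMap.prod (B.l (gen i) ∘ₗ LinearMap.fst k N (Alg k) - g i ∘ₗ LinearMap.snd k N (Alg k))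
      (LinearMap.mulLeft k (gen i) ∘ₗ LinearMap.snd k N (Alg k))
  have hb : ∀ i v, b i v = (B.l (gen i) v.1 - g i v.2, gen i * v.2) := fun i v => rfl
  have hxx : b 0 * b 0 + b 1 * b 0 = 0 := by
    refine LinearMap.ext fun v => ?_
    have e1 := h0 v.2
    have e2 : B.l (x * x) v.1 + B.l (y * x) v.1 = 0 := by
      rw [← LinearMap.add_apply, ← map_add, x_mul_x, neg_add_cancel, map_zero,
        LinearMap.zero_apply]
    simp only [B.l_mul, map_add, LinearMap.add_apply] at e1 e2
    simp only [LinearMap.add_apply, Module.End.mul_apply, hb, LinearMap.zero_apply, Prod.mk_add_mk,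
      map_sub, ← mul_assoc, ← add_mul, x_mul_x, neg_add_cancel, zero_mul]
    refine Prod.ext ?_ rfl
    change _ = (0 : N)
    linear_combination (norm := module) e2 - e1
  have hxz : b 0 * b 2 = 0 := by
    refine LinearMap.ext fun v => ?_
    have e1 := h1 v.2
    have e2 : B.l (x * z) v.1 = 0 := by rw [x_mul_z, map_zero, LinearMap.zero_apply]
    rw [B.l_mul] at e2
    simp only [Module.End.mul_apply, hb, LinearMap.zero_apply, map_sub, ← mul_assoc, x_mul_z,
      zero_mul, e2]
    refine Prod.ext ?_ rfl
    change _ = (0 : N)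
    linear_combination (norm := module) -e1
  have hzy : b 2 * b 1 = 0 := by
    refine LinearMap.ext fun v => ?_
    have e1 := h2 v.2
    have e2 : B.l (z * y) v.1 = 0 := by rw [z_mul_y, map_zero, LinearMap.zero_apply]
    rw [B.l_mul] at e2
    simp only [Module.End.mul_apply, hb, LinearMap.zero_apply, map_sub, ← mul_assoc, z_mul_y,
      zero_mul, e2]
    refine Prod.ext ?_ rfl
    change _ = (0 : N)
    linear_combination (norm := module) -e1
  let ρ : Alg k →ₗ[k] N × Alg k :=
    LinearMap.applyₗ ((0, 1) : N × Alg k) ∘ₗ (algLift (k := k) b hxx hxz hzy).toLinearMap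
  have hρ : ∀ i a, ρ (gen i * a) = b i (ρ a) := by
    intro i a
    simp [ρ, algLift_gen]
  have hsnd : ∀ a, (ρ a).2 = a := by
    refine alg_induction_left (LinearMap.eqLocus (LinearMap.snd k N (Alg k) ∘ₗ ρ) LinearMap.id)
      ?_ ?_
    · simp [ρ]
    · intro i a ha
      have ha' : (ρ a).2 = a := ha
      change (ρ (gen i * a)).2 = gen i * a
      rw [hρ, hb, ha']
  refine ⟨LinearMap.fst k N (Alg k) ∘ₗ ρ, fun i => LinearMap.ext fun a => ?_⟩
  simp [hρ, hb, hsnd]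

theorem coinduced_exact_two (u v w : Alg k →ₗ[k] N)
    (h0 : ∀ a, B.l (x + y) (v a) = u (z * a)) (h1 : ∀ a, B.l x (w a) = v (y * a)) :
    ∃ h : Fin 3 → Alg k →ₗ[k] N,
      u = B.l (x + y) ∘ₗ h 0 + h 0 ∘ₗ LinearMap.mulLeft k x + h 1 ∘ₗ LinearMap.mulLeft k x ∧
      v = B.l x ∘ₗ h 2 + h 0 ∘ₗ LinearMap.mulLeft k z ∧
      w = B.l z ∘ₗ h 1 + h 2 ∘ₗ LinearMap.mulLeft k y := by
  refine ⟨![v ∘ₗ remZ, u ∘ₗ remX, w ∘ₗ remY - B.l z ∘ₗ u ∘ₗ remX ∘ₗ remY], ?_, ?_, ?_⟩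
  · ext a
    have := h0 (remZ a)
    simp [remZ_x_mul, remX_x_mul] at this ⊢
    linear_combination (norm := module) -this
  · ext a
    have e : ∀ n, B.l x (B.l z n) = 0 := fun n => by
      rw [← B.l_mul, x_mul_z, map_zero, LinearMap.zero_apply]
    simp [remZ_z_mul, h1, e]
  · ext a
    simp [remY_y_mul]

theorem coinduced_exact_three (s t : Alg k →ₗ[k] N)
    (h : ∀ a, B.l (x + y) (t a) + s (y * a) = 0) :
    ∃ u v w : Alg k →ₗ[k] N, s = B.l (x + y) ∘ₗ v - u ∘ₗ LinearMap.mulLeft k z ∧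
      t = B.l x ∘ₗ w - v ∘ₗ LinearMap.mulLeft k y := by
  refine ⟨-(s ∘ₗ remZ), -(t ∘ₗ remY), 0, ?_, ?_⟩
  · ext a
    have := h (remY a)
    simp only [LinearMap.sub_apply, LinearMap.comp_apply, LinearMap.neg_apply, map_neg,
      LinearMap.mulLeft_apply, remZ_z_mul, map_sub, sub_neg_eq_add]
    rw [eq_neg_of_add_eq_zero_left this]
    abel
  · ext a
    simp [remY_y_mul]

theorem coinduced_exact_four (u : Alg k →ₗ[k] N) :
    ∃ s t : Alg k →ₗ[k] N, u = B.l (x + y) ∘ₗ t + s ∘ₗ LinearMap.mulLeft k y := by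
  refine ⟨u ∘ₗ remY, 0, ?_⟩
  ext a
  simp [remY_y_mul]

/-- Dimension shifting in the Koszul complex, along the sequence
`0 → N → Hom (A, N) → B.hom → 0` whose middle term has exact Koszul complex. The failure of a
cocycle of `B.hom` to be a cocycle of the middle term is a cocycle of `N`. -/
theorem KoszulVanish.hom : ∀ p, KoszulVanish B (p + 2) → KoszulVanish B.hom (p + 1)
  | 0, hV => by
    intro h hh h0 h1 h2
    have e0 := fun a => LinearMap.congr_fun h0 a
    have e1 := fun a => LinearMap.congr_fun h1 a
    have e2 := fun a => LinearMap.congr_fun h2 a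
    simp only [LinearMap.add_apply, Bimod.hom_l, Bimod.hom_r, LinearMap.zero_apply] at e0 e1 e2
    obtain ⟨m, m0, m1, m2⟩ := hV (B.r 1 (h 0 x + h 1 x)) (B.r 1 (h 0 z)) (B.r 1 (h 2 y))
      (B.r_one_r _ _) (B.r_one_r _ _) (B.r_one_r _ _)
      (by
        have := e0 z
        rw [x_mul_z, map_zero, map_zero] at this
        rw [B.r_r_one, B.comm, ← B.r_one_r z, map_add (B.r z)]
        congr 1
        linear_combination (norm := module) this)
      (by
        have := e1 y
        rw [z_mul_y, map_zero] at this
        rw [B.r_r_one, B.comm, ← B.r_one_r y]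
        congr 1
        linear_combination (norm := module) this)
    obtain ⟨G, hG⟩ := coinduced_exact_one B (fun i => h i - B.r.flip (m i))
      (fun a => by
        have q := congrArg (B.r a) m0
        have := e0 a
        simp only [LinearMap.sub_apply, LinearMap.flip_apply, map_sub, B.r_mul, map_add,
          LinearMap.add_apply, B.comm, B.r_r_one] at this q ⊢
        linear_combination (norm := module) this + q)
      (fun a => by
        have q := congrArg (B.r a) m1
        simp only [B.r_r_one, map_add] at q
        have := e1 a
        simp only [LinearMap.sub_apply, LinearMap.flip_apply, map_sub, B.r_mul, B.comm] at this q ⊢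
        linear_combination (norm := module) this + q)
      (fun a => by
        have q := congrArg (B.r a) m2
        simp only [B.r_r_one, map_add] at q
        have := e2 a
        simp only [LinearMap.sub_apply, LinearMap.flip_apply, map_sub, B.r_mul, B.comm] at this q ⊢
        linear_combination (norm := module) this + q)
    refine ⟨B.proj G, fun i => ?_⟩
    rw [B.hom_l_proj, B.hom_r_proj, ← map_sub, ← hG, B.proj_sub_flip]
    exact (hh i).symm
  | 1, hV => by
    intro u v w hu hv hw h0 h1
    have e0 := fun a => LinearMap.congr_fun h0 a
    have e1 := fun a => LinearMap.congr_fun h1 a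
    simp only [Bimod.hom_l, Bimod.hom_r] at e0 e1
    obtain ⟨U, V, W, m0, m1⟩ := hV (-(B.r 1 (u z))) (-(B.r 1 (v y)))
      (by rw [map_neg, B.r_one_r]) (by rw [map_neg, B.r_one_r])
      (by
        have := e0 y
        rw [z_mul_y, map_zero, zero_sub] at this
        rw [map_neg, map_neg, B.comm, B.r_r_one, this, map_neg, B.r_one_r, neg_neg, add_neg_cancel])
    obtain ⟨H, H0, H1, H2⟩ := coinduced_exact_two B (u - B.r.flip U) (v - B.r.flip V)
      (w - B.r.flip W)
      (fun a => by
        have q := congrArg (B.r a) m0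
        simp only [map_neg, B.r_r_one, map_sub] at q
        simp only [LinearMap.sub_apply, LinearMap.flip_apply, map_sub, B.r_mul, B.comm, e0]
        rw [sub_eq_add_neg (u (z * a)), q]
        abel)
      (fun a => by
        have q := congrArg (B.r a) m1
        simp only [map_neg, B.r_r_one, map_sub] at q
        simp only [LinearMap.sub_apply, LinearMap.flip_apply, map_sub, B.r_mul, B.comm, e1]
        rw [sub_eq_add_neg (v (y * a)), q]
        abel)
    refine ⟨fun i => B.proj (H i), ?_, ?_, ?_⟩
    · rw [B.hom_l_proj, B.hom_r_proj, B.hom_r_proj, ← map_add, ← map_add, ← H0, B.proj_sub_flip]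
      exact hu.symm
    · rw [B.hom_l_proj, B.hom_r_proj, ← map_add, ← H1, B.proj_sub_flip]
      exact hv.symm
    · rw [B.hom_l_proj, B.hom_r_proj, ← map_add, ← H2, B.proj_sub_flip]
      exact hw.symm
  | 2, hV => by
    intro s t hs ht h0
    have e0 := fun a => LinearMap.congr_fun h0 a
    simp only [LinearMap.add_apply, Bimod.hom_l, Bimod.hom_r, LinearMap.zero_apply] at e0
    obtain ⟨S, T, m0⟩ := hV (B.r 1 (s y)) (B.r_one_r _ _)
    obtain ⟨U, V, W, H0, H1⟩ := coinduced_exact_three B (s - B.r.flip S) (t - B.r.flip T)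
      (fun a => by
        have q := congrArg (B.r a) m0
        have := e0 a
        simp only [LinearMap.sub_apply, LinearMap.flip_apply, map_sub, B.r_mul, B.comm, map_add,
          LinearMap.add_apply, B.r_r_one] at this q ⊢
        linear_combination (norm := module) this + q)
    refine ⟨B.proj U, B.proj V, B.proj W, ?_, ?_⟩
    · rw [B.hom_l_proj, B.hom_r_proj, ← map_sub, ← H0, B.proj_sub_flip]
      exact hs.symm
    · rw [B.hom_l_proj, B.hom_r_proj, ← map_sub, ← H1, B.proj_sub_flip]
      exact ht.symm
  | 3, _ => by
    intro u hu
    obtain ⟨s, t, h⟩ := coinduced_exact_four B u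
    refine ⟨B.proj s, B.proj t, ?_⟩
    rw [B.hom_l_proj, B.hom_r_proj, ← map_add, ← h]
    exact hu.symm
  | _ + 4, _ => trivial

/-- If the Koszul complex is exact in degree `1`, every derivation is inner. The action of `1` from
the right need not be the identity, which accounts for a correction by `D 1`. -/
theorem bar_exact_one (hV : KoszulVanish B 1) (D : Alg k →ₗ[k] N)
    (hD : ∀ a b, D (a * b) = B.l a (D b) + B.r b (D a)) :
    ∃ n, ∀ a, D a = B.l a n - B.r a n := by
  have h1 : B.r 1 (D 1) = 0 := by
    have := hD 1 1
    rwa [mul_one, B.l_one, left_eq_add] at this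
  have h1' : ∀ a, B.r a (D 1) = 0 := fun a => by rw [← B.r_r_one, h1, map_zero]
  have h2 : ∀ a b, B.r 1 (D (a * b)) = B.l a (B.r 1 (D b)) + B.r b (B.r 1 (D a)) := fun a b => by
    rw [hD, map_add, B.comm, B.r_one_r, B.r_r_one]
  obtain ⟨n, hn⟩ := hV (fun i => B.r 1 (D (gen i))) (fun i => B.r_one_r _ _)
    (by
      have : B.r 1 (D (x * x + y * x)) = 0 := by rw [x_mul_x, neg_add_cancel, map_zero, map_zero]
      rw [map_add, map_add, h2, h2] at this
      rw [← this, map_add, LinearMap.add_apply]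
      abel)
    (by rw [← h2, x_mul_z, map_zero, map_zero])
    (by rw [← h2, z_mul_y, map_zero, map_zero])
  have hg : ∀ i, D (gen i) = B.l (gen i) (B.r 1 n + D 1) - B.r (gen i) (B.r 1 n + D 1) := by
    intro i
    have e1 := hD (gen i) 1
    have e2 := congrArg (B.r 1) (hn i)
    rw [mul_one] at e1
    rw [e1, ← B.r_one_r, e2]
    simp only [map_add, map_sub, h1', B.r_r_one, B.r_one_r, B.comm]
    abel
  refine ⟨B.r 1 n + D 1, alg_induction_left (LinearMap.eqLocus D
    (B.l.flip (B.r 1 n + D 1) - B.r.flip (B.r 1 n + D 1))) ?_ ?_⟩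
  · change D 1 = B.l 1 (B.r 1 n + D 1) - B.r 1 (B.r 1 n + D 1)
    rw [B.l_one, map_add, B.r_one_r, h1]
    abel
  · intro i a ha
    have ha' : D a = B.l a (B.r 1 n + D 1) - B.r a (B.r 1 n + D 1) := ha
    change D (gen i * a) = B.l (gen i * a) (B.r 1 n + D 1) - B.r (gen i * a) (B.r 1 n + D 1)
    rw [hD, ha', hg, B.l_mul, B.r_mul, map_sub, map_sub, B.comm]
    abel

/-- Hochschild cohomology in positive degrees vanishes where the cohomology of the Koszul complex
does. -/
theorem bar_exact (p : ℕ) : ∀ {N : Type u} [AddCommGroup N] [Module k N] (B : Bimod k (Alg k) N),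
    KoszulVanish B (p + 1) → ∀ f : MultilinearMap k (fun _ : Fin (p + 1) => Alg k) N,
    (∀ a, B.bar f a = 0) → ∃ g : MultilinearMap k (fun _ : Fin p => Alg k) N,
      ∀ a, f a = B.bar g a := by
  induction p with
  | zero =>
    intro N _ _ B hV f hf
    let D : Alg k →ₗ[k] N := f.toLinearMap (fun _ => 0) 0
    have hD : ∀ a : Fin 1 → Alg k, D (a 0) = f a := by
      intro a
      refine congrArg f ?_
      ext i
      obtain rfl : i = 0 := Fin.eq_zero i
      simp
    obtain ⟨n, hn⟩ := bar_exact_one B hV D (fun a b => by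
        have := hf ![a, b]
        simp only [Bimod.bar, ← hD] at this
        simp [mulFace] at this
        linear_combination (norm := module) -this)
    refine ⟨MultilinearMap.constOfIsEmpty k _ n, fun a => ?_⟩
    rw [← hD, hn]
    simp [Bimod.bar, sub_eq_add_neg]
  | succ p ih =>
    intro N _ _ B hV f hf
    obtain ⟨g, hg⟩ := ih B.hom (KoszulVanish.hom B p hV) f.curryRight (fun a => by
      ext b
      rw [B.bar_curryRight, hf, LinearMap.zero_apply])
    let g' : MultilinearMap k (fun _ : Fin (p + 1) => Alg k) N :=
      MultilinearMap.uncurryRight (M := fun _ : Fin (p + 1) => Alg k) g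
    have hg' : g'.curryRight = g :=
      MultilinearMap.curry_uncurryRight (M := fun _ : Fin (p + 1) => Alg k) g
    refine ⟨g', fun a => ?_⟩
    have e : (Fin.snoc (α := fun _ => Alg k) (Fin.init a) (a (Fin.last (p + 1))) :
      Fin (p + 2) → Alg k) = a := Fin.snoc_init_self a
    have := LinearMap.congr_fun (hg (Fin.init a)) (a (Fin.last (p + 1)))
    rw [← hg', B.bar_curryRight, e, MultilinearMap.curryRight_apply, e] at this
    exact this

end Koszul

/-! ### Vanishing of Hochschild homology in degrees at least two -/

section Vanishing

universe u

variable {k : Type u} [Field k]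

/-- The dual of the regular bimodule, `(a φ)(b) = φ(b a)` and `(φ a)(b) = φ(a b)`. -/
def dualBimod (k A : Type*) [CommRing k] [Ring A] [Algebra k A] :
    Bimod k A (Module.Dual k A) where
  l := LinearMap.mk₂ k (fun a φ => φ ∘ₗ LinearMap.mulRight k a)
    (by intros; ext; simp [mul_add]) (by intros; ext; simp) (by intros; ext; simp)
    (by intros; ext; simp)
  r := LinearMap.mk₂ k (fun a φ => φ ∘ₗ LinearMap.mulLeft k a)
    (by intros; ext; simp [add_mul]) (by intros; ext; simp) (by intros; ext; simp)
    (by intros; ext; simp)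
  l_mul a b φ := by ext; simp [mul_assoc]
  l_one φ := by ext; simp
  r_mul a b φ := by ext; simp
  comm a b φ := by ext; simp [mul_assoc]

@[simp] theorem dualBimod_l {A : Type*} [Ring A] [Algebra k A] (a b : A) (φ : Module.Dual k A) :
    (dualBimod k A).l a φ b = φ (b * a) := rfl

@[simp] theorem dualBimod_r {A : Type*} [Ring A] [Algebra k A] (a b : A) (φ : Module.Dual k A) :
    (dualBimod k A).r a φ b = φ (a * b) := rfl

/-- Exactness of the Koszul complex of the regular bimodule in degree `2`. -/
theorem koszul_exact_two (a b c : Alg k) (h0 : a * (x + y) + x * a + z * b = 0)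
    (h1 : x * a + c * z = 0) (h2 : b * x + y * c = 0) :
    ∃ u v, a = z * u ∧ b = y * v - u * (x + y) ∧ c = -(v * x) := by
  -- Subtracting a boundary, it may be assumed that no word of `a` begins with `z`.
  have key : ∀ a b c : Alg k, a * (x + y) + x * a + z * b = 0 → x * a + c * z = 0 →
      (∀ L e, coef (0, 0 :: L, e) a = 0) → a = 0 := by
    intro a b c h0 h1 ha
    have hx : ∀ w, coef w (x * a) = -coef w (c * z) := fun w => by
      rw [eq_neg_of_add_eq_zero_left h1, map_neg]
    have hsome : ∀ n L b, coef (n, L, some b) a = 0 := by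
      intro n L b
      rcases L with _ | ⟨_ | c', L⟩
      · have := hx (n + 1, [], some b)
        rw [coef_x_mul_succ_nil_some, coef_mul_z_some, neg_zero, neg_eq_zero] at this
        exact this
      · rcases n with _ | n
        · exact ha _ _
        · have := hx (0, (n + 1) :: L, some b)
          rw [coef_x_mul_zero_cons_succ, coef_mul_z_some, neg_zero] at this
          exact this
      · have := hx (n + 1, (c' + 1) :: L, some b)
        rw [coef_x_mul_succ_cons_succ, coef_mul_z_some, neg_zero, neg_eq_zero] at this
        exact this
    refine eq_zero_of_coef fun ⟨n, L, e⟩ => ?_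
    rcases e with _ | b'
    · rcases L with _ | ⟨c', L⟩
      · have := hx (0, [], some n)
        rw [coef_x_mul_zero_nil_some, coef_mul_z_some, neg_zero] at this
        exact this
      · by_cases hn : n ≠ 0 ∨ c' ≠ 0
        · have := congrArg (coef (n, c' :: L, some 0)) h0
          rw [mul_add, map_add, map_add, map_add, coef_mul_x_cons, coef_mul_y_some_zero,
            coef_cons_z_mul _ _ hn, map_zero, add_zero, add_zero] at this
          rwa [hx, coef_mul_z_some, neg_zero, add_zero] at this
        · push Not at hn
          rw [hn.1, hn.2]
          exact ha _ _
    · exact hsome _ _ _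
  have ha : a = z * remZ a := by
    rw [← sub_eq_zero]
    refine key _ (b + remZ a * (x + y)) c ?_ ?_ ?_
    · rw [← h0]
      simp only [sub_mul, mul_sub, mul_add, x_mul_z_assoc, mul_assoc]
      abel
    · rw [mul_sub, x_mul_z_assoc, sub_zero, h1]
    · intro L e
      refine word_ext (coef (0, 0 :: L, e) ∘ₗ (LinearMap.id - LinearMap.mulLeft k z ∘ₗ remZ)) 0
        (fun a' L' e' => ?_) a
      rcases L' with _ | ⟨_ | c, L'⟩ <;> rcases e' with _ | b <;> rcases a' with _ | a' <;>
        simp [z_mul_word_zero, remZ, constr_word, coef_word]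
  have hb : z * (b + remZ a * (x + y)) = 0 := by
    have e : x * a = 0 := by rw [ha, x_mul_z_assoc]
    rw [e, add_zero] at h0
    nth_rewrite 1 [ha] at h0
    rw [← h0, mul_add, mul_assoc, add_comm]
  have hb' := remZ_z_mul (b + remZ a * (x + y))
  rw [hb, map_zero, eq_comm, sub_eq_zero] at hb'
  refine ⟨remZ a, remY (b + remZ a * (x + y)), ha, ?_, ?_⟩
  · rw [← hb']; abel
  · have e : y * (remY (b + remZ a * (x + y)) * x + c) = 0 := by
      rw [mul_add, ← mul_assoc, ← hb', add_mul, mul_assoc, add_mul, x_mul_x, neg_add_cancel,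
        mul_zero, add_zero, h2]
    have := remY_y_mul (remY (b + remZ a * (x + y)) * x + c)
    rw [e, map_zero] at this
    exact eq_neg_of_add_eq_zero_right this.symm

theorem koszulVanish_dual_two : KoszulVanish (dualBimod k (Alg k)) 2 := by
  intro u v w _ _ _ h0 h1
  have e0 : ∀ a, v (a * (x + y)) = u (z * a) := fun a => LinearMap.congr_fun h0 a
  have e1 : ∀ a, w (a * x) = v (y * a) := fun a => LinearMap.congr_fun h1 a
  -- The functional `(u, v, w)` vanishes on Koszul cycles, hence it factors through the
  -- differential.
  let d : Alg k × Alg k × Alg k →ₗ[k] Alg k × Alg k × Alg k :=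
    let p0 := LinearMap.fst k (Alg k) (Alg k × Alg k)
    let p1 := LinearMap.fst k (Alg k) (Alg k) ∘ₗ LinearMap.snd k (Alg k) (Alg k × Alg k)
    let p2 := LinearMap.snd k (Alg k) (Alg k) ∘ₗ LinearMap.snd k (Alg k) (Alg k × Alg k)
    (LinearMap.mulRight k (x + y) ∘ₗ p0 + LinearMap.mulLeft k x ∘ₗ p0
      + LinearMap.mulLeft k z ∘ₗ p1).prod
      ((LinearMap.mulLeft k x ∘ₗ p0 + LinearMap.mulRight k z ∘ₗ p2).prod
        (LinearMap.mulRight k x ∘ₗ p1 + LinearMap.mulLeft k y ∘ₗ p2))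
  have hd : ∀ a b c, d (a, b, c) =
      (a * (x + y) + x * a + z * b, x * a + c * z, b * x + y * c) := fun a b c => rfl
  let F : Alg k × Alg k × Alg k →ₗ[k] k := u.coprod (v.coprod w)
  have hF : ∀ a b c, F (a, b, c) = u a + (v b + w c) := fun a b c => by simp [F]
  have hker : F ∈ (LinearMap.ker d).dualAnnihilator := by
    rw [Submodule.mem_dualAnnihilator]
    rintro ⟨a, b, c⟩ habc
    rw [LinearMap.mem_ker, hd, Prod.mk_eq_zero, Prod.mk_eq_zero] at habc
    obtain ⟨u', v', ha, hb, hc⟩ := koszul_exact_two a b c habc.1 habc.2.1 habc.2.2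
    rw [hF, ha, hb, hc, map_sub, map_neg, e0, e1]
    ring
  rw [← LinearMap.range_dualMap_eq_dualAnnihilator_ker] at hker
  obtain ⟨G, hG⟩ := hker
  have hG' : ∀ a b c, G (d (a, b, c)) = u a + (v b + w c) := fun a b c => by
    rw [← hF, ← hG]; rfl
  refine ⟨![G ∘ₗ LinearMap.inl k _ _, G ∘ₗ LinearMap.inr k _ _ ∘ₗ LinearMap.inl k _ _,
    G ∘ₗ LinearMap.inr k _ _ ∘ₗ LinearMap.inr k _ _], ?_, ?_, ?_⟩
  · ext a
    have := hG' a 0 0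
    rw [hd, map_zero, map_zero, add_zero, add_zero] at this
    simp only [zero_mul, mul_zero, add_zero] at this
    rw [← this]
    simp only [LinearMap.add_apply, dualBimod_l, dualBimod_r, Matrix.cons_val_zero,
      Matrix.cons_val_one, LinearMap.comp_apply, ← map_add]
    simp
  · ext a
    have := hG' 0 a 0
    rw [hd, map_zero, map_zero, add_zero, zero_add] at this
    simp only [zero_mul, mul_zero, add_zero, zero_add] at this
    rw [← this]
    simp only [LinearMap.add_apply, dualBimod_l, dualBimod_r, Matrix.cons_val_zero,
      Matrix.cons_val, LinearMap.comp_apply, ← map_add]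
    simp
  · ext a
    have := hG' 0 0 a
    rw [hd, map_zero, map_zero, zero_add, zero_add] at this
    simp only [zero_mul, mul_zero, zero_add] at this
    rw [← this]
    simp only [LinearMap.add_apply, dualBimod_l, dualBimod_r, Matrix.cons_val_one,
      Matrix.cons_val, LinearMap.comp_apply, ← map_add]
    simp

theorem koszulVanish_dual_three : KoszulVanish (dualBimod k (Alg k)) 3 := by
  intro s t _ _ h
  have h' : ∀ a, t (a * (x + y)) + s (y * a) = 0 := fun a => LinearMap.congr_fun h a
  refine ⟨-((s + t ∘ₗ remY ∘ₗ LinearMap.mulRight k (x + y)) ∘ₗ remZ), -(t ∘ₗ remY), 0, ?_, ?_⟩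
  · ext a
    have e1 := h' (remY a)
    simp only [LinearMap.sub_apply, dualBimod_l, dualBimod_r, LinearMap.neg_apply,
      LinearMap.comp_apply, LinearMap.add_apply, LinearMap.mulRight_apply, remZ_z_mul, map_sub,
      mul_assoc, remY_y_mul]
    linear_combination e1
  · ext a
    simp [remY_y_mul]

theorem koszulVanish_dual_four : KoszulVanish (dualBimod k (Alg k)) 4 := by
  intro u _
  refine ⟨u ∘ₗ remY, 0, ?_⟩
  ext a
  simp [remY_y_mul]

theorem koszulVanish_dual : ∀ p, KoszulVanish (dualBimod k (Alg k)) (p + 2)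
  | 0 => koszulVanish_dual_two
  | 1 => koszulVanish_dual_three
  | 2 => koszulVanish_dual_four
  | _ + 3 => trivial

/-- A linear functional on Hochschild chains, as a cochain with values in the dual of the algebra.
-/
def dualCochain {A : Type*} [Ring A] [Algebra k A] {p : ℕ} (F : Chain k A p →ₗ[k] k) :
    MultilinearMap k (fun _ : Fin p => A) (Module.Dual k A) where
  toFun a :=
    { toFun := fun b => (F.compMultilinearMap (PiTensorProduct.tprod k)).curryLeft b a
      map_add' := fun b c => by simp
      map_smul' := fun r b => by simp }
  map_update_add' a i u v := by
    ext b
    exact ((F.compMultilinearMap (PiTensorProduct.tprod k)).curryLeft b).map_update_add a i u v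
  map_update_smul' a i r u := by
    ext b
    exact ((F.compMultilinearMap (PiTensorProduct.tprod k)).curryLeft b).map_update_smul a i r u

theorem dualCochain_apply {A : Type*} [Ring A] [Algebra k A] {p : ℕ} (F : Chain k A p →ₗ[k] k)
    (a : Fin p → A) (b : A) :
    dualCochain F a b = F (PiTensorProduct.tprod k (Fin.cons b a : Fin (p + 1) → A)) := rfl

theorem exists_dualCochain_eq {A : Type*} [Ring A] [Algebra k A] {p : ℕ}
    (g : MultilinearMap k (fun _ : Fin p => A) (Module.Dual k A)) :
    ∃ G : Chain k A p →ₗ[k] k, dualCochain G = g := by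
  let c : A →ₗ[k] MultilinearMap k (fun _ : Fin p => A) k :=
    { toFun := fun b => (Module.Dual.eval k A b).compMultilinearMap g
      map_add' := fun b b' => by ext; simp
      map_smul' := fun r b => by ext; simp }
  let c' : MultilinearMap k (fun _ : Fin (p + 1) => A) k :=
    LinearMap.uncurryLeft (M := fun _ : Fin (p + 1) => A) c
  refine ⟨PiTensorProduct.lift c', ?_⟩
  ext a b
  rw [dualCochain_apply, PiTensorProduct.lift.tprod]
  rfl

theorem apply_boundary {A : Type*} [Ring A] [Algebra k A] {p : ℕ} (F : Chain k A p →ₗ[k] k)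
    (a : Fin (p + 1) → A) (b : A) :
    F (boundary k A p (PiTensorProduct.tprod k (Fin.cons b a : Fin (p + 2) → A))) =
      (dualBimod k A).bar (dualCochain F) a b := by
  have h0 : mulFace 0 (Fin.cons b a : Fin (p + 2) → A) =
      (Fin.cons (b * a 0) (fun i => a i.succ) : Fin (p + 1) → A) := by
    ext j
    induction j using Fin.cases <;> simp [mulFace]
  have h1 : ∀ i : Fin p, mulFace i.succ (Fin.cons b a : Fin (p + 2) → A) =
      (Fin.cons b (mulFace i a) : Fin (p + 1) → A) := by
    intro i
    ext j
    induction j using Fin.cases <;> simp [mulFace]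
  have h2 : lastFace (Fin.cons b a : Fin (p + 2) → A) =
      (Fin.cons (a (Fin.last p) * b) (fun i => a i.castSucc) : Fin (p + 1) → A) := by
    ext j
    induction j using Fin.cases <;> simp [lastFace, ← Fin.succ_last]
  rw [boundary_tprod, Fin.sum_univ_succ, h0, h2]
  simp only [h1, Bimod.bar, LinearMap.add_apply, LinearMap.sum_apply, LinearMap.smul_apply,
    dualBimod_l, dualBimod_r, dualCochain_apply, map_add, map_sum, map_smul, Fin.val_zero, pow_zero,
    one_smul, Fin.val_succ]

/-- Hochschild homology of the algebra vanishes in degrees at least two: a functional that vanishes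
on boundaries is a cocycle with values in the dual bimodule, hence a coboundary, so that it vanishes
on cycles. -/
theorem cycles_le_boundaries (p : ℕ) :
    cycles k (Alg k) (p + 2) ≤ boundaries k (Alg k) (p + 2) := by
  intro c hc
  by_contra hcb
  obtain ⟨F, hFc, hF⟩ := Submodule.exists_le_ker_of_notMem hcb
  obtain ⟨g, hg⟩ := bar_exact (p + 1) (dualBimod k (Alg k)) (koszulVanish_dual p) (dualCochain F)
    (fun a => by
      ext b
      rw [← apply_boundary]
      exact hF ⟨_, rfl⟩)
  obtain ⟨G, rfl⟩ := exists_dualCochain_eq g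
  have hFG : F = G ∘ₗ boundary k (Alg k) (p + 1) := by
    ext a
    have e : a = (Fin.cons (a 0) (Fin.tail a) : Fin (p + 3) → Alg k) := (Fin.cons_self_tail a).symm
    simp only [LinearMap.compMultilinearMap_apply, LinearMap.comp_apply]
    rw [e, apply_boundary, ← hg, dualCochain_apply]
  have hc' : boundary k (Alg k) (p + 1) c = 0 := hc
  exact hFc (by rw [hFG, LinearMap.comp_apply, hc', map_zero])

end Vanishing

/-! ### Hochschild homology in degree zero -/

section HomologyZero

variable {k : Type*} [Field k]

/-- The quotient map to `HH_0`. -/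
noncomputable def zeroHom : Alg k →ₗ[k] Homology k (Alg k) 0 :=
  Subquotient.mk _ _ ∘ₗ LinearMap.codRestrict (cycles k (Alg k) 0)
    (PiTensorProduct.subsingletonEquiv (R := k) (s := fun _ => Alg k) (0 : Fin 1)).symm.toLinearMap
    fun _ => Submodule.mem_top

theorem zeroHom_apply (a : Alg k) : zeroHom a = zeroClass a := by
  simp only [zeroHom, zeroClass, LinearMap.comp_apply]
  congr 1
  ext1
  exact PiTensorProduct.subsingletonEquiv_symm_apply' _ _

theorem boundary_zero_tprod (v : Fin 2 → Alg k) :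
    boundary k (Alg k) 0 (PiTensorProduct.tprod k v) =
      (PiTensorProduct.subsingletonEquiv (R := k) (s := fun _ => Alg k) (0 : Fin 1)).symm
        (v 0 * v 1 - v 1 * v 0) := by
  rw [boundary_tprod, map_sub, PiTensorProduct.subsingletonEquiv_symm_apply',
    PiTensorProduct.subsingletonEquiv_symm_apply']
  have h1 : mulFace 0 v = fun _ : Fin 1 => v 0 * v 1 := by
    ext j; fin_cases j; simp [mulFace]
  have h2 : lastFace v = fun _ : Fin 1 => v 1 * v 0 := by
    ext j; fin_cases j; simp [lastFace]
  simp [h1, h2, sub_eq_add_neg]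

theorem zeroHom_mul_comm (a b : Alg k) : zeroHom (a * b) = zeroHom (b * a) := by
  rw [← sub_eq_zero, ← map_sub]
  refine (Subquotient.mk_eq_zero _ _ _).2 ⟨PiTensorProduct.tprod k ![a, b], ?_⟩
  rw [boundary_zero_tprod]
  rfl

theorem zeroHom_surjective : Function.Surjective (zeroHom (k := k)) := by
  intro ξ
  obtain ⟨c, rfl⟩ := Subquotient.mk_surjective _ _ ξ
  refine ⟨PiTensorProduct.subsingletonEquiv (R := k) (s := fun _ => Alg k) (0 : Fin 1) c, ?_⟩
  simp only [zeroHom, LinearMap.comp_apply]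
  congr 1
  ext1
  exact LinearEquiv.symm_apply_apply _ _

/-- The map on `HH_0` induced by a trace. -/
noncomputable def zeroLift {M : Type*} [AddCommGroup M] [Module k M] (T : Alg k →ₗ[k] M)
    (hT : ∀ a b, T (a * b) = T (b * a)) : Homology k (Alg k) 0 →ₗ[k] M :=
  Submodule.liftQ _
    (T ∘ₗ (PiTensorProduct.subsingletonEquiv (R := k) (s := fun _ => Alg k) (0 : Fin 1)).toLinearMap
      ∘ₗ Submodule.subtype _) (by
    rintro ⟨c, hc⟩ ⟨d, hd⟩
    suffices h : (T ∘ₗ (PiTensorProduct.subsingletonEquiv (R := k) (s := fun _ => Alg k)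
        (0 : Fin 1)).toLinearMap) ∘ₗ boundary k (Alg k) 0 = 0 by
      have := LinearMap.congr_fun h d
      rw [LinearMap.comp_apply, hd] at this
      exact this
    ext v
    simp [boundary_zero_tprod, hT (v 0) (v 1)])

theorem zeroLift_zeroHom {M : Type*} [AddCommGroup M] [Module k M] (T : Alg k →ₗ[k] M)
    (hT : ∀ a b, T (a * b) = T (b * a)) (a : Alg k) : zeroLift T hT (zeroHom a) = T a := by
  change T (PiTensorProduct.subsingletonEquiv (R := k) (s := fun _ => Alg k) (0 : Fin 1)
    ((PiTensorProduct.subsingletonEquiv (R := k) (s := fun _ => Alg k) (0 : Fin 1)).symm a)) = T a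
  rw [LinearEquiv.apply_symm_apply]

/-- Labels of the classes of words in `HH_0`: `inl (false, n)` for `y^n`, `inl (true, n)` for
`y^n x` and the cyclic list of gaps for a cyclic word with at least one letter `z`. -/
abbrev TraceKey := (Bool × ℕ) ⊕ Cycle ℕ

/-- The trace of a normal word: the label of its class in `HH_0`, or zero. The first gap of the
cyclic list of `y^a z g_2 z ⋯ x y^b` is `a + b`, as this word is conjugate to
`z g_2 z ⋯ x y^{a + b}`. -/
noncomputable def traceVal : Word → TraceKey →₀ k
  | (a, [], none) => Finsupp.single (Sum.inl (false, a)) 1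
  | (a, [], some b) => Finsupp.single (Sum.inl (true, a + b)) 1
  | (0, c :: l, none) => Finsupp.single (Sum.inr ((c :: l : List ℕ) : Cycle ℕ)) 1
  | (_ + 1, _ :: _, none) => 0
  | (a, 0 :: l, some b) =>
    if a + b = 0 then 0 else Finsupp.single (Sum.inr (((a + b) :: l : List ℕ) : Cycle ℕ)) 1
  | (_, (_ + 1) :: _, some _) => 0

/-- A trace on the algebra that separates the classes of the basis of `HH_0`. -/
noncomputable def traceMap : Alg k →ₗ[k] TraceKey →₀ k := wordBasis.constr k traceVal

theorem traceMap_word (w : Word) : traceMap (word w : Alg k) = traceVal w := constr_word _ w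

theorem traceMap_gen_mul (i : Fin 3) (a : Alg k) : traceMap (gen i * a) = traceMap (a * gen i) := by
  refine word_ext (traceMap ∘ₗ LinearMap.mulLeft k (gen i))
    (traceMap ∘ₗ LinearMap.mulRight k (gen i)) (fun a L e => ?_) a
  simp only [LinearMap.comp_apply, LinearMap.mulLeft_apply, LinearMap.mulRight_apply]
  fin_cases i
  · simp only [Fin.zero_eta]
    rcases L with _ | ⟨_ | c, L⟩ <;> rcases e with _ | b <;> rcases a with _ | a <;>
      simp [x_mul_word_nil_none, x_mul_word_nil_some, x_mul_word_zero_cons, x_mul_word_succ_cons,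
        x_mul_word_cons_succ, word_none_mul_x, word_nil_some_mul_x, word_cons_some_mul_x,
        traceMap_word, traceVal, add_right_comm, Nat.add_comm 1]
  · simp only [Fin.mk_one]
    rcases L with _ | ⟨_ | c, L⟩ <;> rcases e with _ | b <;>
      simp [y_mul_word, word_nil_none_mul_y, word_cons_none_mul_y, word_some_mul_y, traceMap_word,
        traceVal, add_right_comm, add_assoc]
  · simp only [Fin.reduceFinMk]
    have hc : ∀ (c : ℕ) (L : List ℕ),
        ((c :: L : List ℕ) : Cycle ℕ) = ((L ++ [c] : List ℕ) : Cycle ℕ) :=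
      fun c L => Cycle.coe_cons_eq_coe_append L c
    rcases L with _ | ⟨c, L⟩ <;> rcases e with _ | _ | b <;> rcases a with _ | a <;>
      simp [z_mul_word_zero, z_mul_word_succ, word_none_mul_z, word_some_zero_mul_z,
        word_some_succ_mul_z, traceMap_word, traceVal, hc]

theorem traceMap_mul_comm (a b : Alg k) : traceMap (a * b) = traceMap (b * a) := by
  revert b
  refine alg_induction_left
    { carrier := {a | ∀ b, traceMap (a * b) = traceMap (b * a)}
      add_mem' := fun {a a'} h h' b => by
        simp only [add_mul, mul_add, map_add, h b, h' b]
      zero_mem' := fun b => by simp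
      smul_mem' := fun r a h b => by
        simp only [smul_mul_assoc, mul_smul_comm, map_smul, h b] } ?_ ?_ a
  · intro b
    rw [one_mul, mul_one]
  · intro i a ha b
    rw [mul_assoc, traceMap_gen_mul, mul_assoc, ha, mul_assoc]

/-- The map on `HH_0` induced by `traceMap`. It sends distinct classes of the basis to distinct
standard basis vectors. -/
noncomputable def zeroTrace : Homology k (Alg k) 0 →ₗ[k] TraceKey →₀ k :=
  zeroLift traceMap traceMap_mul_comm

theorem zeroTrace_zeroClass (a : Alg k) : zeroTrace (zeroClass a) = traceMap a := by
  rw [← zeroHom_apply, zeroTrace, zeroLift_zeroHom]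

/-! Lists of pairs and lists of gaps. -/

/-- The list of gaps `n_1, 0, …, 0, n_2, 0, …, 0, …` with `m_j - 1` zeros after `n_j`. -/
def pairGaps : List (ℕ+ × ℕ+) → List ℕ
  | [] => []
  | e :: r => (e.1 : ℕ) :: (List.replicate ((e.2 : ℕ) - 1) 0 ++ pairGaps r)

/-- The exponents `m` and `(n_j, m_j)` with `z^m x y^{n_1} z^{m_1} ⋯ = z g_1 z g_2 z ⋯` for a list
of gaps `g_1, g_2, …`. -/
def gapDecode : List ℕ → ℕ+ × List (ℕ+ × ℕ+)
  | [] => (1, [])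
  | 0 :: l => ((gapDecode l).1 + 1, (gapDecode l).2)
  | (c + 1) :: l => (1, (c.succPNat, (gapDecode l).1) :: (gapDecode l).2)

theorem gapDecode_append (m : ℕ+) (r : List (ℕ+ × ℕ+)) :
    gapDecode (List.replicate ((m : ℕ) - 1) 0 ++ pairGaps r) = (m, r) := by
  induction r generalizing m with
  | nil =>
    induction m using PNat.recOn with
    | one => rfl
    | succ m ih =>
      obtain ⟨c, hc⟩ := Nat.exists_eq_succ_of_ne_zero m.ne_zero
      have : ((m + 1 : ℕ+) : ℕ) - 1 = ((m : ℕ) - 1) + 1 := by rw [PNat.add_coe, hc]; simp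
      rw [this, List.replicate_succ, List.cons_append, gapDecode, ih]
  | cons e r ihr =>
    induction m using PNat.recOn with
    | one =>
      obtain ⟨⟨n, hn⟩, m⟩ := e
      obtain ⟨c, rfl⟩ := Nat.exists_eq_succ_of_ne_zero hn.ne'
      simp only [PNat.one_coe, Nat.sub_self, List.replicate_zero, List.nil_append, pairGaps,
        PNat.mk_coe, Nat.succ_eq_add_one, gapDecode, ihr]
      rfl
    | succ m ih =>
      obtain ⟨c, hc⟩ := Nat.exists_eq_succ_of_ne_zero m.ne_zero
      have : ((m + 1 : ℕ+) : ℕ) - 1 = ((m : ℕ) - 1) + 1 := by rw [PNat.add_coe, hc]; simp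
      rw [this, List.replicate_succ, List.cons_append, gapDecode, ih]

theorem pairGaps_injective : Function.Injective pairGaps := by
  intro r r' h
  have := congrArg (fun l => (gapDecode (List.replicate (((1 : ℕ+) : ℕ) - 1) 0 ++ l)).2) h
  simpa only [gapDecode_append] using this

theorem pairGaps_append (r r' : List (ℕ+ × ℕ+)) :
    pairGaps (r ++ r') = pairGaps r ++ pairGaps r' := by
  induction r with
  | nil => rfl
  | cons e r ih => simp [pairGaps, ih]

theorem gapProd_replicate (n : ℕ) : (gapProd (List.replicate n 0) : Alg k) = z ^ n := by
  simp [gapProd, gapZ]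

theorem gapProd_pairGaps (m : ℕ+) (r : List (ℕ+ × ℕ+)) :
    (z * gapProd (List.replicate ((m : ℕ) - 1) 0 ++ pairGaps r) : Alg k) =
      z ^ (m : ℕ) * block (toNat r) := by
  have h : ∀ r : List (ℕ+ × ℕ+), (gapProd (pairGaps r) : Alg k) = block (toNat r) := by
    intro r
    induction r with
    | nil => rfl
    | cons e r ih =>
      obtain ⟨⟨n, hn⟩, m⟩ := e
      obtain ⟨c, rfl⟩ := Nat.exists_eq_succ_of_ne_zero hn.ne'
      obtain ⟨d, hd⟩ := Nat.exists_eq_succ_of_ne_zero m.ne_zero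
      simp [pairGaps, toNat, block_cons, gapZ, gapProd_replicate, ih, hd, pow_succ', mul_assoc]
  obtain ⟨d, hd⟩ := Nat.exists_eq_succ_of_ne_zero m.ne_zero
  rw [gapProd_append, gapProd_replicate, h, hd, ← mul_assoc, pow_succ']
  rfl

theorem append_pairGaps_gapDecode (l : List ℕ) :
    List.replicate (((gapDecode l).1 : ℕ) - 1) 0 ++ pairGaps (gapDecode l).2 = l := by
  induction l with
  | nil => rfl
  | cons c l ih =>
    rcases c with _ | c
    · obtain ⟨d, hd⟩ := Nat.exists_eq_succ_of_ne_zero (gapDecode l).1.ne_zero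
      rw [gapDecode, PNat.add_coe, hd]
      rw [hd] at ih
      simp only [Nat.succ_eq_add_one, add_tsub_cancel_right, PNat.one_coe] at ih ⊢
      rw [List.replicate_succ, List.cons_append, ih]
    · simp [gapDecode, pairGaps, ih]

theorem z_mul_gapProd (l : List ℕ) : (z * gapProd l : Alg k) =
    z ^ ((gapDecode l).1 : ℕ) * block (toNat (gapDecode l).2) := by
  rw [← gapProd_pairGaps, append_pairGaps_gapDecode]

theorem isRotated_iff_append {α : Type*} {l l' : List α} :
    l ~r l' ↔ ∃ u v, l = u ++ v ∧ l' = v ++ u := by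
  constructor
  · rintro ⟨n, rfl⟩
    rw [List.rotate_eq_drop_append_take_mod]
    exact ⟨_, _, (List.take_append_drop _ _).symm, rfl⟩
  · rintro ⟨u, v, rfl, rfl⟩
    exact List.isRotated_append

/-- If a list of gaps that comes from pairs is cut before a nonzero gap, both parts come from pairs.
-/
theorem pairGaps_split (q : List (ℕ+ × ℕ+)) (u v : List ℕ) (c : ℕ)
    (h : pairGaps q = u ++ (c + 1) :: v) :
    ∃ q₁ q₂, q = q₁ ++ q₂ ∧ pairGaps q₁ = u ∧ pairGaps q₂ = (c + 1) :: v := by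
  induction q generalizing u with
  | nil => simp [pairGaps] at h
  | cons e q ih =>
    rcases u with _ | ⟨d, u⟩
    · exact ⟨[], e :: q, rfl, rfl, h⟩
    · rw [pairGaps, List.cons_append, List.cons.injEq] at h
      obtain ⟨h1, h2⟩ := h
      rw [List.append_eq_append_iff] at h2
      rcases h2 with ⟨a, rfl, ha⟩ | ⟨a, ha, ha'⟩
      · obtain ⟨q₁, q₂, rfl, rfl, hq⟩ := ih a ha
        refine ⟨e :: q₁, q₂, rfl, ?_, hq⟩
        rw [pairGaps, h1]
      · rcases a with _ | ⟨a, as⟩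
        · obtain ⟨q₁, q₂, rfl, hq₁, hq⟩ := ih [] (by simpa using ha'.symm)
          refine ⟨e :: q₁, q₂, rfl, ?_, hq⟩
          rw [pairGaps, h1, hq₁, ha]
          simp
        · rw [List.cons_append, List.cons.injEq] at ha'
          have : a ∈ List.replicate ((e.2 : ℕ) - 1) 0 := by rw [ha]; simp
          rw [← ha'.1] at this
          simp at this

theorem isRotated_of_pairGaps {q q' : List (ℕ+ × ℕ+)} (h : pairGaps q ~r pairGaps q') :
    q ~r q' := by
  obtain ⟨u, v, hu, hv⟩ := isRotated_iff_append.1 h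
  rcases q' with _ | ⟨e, q'⟩
  · simp only [pairGaps, List.nil_eq, List.append_eq_nil_iff] at hv
    rw [hv.1, hv.2] at hu
    rw [pairGaps_injective (a₁ := q) (a₂ := []) hu]
  · rcases v with _ | ⟨c, v⟩
    · rw [List.append_nil] at hu
      rw [List.nil_append, ← hu] at hv
      rw [pairGaps_injective hv]
    · obtain ⟨d, hd⟩ := Nat.exists_eq_succ_of_ne_zero e.1.ne_zero
      have hc : c = d + 1 := by
        rw [pairGaps, List.cons_append, List.cons.injEq] at hv
        rw [← hv.1, hd]
      subst hc
      obtain ⟨q₁, q₂, rfl, h1, h2⟩ := pairGaps_split _ _ _ _ hu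
      have : e :: q' = q₂ ++ q₁ := pairGaps_injective (by rw [hv, pairGaps_append, h1, h2])
      rw [this]
      exact List.isRotated_append

/-! The basis of `HH_0`. -/

/-- A family that spans, and that a linear map sends to nonzero multiples of standard basis vectors,
is a basis up to repetitions. -/
theorem IsBasisUpTo.of_key {k ι κ M : Type*} [Field k] [AddCommGroup M] [Module k M]
    {rel : ι → ι → Prop} {v : ι → M} (T : M →ₗ[k] κ →₀ k) (key : ι → κ) (c : ι → k)
    (hc : ∀ i, c i ≠ 0) (hT : ∀ i, T (v i) = Finsupp.single (key i) (c i))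
    (hkey : ∀ i j, key i = key j → rel i j) (hrel : ∀ i j, rel i j → v i = v j)
    (hspan : Submodule.span k (Set.range v) = ⊤) : IsBasisUpTo k rel v := by
  have hv : ∀ i j, key i = key j → v i = v j := fun i j h => hrel i j (hkey i j h)
  refine ⟨fun i j => ⟨fun h => ?_, hrel i j⟩, ?_, hspan⟩
  · have := congrArg T h
    rw [hT, hT, Finsupp.single_eq_single_iff] at this
    rcases this with h | h
    · exact hkey i j h.1
    · exact absurd h.1 (hc i)
  · let s : Set.range v → ι := fun w => w.2.choose
    have hs : ∀ w, v (s w) = w.1 := fun w => w.2.choose_spec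
    refine LinearIndependent.of_comp T ?_
    have h1 : T ∘ Subtype.val = fun w : Set.range v =>
        (Units.mk0 (c (s w)) (hc _)) • Finsupp.single (key (s w)) (1 : k) := by
      funext w
      rw [Function.comp_apply, ← hs w, hT]
      simp [Units.smul_def]
    rw [h1]
    refine LinearIndependent.units_smul ?_ _
    refine (Finsupp.linearIndependent_single_one k κ).comp (fun w => key (s w)) ?_
    intro w w' h
    exact Subtype.ext (by rw [← hs w, ← hs w', hv _ _ h])

/-- The label in `TraceKey` of a class in the basis of `HH_0`. -/
def key₀ : Label₀ → TraceKey
  | .zeta => Sum.inl (false, 0)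
  | .alpha => Sum.inl (true, 0)
  | .beta n => Sum.inl (true, n)
  | .gamma n => Sum.inl (false, n)
  | .delta n => Sum.inr (List.replicate n 0 : List ℕ)
  | .eps e r => Sum.inr (pairGaps (e :: r) : List ℕ)

theorem block_mul_x (l : List (ℕ × ℕ)) : (block l * x : Alg k) = x * cyclicWord l := by
  induction l with
  | nil => simp [block, cyclicWord]
  | cons e l ih =>
    have : (cyclicWord (e :: l) : Alg k) = y ^ e.1 * z ^ e.2 * x * cyclicWord l := by
      simp [cyclicWord]
    rw [block_cons, this, mul_assoc, ih]
    simp only [mul_assoc]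

theorem cyclicWord_cons (e : ℕ × ℕ) (l : List (ℕ × ℕ)) :
    (cyclicWord (e :: l) : Alg k) = y ^ e.1 * (z ^ e.2 * (block l * x)) := by
  rw [block_mul_x]
  simp [cyclicWord, mul_assoc]

theorem cyclicWord_append (l l' : List (ℕ × ℕ)) :
    (cyclicWord (l ++ l') : Alg k) = cyclicWord l * cyclicWord l' := by
  simp [cyclicWord]

theorem eps₀_rotate {l l' : List (ℕ × ℕ)} (h : l ~r l') :
    (eps₀ l : Homology k (Alg k) 0) = eps₀ l' := by
  obtain ⟨u, v, rfl, rfl⟩ := isRotated_iff_append.1 h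
  rw [eps₀, eps₀, cyclicWord_append, cyclicWord_append, ← zeroHom_apply, ← zeroHom_apply,
    zeroHom_mul_comm]

theorem cyclicWord_eq_word (n : ℕ) (m : ℕ+) (r : List (ℕ+ × ℕ+)) :
    (cyclicWord ((n, (m : ℕ)) :: toNat r) : Alg k) =
      word (n, 0 :: (List.replicate ((m : ℕ) - 1) 0 ++ pairGaps r), some 0) := by
  rw [cyclicWord_cons, word, gapProd_cons]
  have := gapProd_pairGaps (k := k) m r
  simp only [gapZ, this, tailEnd, pow_zero, mul_one, mul_assoc]

theorem toNat_cons (e : ℕ+ × ℕ+) (r : List (ℕ+ × ℕ+)) :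
    toNat (e :: r) = ((e.1 : ℕ), (e.2 : ℕ)) :: toNat r := rfl

theorem zeroTrace_class₀ (i : Label₀) :
    zeroTrace (class₀ i : Homology k (Alg k) 0) = Finsupp.single (key₀ i) 1 := by
  have hy : ∀ n, (y ^ n : Alg k) = word (n, [], none) := fun n => by simp [word, tailEnd]
  have hyx : ∀ n, (y ^ n * x : Alg k) = word (n, [], some 0) := fun n => by simp [word, tailEnd]
  cases i with
  | zeta =>
    rw [class₀, zeta₀, zeroTrace_zeroClass, ← pow_zero y, hy, traceMap_word]
    rfl
  | alpha =>
    have := hyx 0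
    rw [pow_zero, one_mul] at this
    rw [class₀, alpha₀, zeroTrace_zeroClass, this, traceMap_word]
    rfl
  | beta n =>
    rw [class₀, beta₀, zeroTrace_zeroClass, hyx, traceMap_word]
    rfl
  | gamma n =>
    rw [class₀, gamma₀, zeroTrace_zeroClass, hy, traceMap_word]
    rfl
  | delta n =>
    obtain ⟨d, hd⟩ := Nat.exists_eq_succ_of_ne_zero n.ne_zero
    have : (z ^ (n : ℕ) : Alg k) = word (0, List.replicate n 0, none) := by
      simp [word, tailEnd, gapProd_replicate]
    rw [class₀, delta₀, zeroTrace_zeroClass, this, traceMap_word, key₀, hd]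
    rfl
  | eps e r =>
    rw [class₀, eps₀, zeroTrace_zeroClass, toNat_cons, cyclicWord_eq_word, traceMap_word, traceVal,
      add_zero, if_neg e.1.ne_zero]
    rfl

theorem same_of_key₀ (i j : Label₀) (h : key₀ i = key₀ j) : Label₀.Same i j := by
  have h0 : ∀ (n : ℕ) (e : ℕ+ × ℕ+) (r : List (ℕ+ × ℕ+)),
      ((List.replicate n 0 : List ℕ) : Cycle ℕ) ≠ (pairGaps (e :: r) : List ℕ) := by
    intro n e r h
    have h1 := (Cycle.coe_eq_coe.1 h).mem_iff (a := (e.1 : ℕ))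
    simp [pairGaps] at h1
  cases i <;> cases j <;> simp only [key₀, Sum.inl.injEq, Sum.inr.injEq, Prod.mk.injEq,
    reduceCtorEq, false_and, true_and, PNat.coe_inj] at h
  case zeta.zeta => exact .refl _
  case alpha.alpha => exact .refl _
  case beta.beta => rw [h]; exact .refl _
  case gamma.gamma => rw [h]; exact .refl _
  case delta.delta n m =>
    have := (Cycle.coe_eq_coe.1 h).perm.length_eq
    rw [List.length_replicate, List.length_replicate, PNat.coe_inj] at this
    rw [this]; exact .refl _
  case eps.eps => exact .rot (isRotated_of_pairGaps (Cycle.coe_eq_coe.1 h))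
  case delta.eps => exact absurd h (h0 _ _ _)
  case eps.delta => exact absurd h.symm (h0 _ _ _)
  case zeta.gamma n => exact absurd h.symm n.ne_zero
  case gamma.zeta n => exact absurd h n.ne_zero
  case alpha.beta n => exact absurd h.symm n.ne_zero
  case beta.alpha n => exact absurd h n.ne_zero

theorem class₀_same (i j : Label₀) (h : Label₀.Same i j) :
    (class₀ i : Homology k (Alg k) 0) = class₀ j := by
  cases h with
  | refl => rfl
  | rot h => exact eps₀_rotate (h.map _)

/-- The span of the classes of the basis of `HH_0` other than the class of `1`. -/
noncomputable def positiveSpan (k : Type*) [Field k] : Submodule k (Homology k (Alg k) 0) :=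
  Submodule.span k (class₀ '' {i | i ≠ .zeta})

theorem class₀_mem_positiveSpan {i : Label₀} (hi : i ≠ .zeta) :
    class₀ i ∈ positiveSpan k :=
  Submodule.subset_span ⟨i, hi, rfl⟩

theorem zeroHom_y_pow_mul_word (a : ℕ) (c : ℕ) (l : List ℕ) :
    zeroHom (y ^ (a + 1) * gapProd (c :: l) : Alg k) = 0 := by
  rw [zeroHom_mul_comm, ← mul_one (y ^ (a + 1)), gapProd_mul_y_pow, map_zero]

/-- Every word other than `1` is a scalar multiple of an element of the basis in `HH_0`. -/
theorem zeroHom_word_mem (w : Word) (hw : w ≠ (0, [], none)) :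
    zeroHom (word w) ∈ positiveSpan k := by
  obtain ⟨a, L, e⟩ := w
  have heps : ∀ (n : ℕ) (hn : n ≠ 0) (l : List ℕ),
      zeroHom (y ^ n * (z * (gapProd l * x))) ∈ positiveSpan k := by
    intro n hn l
    obtain ⟨c, rfl⟩ := Nat.exists_eq_succ_of_ne_zero hn
    have := class₀_mem_positiveSpan (k := k)
      (i := .eps (c.succPNat, (gapDecode l).1) (gapDecode l).2) (by simp)
    rw [class₀, eps₀, ← zeroHom_apply, toNat_cons, cyclicWord_cons, ← mul_assoc (z ^ _),
      ← z_mul_gapProd] at this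
    simpa [mul_assoc] using this
  rcases L with _ | ⟨c, l⟩
  · rcases e with _ | b
    · obtain ⟨d, rfl⟩ := Nat.exists_eq_succ_of_ne_zero (show a ≠ 0 by rintro rfl; exact hw rfl)
      have := class₀_mem_positiveSpan (k := k) (i := .gamma d.succPNat) (by simp)
      rw [class₀, gamma₀, ← zeroHom_apply] at this
      simpa [word, tailEnd] using this
    · have h : zeroHom (word (a, [], some b) : Alg k) = zeroHom (y ^ (b + a) * x) := by
        simp only [word, gapProd_nil, tailEnd, one_mul]
        rw [← mul_assoc, zeroHom_mul_comm, ← mul_assoc, ← pow_add]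
      rw [h]
      rcases h' : b + a with _ | d
      · have := class₀_mem_positiveSpan (k := k) (i := .alpha) (by simp)
        rw [class₀, alpha₀, ← zeroHom_apply] at this
        simpa using this
      · have := class₀_mem_positiveSpan (k := k) (i := .beta d.succPNat) (by simp)
        rw [class₀, beta₀, ← zeroHom_apply] at this
        simpa using this
  · rcases e with _ | b
    · rcases a with _ | a
      · have h0 : (word (0, c :: l, none) : Alg k) = gapProd (c :: l) := by simp [word, tailEnd]
        rw [h0]
        -- Either all gaps are empty, or a rotation moves a nonempty gap to the front.
        by_cases hz : ∀ d ∈ c :: l, d = 0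
        · rw [List.eq_replicate_of_mem hz, gapProd_replicate]
          have := class₀_mem_positiveSpan (k := k) (i := .delta l.length.succPNat) (by simp)
          rw [class₀, delta₀, ← zeroHom_apply] at this
          simpa using this
        · push Not at hz
          obtain ⟨d, hd, hd0⟩ := hz
          obtain ⟨u, v, huv⟩ := List.append_of_mem hd
          obtain ⟨d, rfl⟩ := Nat.exists_eq_succ_of_ne_zero hd0
          rw [huv, gapProd_append, zeroHom_mul_comm, ← gapProd_append, List.cons_append,
            gapProd_cons, gapZ, mul_assoc, zeroHom_mul_comm]
          simpa [mul_assoc] using heps (d + 1) (Nat.succ_ne_zero d) (v ++ u)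
      · have h0 : (word (a + 1, c :: l, none) : Alg k) = y ^ (a + 1) * gapProd (c :: l) := by
          simp only [word, tailEnd, mul_one]
        rw [h0, zeroHom_y_pow_mul_word]
        exact Submodule.zero_mem _
    · rcases c with _ | c
      · have h0 : zeroHom (word (a, 0 :: l, some b) : Alg k) =
            zeroHom (y ^ (b + a) * (z * (gapProd l * x))) := by
          have e1 : (word (a, 0 :: l, some b) : Alg k) = y ^ a * (z * (gapProd l * x)) * y ^ b := by
            simp [word, gapZ, tailEnd, mul_assoc]
          rw [e1, zeroHom_mul_comm, ← mul_assoc, ← pow_add]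
        rw [h0]
        by_cases h : b + a = 0
        · rw [h, pow_zero, one_mul, ← mul_assoc, zeroHom_mul_comm, x_mul_z_assoc, map_zero]
          exact Submodule.zero_mem _
        · exact heps _ h l
      · have e1 : (word (a, (c + 1) :: l, some b) : Alg k) =
            (y ^ a * (x * (y ^ (c + 1) * (z * gapProd l)))) * (x * y ^ b) := by
          simp [word, gapZ, tailEnd, mul_assoc]
        have e2 : (x * y ^ b * (y ^ a * (x * (y ^ (c + 1) * (z * gapProd l)))) : Alg k) =
            -(y ^ (b + a + 1) * gapProd ((c + 1) :: l)) := by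
          rw [mul_assoc, ← mul_assoc (y ^ b), ← pow_add, x_mul_y_pow_mul_x_assoc]
          simp [gapZ, mul_assoc]
        rw [e1, zeroHom_mul_comm, e2, map_neg, zeroHom_y_pow_mul_word, neg_zero]
        exact Submodule.zero_mem _

theorem span_class₀ : Submodule.span k (Set.range (class₀ (k := k))) = ⊤ := by
  rw [eq_top_iff]
  rintro ξ -
  obtain ⟨a, rfl⟩ := zeroHom_surjective ξ
  rw [← linearCombination_toVec a, Finsupp.linearCombination_apply, Finsupp.sum, map_sum]
  refine Submodule.sum_mem _ fun w _ => ?_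
  rw [map_smul]
  refine Submodule.smul_mem _ _ ?_
  by_cases hw : w = (0, [], none)
  · subst hw
    have : zeroHom (word (0, [], none) : Alg k) = class₀ .zeta := by
      simp [word, tailEnd, class₀, zeta₀, zeroHom_apply]
    rw [this]
    exact Submodule.subset_span ⟨_, rfl⟩
  · exact Submodule.span_mono (Set.image_subset_range _ _) (zeroHom_word_mem w hw)

theorem isBasisUpTo_class₀ : IsBasisUpTo k Label₀.Same (class₀ (k := k)) :=
  IsBasisUpTo.of_key zeroTrace key₀ (fun _ => 1) (fun _ => one_ne_zero) zeroTrace_class₀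
    same_of_key₀ class₀_same span_class₀

end HomologyZero

/-! ### Hochschild homology in degree one -/

section HomologyOne

variable {k : Type*} [Field k]

theorem cap_derClass_oneClass (v : Fin 3 → Alg k) (hv : IsDer v) (w : Fin 3 → Alg k)
    (hw : ∑ i, (w i * gen i - gen i * w i) = 0) :
    cap k (n := 1) (m := 0) (p := 1) rfl (derClass v hv) (oneClass w hw) =
      zeroHom (∑ i, w i * v i) := by
  rw [map_sum]
  simp only [zeroHom_apply, derClass, oneClass]
  rw [cap, Subquotient.map₂_mk]
  simp only [zeroClass, ← map_sum]
  congr 1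
  ext1
  simp only [oneChain, map_sum, AddSubmonoidClass.coe_finsetSum]
  refine Finset.sum_congr rfl fun i _ => ?_
  rw [capChain_tprod]
  congr 1
  ext j
  fin_cases j
  simp [capTuple, derivation_gen]

/-- The chain `a ⊗ b`. -/
noncomputable def pair (a b : Alg k) : Chain k (Alg k) 1 := PiTensorProduct.tprod k ![a, b]

/-- The linear map on `1`-chains induced by a bilinear map. -/
noncomputable def pairLift {M : Type*} [AddCommGroup M] [Module k M]
    (f : Alg k →ₗ[k] Alg k →ₗ[k] M) : Chain k (Alg k) 1 →ₗ[k] M :=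
  PiTensorProduct.lift
    { toFun := fun v => f (v 0) (v 1)
      map_update_add' := by
        intro _ v i a b
        fin_cases i <;> simp
      map_update_smul' := by
        intro _ v i r a
        fin_cases i <;> simp }

theorem pairLift_pair {M : Type*} [AddCommGroup M] [Module k M]
    (f : Alg k →ₗ[k] Alg k →ₗ[k] M) (a b : Alg k) : pairLift f (pair a b) = f a b := by
  simp [pairLift, pair]

theorem pair_ext {M : Type*} [AddCommGroup M] [Module k M] {f g : Chain k (Alg k) 1 →ₗ[k] M}
    (h : ∀ a b, f (pair a b) = g (pair a b)) (c : Chain k (Alg k) 1) : f c = g c := by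
  have : f = g := by
    ext v
    have e : v = ![v 0, v 1] := by ext i; fin_cases i <;> rfl
    simp only [LinearMap.compMultilinearMap_apply]
    rw [e]
    exact h _ _
  rw [this]

theorem tprod_update {p : ℕ} (v : Fin p → Alg k) (i : Fin p) (f : Alg k → Fin p → Alg k)
    (hf : ∀ a, Function.update v i a = f a) :
    IsLinearMap k fun a => PiTensorProduct.tprod k (f a) where
  map_add a b := by simp only [← hf, MultilinearMap.map_update_add]
  map_smul r a := by simp only [← hf, MultilinearMap.map_update_smul]

theorem tprod_pair_left (b : Alg k) :
    IsLinearMap k fun a : Alg k => PiTensorProduct.tprod k ![a, b] :=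
  tprod_update ![0, b] 0 _ fun a => by ext i; fin_cases i <;> rfl

theorem tprod_pair_right (a : Alg k) :
    IsLinearMap k fun b : Alg k => PiTensorProduct.tprod k ![a, b] :=
  tprod_update ![a, 0] 1 _ fun b => by ext i; fin_cases i <;> rfl

theorem tprod_triple_middle (a c : Alg k) :
    IsLinearMap k fun b : Alg k => PiTensorProduct.tprod k ![a, b, c] :=
  tprod_update ![a, 0, c] 1 _ fun b => by ext i; fin_cases i <;> rfl

theorem tprod_triple_right (a b : Alg k) :
    IsLinearMap k fun c : Alg k => PiTensorProduct.tprod k ![a, b, c] :=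
  tprod_update ![a, b, 0] 2 _ fun c => by ext i; fin_cases i <;> rfl

/-- The bilinear map `(a, b) ↦ a ⊗ b`. -/
noncomputable def pairHom : Alg k →ₗ[k] Alg k →ₗ[k] Chain k (Alg k) 1 :=
  LinearMap.mk₂ k pair (fun a a' b => (tprod_pair_left b).map_add a a')
    (fun r a b => (tprod_pair_left b).map_smul r a) (fun a => (tprod_pair_right a).map_add)
    (fun r a b => (tprod_pair_right a).map_smul r b)

@[simp] theorem pairHom_apply (a b : Alg k) : pairHom a b = pair a b := rfl

/-- The bilinear map `(a, b) ↦ 1 ⊗ a ⊗ b`. -/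
noncomputable def oneTriple : Alg k →ₗ[k] Alg k →ₗ[k] Chain k (Alg k) 2 :=
  LinearMap.mk₂ k (fun a b => PiTensorProduct.tprod k ![1, a, b])
    (fun a a' b => (tprod_triple_middle 1 b).map_add a a')
    (fun r a b => (tprod_triple_middle 1 b).map_smul r a)
    (fun a => (tprod_triple_right 1 a).map_add)
    (fun r a b => (tprod_triple_right 1 a).map_smul r b)

theorem boundary_one_tprod (a b c : Alg k) :
    boundary k (Alg k) 1 (PiTensorProduct.tprod k ![a, b, c]) =
      pair (a * b) c - pair a (b * c) + pair (c * a) b := by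
  have h0 : mulFace 0 ![a, b, c] = ![a * b, c] := by
    ext i; fin_cases i <;> simp [mulFace]
  have h1 : mulFace 1 ![a, b, c] = ![a, b * c] := by
    ext i; fin_cases i <;> simp [mulFace]
  have h2 : lastFace ![a, b, c] = ![c * a, b] := by
    ext i; fin_cases i
    · simp only [lastFace]; rfl
    · simp [lastFace]
  rw [boundary_tprod, Fin.sum_univ_two, h0, h1, h2]
  simp [pair, sub_eq_add_neg]

theorem boundary_oneTriple (a b : Alg k) :
    boundary k (Alg k) 1 (oneTriple a b) = pair a b - pair 1 (a * b) + pair b a := by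
  change boundary k (Alg k) 1 (PiTensorProduct.tprod k ![1, a, b]) = _
  rw [boundary_one_tprod, one_mul, mul_one]

theorem isDer_gen : IsDer (gen : Fin 3 → Alg k) where
  xx := by rw [add_mul, x_mul_x]; abel
  xz := by rw [x_mul_z, add_zero]
  zy := by rw [z_mul_y, add_zero]

/-- The Euler derivation, which multiplies a word by its length. -/
noncomputable def euler : Alg k →ₗ[k] Alg k := derivation gen isDer_gen

theorem euler_mul (a b : Alg k) : euler (a * b) = a * euler b + euler a * b :=
  derivation_mul _ _ a b

theorem euler_gen (i : Fin 3) : euler (gen i : Alg k) = gen i := derivation_gen _ _ i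

theorem euler_one : euler (1 : Alg k) = 0 := by
  have := euler_mul (1 : Alg k) 1
  rwa [mul_one, one_mul, mul_one, left_eq_add] at this

/-- The cochain of the Euler derivation. -/
noncomputable def eulerCochain : Cochain k (Alg k) 1 :=
  MultilinearMap.ofSubsingleton k (Alg k) (Alg k) 0 euler

theorem eulerCochain_mem : eulerCochain ∈ cocycles k (Alg k) 1 := by
  change coboundary k (Alg k) 1 _ = 0
  ext a
  simp [eulerCochain, coboundary_apply, mulFace, euler_mul]

/-- The action of the Euler derivation on `1`-chains. -/
noncomputable def eulerChain : Chain k (Alg k) 1 →ₗ[k] Chain k (Alg k) 1 :=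
  pairLift (pairHom ∘ₗ euler + pairHom.compl₂ euler)

theorem eulerChain_pair (a b : Alg k) :
    eulerChain (pair a b) = pair (euler a) b + pair a (euler b) := by
  simp [eulerChain, pairLift_pair]

theorem eulerChain_mem_boundaries {c : Chain k (Alg k) 1} (hc : c ∈ boundaries k (Alg k) 1) :
    eulerChain c ∈ boundaries k (Alg k) 1 := by
  obtain ⟨d, rfl⟩ := hc
  have h : ∀ d, (Submodule.mkQ (boundaries k (Alg k) 1) ∘ₗ eulerChain ∘ₗ boundary k (Alg k) 1) d
      = 0 := by
    intro d
    have : Submodule.mkQ (boundaries k (Alg k) 1) ∘ₗ eulerChain ∘ₗ boundary k (Alg k) 1 = 0 := by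
      ext v
      have e : v = ![v 0, v 1, v 2] := by ext i; fin_cases i <;> rfl
      simp only [LinearMap.compMultilinearMap_apply]
      rw [e]
      generalize v 0 = a
      generalize v 1 = b
      generalize v 2 = c
      simp only [LinearMap.comp_apply, LinearMap.zero_apply, Submodule.mkQ_apply,
        Submodule.Quotient.mk_eq_zero]
      refine ⟨PiTensorProduct.tprod k ![euler a, b, c] + PiTensorProduct.tprod k ![a, euler b, c]
        + PiTensorProduct.tprod k ![a, b, euler c], ?_⟩
      simp only [map_add, map_sub, boundary_one_tprod, eulerChain_pair, euler_mul]
      simp only [← pairHom_apply, map_add, LinearMap.add_apply]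
      abel
    rw [this, LinearMap.zero_apply]
  exact (Submodule.Quotient.mk_eq_zero _).1 (h d)

/-- An operator is injective if eigenvectors with nonzero eigenvalues span the space. -/
theorem eq_zero_of_eigenvectors {M : Type*} [AddCommGroup M] [Module k M] (f : Module.End k M)
    (s : Set M) (hs : Submodule.span k s = ⊤) (h : ∀ v ∈ s, ∃ μ : k, μ ≠ 0 ∧ f v = μ • v) (v : M)
    (hv : f v = 0) : v = 0 := by
  have h1 : (⨆ μ, ⨆ (_ : μ ≠ 0), f.eigenspace μ) = ⊤ := by
    rw [eq_top_iff, ← hs, Submodule.span_le]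
    intro w hw
    obtain ⟨μ, hμ, hfw⟩ := h w hw
    exact Submodule.mem_iSup_of_mem μ (Submodule.mem_iSup_of_mem hμ
      (Module.End.mem_eigenspace_iff.2 hfw))
  have h2 := f.eigenspaces_iSupIndep 0
  rw [h1, disjoint_top] at h2
  have h3 : v ∈ f.eigenspace 0 := Module.End.mem_eigenspace_iff.2 (by rw [hv, zero_smul])
  rwa [h2, Submodule.mem_bot] at h3

theorem span_homogeneous : Submodule.span k
    {a : Alg k | ∃ n : ℕ, euler a = (n : k) • a ∧ (n = 0 → a = 1)} = ⊤ := by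
  rw [eq_top_iff]
  rintro a -
  refine alg_induction_left (Submodule.span k
    {a : Alg k | ∃ n : ℕ, euler a = (n : k) • a ∧ (n = 0 → a = 1)})
    (Submodule.subset_span ⟨0, by simp [euler_one], fun _ => rfl⟩) ?_ a
  intro i a ha
  induction ha using Submodule.span_induction with
  | zero => rw [mul_zero]; exact Submodule.zero_mem _
  | add a b _ _ ha hb => rw [mul_add]; exact Submodule.add_mem _ ha hb
  | smul r a _ ha => rw [mul_smul_comm]; exact Submodule.smul_mem _ _ ha
  | mem a ha =>
    obtain ⟨n, hn, -⟩ := ha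
    refine Submodule.subset_span ⟨n + 1, ?_, fun h => absurd h (Nat.succ_ne_zero n)⟩
    rw [euler_mul, euler_gen, hn, mul_smul_comm, Nat.cast_succ, add_smul, one_smul]

variable [CharZero k]

theorem mem_boundaries_of_eulerChain {c : Chain k (Alg k) 1}
    (hc : eulerChain c ∈ boundaries k (Alg k) 1) : c ∈ boundaries k (Alg k) 1 := by
  let B := boundaries k (Alg k) 1
  let f : Module.End k (Chain k (Alg k) 1 ⧸ B) :=
    B.mapQ B eulerChain fun c hc => eulerChain_mem_boundaries hc
  let H : Set (Alg k) := {a | ∃ n : ℕ, euler a = (n : k) • a ∧ (n = 0 → a = 1)}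
  rw [← Submodule.Quotient.mk_eq_zero]
  refine eq_zero_of_eigenvectors f (B.mkQ '' Set.image2 pair H H) ?_ ?_ _
    ((Submodule.Quotient.mk_eq_zero _).2 hc)
  · have h1 : Submodule.span k (Set.image2 pair H H) = (⊤ : Submodule k (Chain k (Alg k) 1)) := by
      have h2 : Submodule.map₂ pairHom (Submodule.span k H) (Submodule.span k H) =
          Submodule.span k (Set.image2 pair H H) := Submodule.map₂_span_span k pairHom H H
      rw [← h2, span_homogeneous, eq_top_iff, ← PiTensorProduct.span_tprod_eq_top,
        Submodule.span_le]
      rintro _ ⟨v, rfl⟩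
      have e : v = ![v 0, v 1] := by ext i; fin_cases i <;> rfl
      rw [e]
      exact Submodule.apply_mem_map₂ pairHom (Submodule.mem_top (x := v 0))
        (Submodule.mem_top (x := v 1))
    rw [← Submodule.map_span, h1, Submodule.map_top, Submodule.range_mkQ]
  · rintro _ ⟨_, ⟨a, ⟨n, hn, hn0⟩, b, ⟨m, hm, hm0⟩, rfl⟩, rfl⟩
    have hf : f (B.mkQ (pair a b)) = ((n + m : ℕ) : k) • B.mkQ (pair a b) := by
      have : eulerChain (pair a b) = ((n + m : ℕ) : k) • pair a b := by
        rw [eulerChain_pair, hn, hm, ← pairHom_apply, ← pairHom_apply, ← pairHom_apply, map_smul,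
          map_smul, LinearMap.smul_apply, ← add_smul, Nat.cast_add]
      change B.mkQ (eulerChain (pair a b)) = _
      rw [this, map_smul]
    by_cases h0 : n + m = 0
    · -- The only eigenvector with eigenvalue zero is `1 ⊗ 1`, a boundary.
      refine ⟨1, one_ne_zero, ?_⟩
      have : B.mkQ (pair a b) = 0 := by
        rw [hn0 (by omega), hm0 (by omega), Submodule.mkQ_apply, Submodule.Quotient.mk_eq_zero]
        refine ⟨oneTriple 1 1, ?_⟩
        rw [boundary_oneTriple, mul_one]
        abel
      rw [this, map_zero, smul_zero]
    · exact ⟨_, Nat.cast_ne_zero.2 h0, hf⟩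

end HomologyOne

/-! ### The cap product with the Euler class -/

section EulerInjective

universe u

variable {k : Type u} [Field k]

/-- The cap product with the Euler class. -/
noncomputable def capEuler : Homology k (Alg k) 1 →ₗ[k] Homology k (Alg k) 0 :=
  cap k (n := 1) (m := 0) (p := 1) rfl (derClass gen isDer_gen)

theorem capEuler_mk (c : cycles k (Alg k) 1) : capEuler (Subquotient.mk _ _ c) =
    zeroHom (pairLift ((LinearMap.mul k (Alg k)).compl₂ euler) c) := by
  have h : ∀ c, capChain k (n := 1) (m := 0) (p := 1) rfl eulerCochain c =
      (PiTensorProduct.subsingletonEquiv (R := k) (s := fun _ => Alg k) (0 : Fin 1)).symm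
        (pairLift ((LinearMap.mul k (Alg k)).compl₂ euler) c) := by
    refine pair_ext (g := (PiTensorProduct.subsingletonEquiv (R := k) (s := fun _ => Alg k)
      (0 : Fin 1)).symm.toLinearMap ∘ₗ pairLift ((LinearMap.mul k (Alg k)).compl₂ euler)) ?_
    intro a b
    simp only [LinearMap.comp_apply, pairLift_pair, LinearEquiv.coe_coe,
      PiTensorProduct.subsingletonEquiv_symm_apply']
    rw [pair, capChain_tprod]
    congr 1
    ext j
    fin_cases j
    simp [capTuple, eulerCochain]
  rw [capEuler, derClass, cap, Subquotient.map₂_mk, zeroHom, LinearMap.comp_apply]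
  congr 1
  ext1
  exact h c

theorem zeroHom_gen_mul_mem (i : Fin 3) (a : Alg k) : zeroHom (gen i * a) ∈ positiveSpan k := by
  rw [← linearCombination_toVec (gen i * a), Finsupp.linearCombination_apply, Finsupp.sum, map_sum]
  refine Submodule.sum_mem _ fun w hw => ?_
  rw [map_smul]
  refine Submodule.smul_mem _ _ (zeroHom_word_mem w ?_)
  rintro rfl
  rw [Finsupp.mem_support_iff] at hw
  apply hw
  change coef (0, [], none) (gen i * a) = 0
  fin_cases i
  · exact coef_x_mul_nil_none _ _
  · exact coef_zero_y_mul _ _ _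
  · exact coef_nil_z_mul _ _ _

theorem capEuler_mem (ξ : Homology k (Alg k) 1) : capEuler ξ ∈ positiveSpan k := by
  obtain ⟨c, rfl⟩ := Subquotient.mk_surjective _ _ ξ
  rw [capEuler_mk]
  have h1 : ∀ b : Alg k, ∀ a, zeroHom (a * euler b) ∈ positiveSpan k := by
    refine alg_induction_left
      { carrier := {b | ∀ a, zeroHom (a * euler b) ∈ positiveSpan k}
        add_mem' := fun {b b'} h h' a => by
          rw [map_add, mul_add, map_add]; exact Submodule.add_mem _ (h a) (h' a)
        zero_mem' := fun a => by simp
        smul_mem' := fun r b h a => by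
          rw [map_smul, mul_smul_comm, map_smul]; exact Submodule.smul_mem _ _ (h a) } ?_ ?_
    · intro a
      rw [euler_one, mul_zero, map_zero]
      exact Submodule.zero_mem _
    · intro i b hb a
      rw [euler_mul, euler_gen, mul_add, map_add]
      refine Submodule.add_mem _ ?_ ?_
      · rw [← mul_assoc]; exact hb _
      · rw [zeroHom_mul_comm, mul_assoc]; exact zeroHom_gen_mul_mem i _
  rw [← Submodule.Quotient.mk_eq_zero]
  exact pair_ext (f := (positiveSpan k).mkQ ∘ₗ zeroHom ∘ₗ
    pairLift ((LinearMap.mul k (Alg k)).compl₂ euler)) (g := 0) (fun a b => by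
      simpa [pairLift_pair] using h1 b a) c.1

/-- The cap product with the Euler class is injective on `HH_1`: the Euler derivation acts on `HH_1`
as the composition of this cap product with the Connes operator `a ↦ 1 ⊗ a`, since `HH_2`
vanishes, and its action on `HH_1` is injective. -/
theorem capEuler_injective [CharZero k] : Function.Injective (capEuler (k := k)) := by
  rw [← LinearMap.ker_eq_bot, LinearMap.ker_eq_bot']
  intro ξ hξ
  obtain ⟨⟨c, hc⟩, rfl⟩ := Subquotient.mk_surjective _ _ ξ
  rw [capEuler_mk] at hξ
  rw [Subquotient.mk_eq_zero]
  refine mem_boundaries_of_eulerChain ?_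
  let P : Chain k (Alg k) 1 →ₗ[k] Alg k := pairLift ((LinearMap.mul k (Alg k)).compl₂ euler)
  let S : Chain k (Alg k) 1 →ₗ[k] Chain k (Alg k) 2 := pairLift (oneTriple - oneTriple.flip)
  let e := PiTensorProduct.subsingletonEquiv (R := k) (s := fun _ => Alg k) (0 : Fin 1)
  have hS : ∀ c, boundary k (Alg k) 1 (S c) = -pairHom 1 (e (boundary k (Alg k) 0 c)) := by
    refine pair_ext (f := boundary k (Alg k) 1 ∘ₗ S)
      (g := -(pairHom 1 ∘ₗ e.toLinearMap ∘ₗ boundary k (Alg k) 0)) fun a b => ?_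
    simp only [LinearMap.comp_apply, LinearMap.neg_apply, LinearEquiv.coe_coe]
    rw [pairLift_pair, LinearMap.sub_apply, LinearMap.sub_apply, LinearMap.flip_apply, map_sub,
      boundary_oneTriple, boundary_oneTriple, pair.eq_def a b, boundary_zero_tprod]
    rw [LinearEquiv.apply_symm_apply, map_sub, pairHom_apply, pairHom_apply]
    simp only [Matrix.cons_val_zero, Matrix.cons_val_one, pair]
    abel
  have hcap : ∀ c, eulerChain c - pairHom 1 (P c)
      - capChain k (n := 1) (m := 1) (p := 2) rfl eulerCochain (S c) =
      boundary k (Alg k) 1 (pairLift (oneTriple.compl₂ euler) c) := by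
    refine pair_ext (f := eulerChain - pairHom 1 ∘ₗ P
      - capChain k (n := 1) (m := 1) (p := 2) rfl eulerCochain ∘ₗ S)
      (g := boundary k (Alg k) 1 ∘ₗ pairLift (oneTriple.compl₂ euler)) fun a b => ?_
    have h1 : ∀ a b : Alg k, capChain k (n := 1) (m := 1) (p := 2) rfl eulerCochain
        (oneTriple a b) = pair (euler a) b := by
      intro a b
      change capChain k (n := 1) (m := 1) (p := 2) rfl eulerCochain
        (PiTensorProduct.tprod k ![1, a, b]) = _
      rw [capChain_tprod, pair]
      congr 1
      ext j
      fin_cases j <;> simp [capTuple, eulerCochain]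
    simp only [LinearMap.comp_apply, LinearMap.sub_apply, P, S, pairLift_pair, eulerChain_pair,
      LinearMap.compl₂_apply, LinearMap.flip_apply, map_sub, h1, boundary_oneTriple,
      LinearMap.mul_apply', pairHom_apply]
    abel
  rw [eq_add_of_sub_eq (eq_add_of_sub_eq' (hcap c))]
  have hc' : boundary k (Alg k) 0 c = 0 := hc
  refine Submodule.add_mem _ (Submodule.add_mem _ ?_ ⟨_, rfl⟩) ?_
  · refine capChain_mem_boundaries k _ eulerCochain_mem (cycles_le_boundaries 0 ?_)
    change boundary k (Alg k) 1 (S c) = 0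
    rw [hS, hc', map_zero, map_zero, neg_zero]
  · obtain ⟨d, hd⟩ := (Subquotient.mk_eq_zero _ _ _).1 hξ
    have hd' : e (boundary k (Alg k) 0 d) = P c := by
      rw [hd]
      exact LinearEquiv.apply_symm_apply _ _
    rw [← hd', ← neg_neg (pairHom 1 _), ← hS]
    exact Submodule.neg_mem _ ⟨_, rfl⟩

end EulerInjective

/-! ### Sums over the letters of a cyclic word -/

section ThetaSums

variable {k : Type*} [Field k]

/-- The cap product with `θ₁` is a sum over the letters of the cyclic word: each letter is replaced
in turn by its image. Here this is stated for the letters of the initial part `y^n z^m x`. -/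
theorem zeroHom_thetaSummand (n m : ℕ) (r : List (ℕ × ℕ)) (X : Fin 3 → Alg k) :
    zeroHom (∑ i, thetaSummand ((n, m) :: r) i * X i) =
      zeroHom (y ^ n * (z ^ m * (block r * X 0)))
      + ∑ t ∈ Finset.Icc 1 n,
          zeroHom (y ^ (t - 1) * (X 1 * (y ^ (n - t) * (z ^ m * (block r * x)))))
      + ∑ s ∈ Finset.Icc 1 m,
          zeroHom (y ^ n * (z ^ (s - 1) * (X 2 * (z ^ (m - s) * (block r * x))))) := by
  simp only [thetaSummand, Fin.sum_univ_three, Matrix.cons_val_zero, Matrix.cons_val_one,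
    Matrix.cons_val, map_add, Finset.sum_mul, map_sum]
  congr 1
  · congr 1
    · simp only [mul_assoc]
    · refine Finset.sum_congr rfl fun t _ => ?_
      rw [mul_assoc, zeroHom_mul_comm]
      simp only [mul_assoc]
  · refine Finset.sum_congr rfl fun s _ => ?_
    rw [mul_assoc, mul_assoc, zeroHom_mul_comm]
    simp only [mul_assoc]

theorem zeroHom_thetaValue (l : List (ℕ × ℕ)) (X : Fin 3 → Alg k)
    (f : List (ℕ × ℕ) → ℕ → ℕ → List (ℕ × ℕ) → Homology k (Alg k) 0)
    (h : ∀ u n m v, l = u ++ (n, m) :: v →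
      zeroHom (∑ i, thetaSummand ((n, m) :: (v ++ u)) i * X i) = f u n m v) :
    zeroHom (∑ i, thetaValue l i * X i) = sumSplit l f := by
  have h1 : ∑ i, thetaValue l i * X i =
      ∑ j ∈ Finset.range l.length, ∑ i, thetaSummand (l.rotate j) i * X i := by
    rw [Finset.sum_comm]
    simp only [thetaValue, Finset.sum_apply, Finset.sum_mul]
  rw [h1, map_sum, sumSplit, Finset.sum_range]
  refine Finset.sum_congr rfl fun j _ => ?_
  have h2 : l.drop j = (l[j].1, l[j].2) :: l.drop (j + 1) := List.drop_eq_getElem_cons j.2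
  rw [List.rotate_eq_drop_append_take j.2.le, h2, List.cons_append]
  exact h _ _ _ _ (by rw [← h2, List.take_append_drop])

theorem zeroHom_cyclicWord (n m : ℕ) (r : List (ℕ × ℕ)) :
    zeroHom (y ^ n * (z ^ m * (block r * x)) : Alg k) = eps₀ ((n, m) :: r) := by
  rw [eps₀, cyclicWord_cons, zeroHom_apply]

theorem sumSplit_nsmul (l : List (ℕ × ℕ)) (g : ℕ → ℕ → ℕ) (ξ : Homology k (Alg k) 0) :
    sumSplit l (fun _ n m _ => g n m • ξ) = (l.map fun e => g e.1 e.2).sum • ξ := by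
  rw [sumSplit, ← Finset.sum_smul]
  congr 1
  exact Fin.sum_univ_fun_getElem l fun e => g e.1 e.2

end ThetaSums

/-! ### The basis of `HH_1` -/

section BasisOne

universe u

variable {k : Type u} [Field k]

/-- The label of the class in `HH_0` proportional to the cap product of the Euler class with a given
class in `HH_1`. -/
def eulerLabel : Label₁ → Label₀
  | .alpha => .alpha
  | .beta => .beta 1
  | .gamma n => .beta (n + 1)
  | .delta => .gamma 1
  | .eps n => .gamma (n + 1)
  | .zeta => .delta 1
  | .eta n => .delta (n + 1)
  | .theta e r => .eps e r

/-- The factor of proportionality in `capEuler_class₁`; for `θ₁` it is the length of the cyclic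
word. -/
def eulerFactor (k : Type*) [Field k] : Label₁ → k
  | .beta | .gamma _ => -1
  | .theta e r => (((toNat (e :: r)).map fun e => 1 + e.1 + e.2).sum : ℕ)
  | _ => 1

theorem eulerFactor_ne_zero [CharZero k] (χ : Label₁) : eulerFactor k χ ≠ 0 := by
  cases χ with
  | theta e r =>
    rw [eulerFactor, toNat_cons, List.map_cons, List.sum_cons, Nat.cast_ne_zero]
    omega
  | _ => simp [eulerFactor]

theorem capEuler_oneClass (w : Fin 3 → Alg k) (hw : ∑ i, (w i * gen i - gen i * w i) = 0) :
    capEuler (oneClass w hw) = zeroHom (∑ i, w i * gen i) :=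
  cap_derClass_oneClass _ _ _ _

theorem zeroHom_thetaSummand_gen (n m : ℕ) (r : List (ℕ × ℕ)) :
    zeroHom (∑ i, thetaSummand ((n, m) :: r) i * (gen i : Alg k)) =
      (1 + n + m) • eps₀ ((n, m) :: r) := by
  rw [zeroHom_thetaSummand]
  have h1 : ∀ t ∈ Finset.Icc 1 n, zeroHom (y ^ (t - 1) * (y * (y ^ (n - t) *
      (z ^ m * (block r * x)))) : Alg k) = eps₀ ((n, m) :: r) := by
    intro t ht
    rw [Finset.mem_Icc] at ht
    rw [← zeroHom_cyclicWord, ← mul_assoc, ← mul_assoc, ← pow_succ, ← pow_add]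
    congr 3
    omega
  have h2 : ∀ s ∈ Finset.Icc 1 m, zeroHom (y ^ n * (z ^ (s - 1) * (z * (z ^ (m - s) *
      (block r * x)))) : Alg k) = eps₀ ((n, m) :: r) := by
    intro s hs
    rw [Finset.mem_Icc] at hs
    rw [← zeroHom_cyclicWord, ← mul_assoc (z ^ _), ← mul_assoc (z ^ _ * z), ← pow_succ, ← pow_add]
    congr 4
    omega
  rw [Finset.sum_congr rfl h1, Finset.sum_congr rfl h2, zeroHom_cyclicWord]
  simp [add_smul]

theorem capEuler_class₁ (χ : Label₁) :
    capEuler (class₁ χ : Homology k (Alg k) 1) = eulerFactor k χ • class₀ (eulerLabel χ) := by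
  rw [class₁, capEuler_oneClass]
  cases χ with
  | theta e r =>
    rw [value₁, zeroHom_thetaValue _ _
      (fun _ n m _ => (1 + n + m) • eps₀ (toNat (e :: r))), sumSplit_nsmul]
    · simp only [eulerFactor, eulerLabel, class₀, Nat.cast_smul_eq_nsmul]
    · intro u n m v h
      rw [zeroHom_thetaSummand_gen, h, ← List.cons_append,
        eps₀_rotate (List.isRotated_append (l := u) (l' := (n, m) :: v))]
  | beta =>
    simp [value₁, Fin.sum_univ_three, eulerFactor, eulerLabel, class₀, beta₀, x_mul_x,
      ← zeroHom_apply]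
  | gamma n =>
    have : (y ^ (n : ℕ) * x * x : Alg k) = -(y ^ ((n : ℕ) + 1) * x) := by
      rw [mul_assoc, x_mul_x, pow_succ, mul_neg, mul_assoc]
    simp [value₁, Fin.sum_univ_three, eulerFactor, eulerLabel, class₀, beta₀, this, ← zeroHom_apply]
  | _ =>
    simp [value₁, Fin.sum_univ_three, eulerFactor, eulerLabel, class₀, alpha₀, gamma₀, delta₀,
      zeroHom_apply, pow_succ]

theorem same_of_eulerLabel {χ χ' : Label₁} (h : Label₀.Same (eulerLabel χ) (eulerLabel χ')) :
    Label₁.Same χ χ' := by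
  have h1 : ∀ i j, Label₀.Same i j → i = j ∨ ∃ e e' r r', i = .eps e r ∧ j = .eps e' r' ∧
      (e :: r) ~r (e' :: r') := by
    rintro i j (_ | h)
    · exact Or.inl rfl
    · exact Or.inr ⟨_, _, _, _, rfl, rfl, h⟩
  have h2 : ∀ n : ℕ+, n + 1 ≠ 1 := fun n h => by
    have := congrArg PNat.val h
    simp at this
  rcases h1 _ _ h with h | ⟨e, e', r, r', h, h', hr⟩
  · cases χ <;> cases χ' <;> simp only [eulerLabel, reduceCtorEq, Label₀.beta.injEq,
      Label₀.gamma.injEq, Label₀.delta.injEq, Label₀.eps.injEq, h2, (h2 _).symm, add_left_inj] at h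
    all_goals first
      | exact .refl _
      | (subst h; exact .refl _)
      | (obtain ⟨rfl, rfl⟩ := h; exact .refl _)
  · cases χ <;> cases h
    cases χ' <;> cases h'
    exact .rot hr

theorem exists_eulerLabel {i : Label₀} (hi : i ≠ .zeta) : ∃ χ, eulerLabel χ = i := by
  have h : ∀ n : ℕ+, n = 1 ∨ ∃ m, n = m + 1 := fun n => by
    by_cases hn : n = 1
    · exact Or.inl hn
    · obtain ⟨m, rfl⟩ := PNat.exists_eq_succ_of_ne_one hn
      exact Or.inr ⟨m, rfl⟩
  cases i with
  | zeta => exact absurd rfl hi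
  | alpha => exact ⟨.alpha, rfl⟩
  | beta n =>
    obtain rfl | ⟨m, rfl⟩ := h n
    exacts [⟨.beta, rfl⟩, ⟨.gamma m, rfl⟩]
  | gamma n =>
    obtain rfl | ⟨m, rfl⟩ := h n
    exacts [⟨.delta, rfl⟩, ⟨.eps m, rfl⟩]
  | delta n =>
    obtain rfl | ⟨m, rfl⟩ := h n
    exacts [⟨.zeta, rfl⟩, ⟨.eta m, rfl⟩]
  | eps e r => exact ⟨.theta e r, rfl⟩

theorem isBasisUpTo_class₁ [CharZero k] : IsBasisUpTo k Label₁.Same (class₁ (k := k)) := by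
  refine IsBasisUpTo.of_key (zeroTrace ∘ₗ capEuler) (key₀ ∘ eulerLabel) (eulerFactor k)
    eulerFactor_ne_zero (fun χ => ?_) (fun χ χ' h => same_of_eulerLabel (same_of_key₀ _ _ h))
    (fun χ χ' h => capEuler_injective ?_) ?_
  · rw [LinearMap.comp_apply, capEuler_class₁, map_smul, zeroTrace_class₀, Finsupp.smul_single,
      smul_eq_mul, mul_one, Function.comp_apply]
  · cases h with
    | refl => rfl
    | rot h =>
      rw [capEuler_class₁, capEuler_class₁]
      congr 1
      · simp only [eulerFactor, toNat]
        rw [((h.perm.map _).map _).sum_eq]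
      · exact class₀_same _ _ (.rot h)
  · rw [eq_top_iff]
    rintro ξ -
    have h : positiveSpan k ≤ (Submodule.span k (Set.range (class₁ (k := k)))).map capEuler := by
      rw [positiveSpan, Submodule.span_le]
      rintro _ ⟨i, hi, rfl⟩
      obtain ⟨χ, rfl⟩ := exists_eulerLabel hi
      refine ⟨(eulerFactor k χ)⁻¹ • class₁ χ,
        Submodule.smul_mem _ _ (Submodule.subset_span ⟨χ, rfl⟩), ?_⟩
      rw [map_smul, capEuler_class₁, inv_smul_smul₀ (eulerFactor_ne_zero χ)]
    obtain ⟨η, hη, hξ⟩ := h (capEuler_mem ξ)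
    rwa [← capEuler_injective hξ]

end BasisOne

/-! ### The table of cap products in degree one -/

section CapTable

variable {k : Type*} [Field k]

theorem z_pow_mul_x_mul_cyclicWord (m : ℕ) (hm : m ≠ 0) (l : List (ℕ × ℕ)) (hl : ∃ e ∈ l, e.2 = 0) :
    (z ^ m * (x * cyclicWord l) : Alg k) = 0 := by
  induction l generalizing m with
  | nil => simp at hl
  | cons e l ih =>
    have h1 : (cyclicWord (e :: l) : Alg k) = y ^ e.1 * (z ^ e.2 * (x * cyclicWord l)) := by
      simp [cyclicWord, mul_assoc]
    rw [h1]
    by_cases h : e.2 = 0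
    · have h2 : (z ^ m * (x * (y ^ e.1 * (x * cyclicWord l))) : Alg k) =
          z ^ m * (x * y ^ e.1 * x) * cyclicWord l := by simp only [mul_assoc]
      have h3 : (z ^ m * y : Alg k) = 0 := z_pow_mul_y m hm
      rw [h, pow_zero, one_mul, h2, x_mul_y_pow_mul_x, pow_succ', mul_neg, ← mul_assoc,
        ← mul_assoc, h3]
      simp
    · rw [ih _ h (by simpa [h] using hl)]
      simp

theorem eps₀_eq_zero (l : List (ℕ × ℕ)) (h1 : ∃ e ∈ l, 0 < e.2) (h2 : ∃ e ∈ l, e.1 = 0 ∨ e.2 = 0) :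
    (eps₀ l : Homology k (Alg k) 0) = 0 := by
  by_cases h : ∃ e ∈ l, e.2 = 0
  · obtain ⟨e, he, he0⟩ := h1
    obtain ⟨u, v, rfl⟩ := List.append_of_mem he
    rw [eps₀_rotate (List.isRotated_append (l := u) (l' := e :: v)), List.cons_append]
    obtain ⟨e', he', h0⟩ := h
    have h3 : ∃ e ∈ v ++ u, e.2 = 0 := by
      refine ⟨e', ?_, h0⟩
      have : e' ≠ e := by rintro rfl; omega
      simpa [this, or_comm] using he'
    rw [eps₀, cyclicWord_cons, block_mul_x, z_pow_mul_x_mul_cyclicWord _ he0.ne' _ h3, mul_zero,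
      ← zeroHom_apply, map_zero]
  · obtain ⟨e, he, h0⟩ := h2
    have hz : e.2 ≠ 0 := fun h' => h ⟨e, he, h'⟩
    obtain ⟨u, v, rfl⟩ := List.append_of_mem he
    have h3 : (x * z ^ e.2 : Alg k) = 0 := x_mul_z_pow _ hz
    rw [eps₀_rotate (List.isRotated_append (l := u) (l' := e :: v)), List.cons_append, eps₀,
      cyclicWord_cons, h0.resolve_right hz, pow_zero, one_mul, ← mul_assoc, ← zeroHom_apply,
      zeroHom_mul_comm, ← mul_assoc, h3, zero_mul, map_zero]

theorem zeroHom_block (e : ℕ × ℕ) (l : List (ℕ × ℕ)) :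
    zeroHom (block (e :: l) : Alg k) = eps₀ (e :: l) := by
  rw [eps₀, cyclicWord_cons, block_cons, ← zeroHom_apply, mul_assoc, mul_assoc, zeroHom_mul_comm]
  simp only [mul_assoc]

theorem addLast_cons (e : ℕ × ℕ) (l : List (ℕ × ℕ)) (d : ℕ) :
    ∃ e' l', addLast (e :: l) d = e' :: l' := by
  cases l <;> exact ⟨_, _, rfl⟩

theorem block_addLast (e : ℕ × ℕ) (l : List (ℕ × ℕ)) (d : ℕ) :
    (block (addLast (e :: l) d) : Alg k) = block (e :: l) * z ^ d := by
  induction l generalizing e with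
  | nil => simp [addLast, block, pow_add, mul_assoc]
  | cons e' l ih => rw [addLast, block_cons, ih, block_cons e]; simp only [mul_assoc]

theorem eps₀_addLast (e : ℕ × ℕ) (l : List (ℕ × ℕ)) (d : ℕ) :
    (eps₀ (addLast (e :: l) d) : Homology k (Alg k) 0) = zeroHom (block (e :: l) * z ^ d) := by
  rw [← block_addLast]
  obtain ⟨e', l', h⟩ := addLast_cons e l d
  rw [h, zeroHom_block]

/-- The class of `y^N D(y)` for the derivation `D` with a given label. -/
noncomputable def capPowY : CoLabel → ℕ → Homology k (Alg k) 0
  | .A, N => gamma₀ (N + 1)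
  | .B n, N => -beta₀ (N + n)
  | .E n, N => beta₀ (N + n) + gamma₀ (N + n + 1)
  | .G e r, N => eps₀ ((N + e.1, (e.2 : ℕ)) :: toNat r)
  | .I e r n', N => eps₀ ((N + e.1 + n', (e.2 : ℕ)) :: toNat r)
  | _, _ => 0

/-- The class of `z^N D(z)` for the derivation `D` with a given label. -/
noncomputable def capPowZ : CoLabel → ℕ → Homology k (Alg k) 0
  | .C n, N => eps₀ [((n : ℕ), N + 1)]
  | .J e r n', N => -eps₀ (((n' : ℕ) - 1, N + 1) :: toNat (e :: r))
  | .K m [], N => delta₀ (m + N)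
  | .K m (a :: r), N => eps₀ (addLast (toNat (a :: r)) (m + N))
  | _, _ => 0

theorem zeroHom_y_pow_mul_x_mul_y_pow (a b : ℕ) :
    zeroHom (y ^ a * (x * y ^ b) : Alg k) = beta₀ (a + b) := by
  rw [← mul_assoc, zeroHom_mul_comm, ← mul_assoc, ← pow_add, beta₀, zeroHom_apply, add_comm b]

theorem zeroHom_yzWord (N j : ℕ) (e : ℕ+ × ℕ+) (r : List (ℕ+ × ℕ+)) :
    zeroHom (y ^ N * (yzWord e r * (x * y ^ j)) : Alg k) =
      eps₀ ((N + e.1 + j, (e.2 : ℕ)) :: toNat r) := by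
  rw [← mul_assoc, ← mul_assoc, zeroHom_mul_comm, yzWord, ← zeroHom_cyclicWord]
  simp only [← mul_assoc, ← pow_add]
  congr 5
  ring

theorem zeroHom_yzWord_mul (e : ℕ+ × ℕ+) (r : List (ℕ+ × ℕ+)) (i j : ℕ) :
    zeroHom (y ^ i * (x * (yzWord e r * (x * y ^ j))) : Alg k) = 0 := by
  have := yzWord_x (k := k) e r (j + i)
  rw [← mul_assoc, zeroHom_mul_comm]
  simp only [mul_assoc]
  rw [← mul_assoc (y ^ j), ← pow_add, this, map_zero]

theorem zeroHom_y_pow_mul_coValue (X : CoLabel) (N : ℕ) :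
    zeroHom (y ^ N * coValue X 1 : Alg k) = capPowY X N := by
  cases X with
  | A => simp [coValue, capPowY, gamma₀, ← zeroHom_apply, pow_succ]
  | B n => simp [coValue, capPowY, beta₀, ← zeroHom_apply, ← mul_assoc, pow_add]
  | C n =>
    have e : (y ^ N * coValue (.C n) 1 : Alg k) =
        y ^ (N + ((n : ℕ) + 1)) * x - y ^ N * (x * y ^ ((n : ℕ) + 1)) := by
      simp [coValue, mul_sub, pow_add, mul_assoc]
    rw [e, map_sub, zeroHom_y_pow_mul_x_mul_y_pow, beta₀, ← zeroHom_apply, sub_self]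
    rfl
  | D n i hi =>
    have h := zeroHom_y_pow_mul_x_mul_y_pow (k := k) (N + i) ((n : ℕ) - i)
    have h' : N + (i : ℕ) + ((n : ℕ) - i) = N + n := by omega
    rw [h'] at h
    have e : (y ^ N * coValue (.D n i hi) 1 : Alg k) =
        y ^ (N + n) * x - y ^ (N + i) * (x * y ^ ((n : ℕ) - i)) := by
      simp [coValue, mul_sub, pow_add, mul_assoc]
    rw [e, map_sub, h, beta₀, ← zeroHom_apply, sub_self]
    rfl
  | E n => simp [coValue, capPowY, beta₀, gamma₀, ← zeroHom_apply, mul_add, ← mul_assoc, ← pow_add,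
      add_assoc]
  | F n₀ e r =>
    have e : (y ^ N * coValue (.F n₀ e r) 1 : Alg k) =
        y ^ (N + n₀) * (x * (yzWord e r * (x * y ^ 0))) := by
      simp [coValue, pow_add, mul_assoc]
    rw [e, zeroHom_yzWord_mul]
    rfl
  | G e r =>
    have := zeroHom_yzWord (k := k) N 0 e r
    simpa [coValue, capPowY, mul_assoc] using this
  | H n₀ e r n' =>
    have e : (y ^ N * coValue (.H n₀ e r n') 1 : Alg k) =
        y ^ (N + n₀) * (x * (yzWord e r * (x * y ^ (n' : ℕ)))) := by
      simp [coValue, pow_add, mul_assoc]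
    rw [e, zeroHom_yzWord_mul]
    rfl
  | I e r n' =>
    have := zeroHom_yzWord (k := k) N n' e r
    simpa [coValue, capPowY, mul_assoc] using this
  | J e r n' =>
    have := zeroHom_yzWord_mul (k := k) e r N n'
    simpa [coValue, capPowY, mul_assoc] using this
  | K m r => simp [coValue, capPowY]

theorem block_toNat_cons (e : ℕ+ × ℕ+) (r : List (ℕ+ × ℕ+)) :
    (block (toNat (e :: r)) : Alg k) = x * yzWord e r := by
  rw [toNat_cons, block_cons, yzWord]
  simp only [mul_assoc]

theorem zeroHom_z_pow_mul_coValue (X : CoLabel) (N : ℕ) :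
    zeroHom (z ^ N * coValue X 2 : Alg k) = capPowZ X N := by
  cases X with
  | C n =>
    have e : (z ^ N * coValue (.C n) 2 : Alg k) = z ^ (N + 1) * x * y ^ (n : ℕ) := by
      simp [coValue, pow_succ, mul_assoc]
    rw [e, zeroHom_mul_comm, capPowZ, ← zeroHom_cyclicWord, block_nil, one_mul]
  | J e r n' =>
    have h : (z ^ N * coValue (.J e r n') 2 : Alg k) =
        -(z ^ (N + 1) * (x * (yzWord e r * x)) * y ^ ((n' : ℕ) - 1)) := by
      simp [coValue, pow_succ, mul_assoc]
    rw [h, map_neg, zeroHom_mul_comm, capPowZ, ← zeroHom_cyclicWord, block_toNat_cons, mul_assoc x]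
  | K m r =>
    have h : (z ^ N * coValue (.K m r) 2 : Alg k) = z ^ ((m : ℕ) + N) * block (toNat r) := by
      simp [coValue, ← mul_assoc, ← pow_add, add_comm]
    rw [h]
    cases r with
    | nil => simp [capPowZ, toNat, block_nil, delta₀, zeroHom_apply]
    | cons a r => rw [capPowZ, toNat_cons, eps₀_addLast, zeroHom_mul_comm]
  | _ => simp [coValue, capPowZ]

theorem zeroHom_thetaValue_toNat (l : List (ℕ+ × ℕ+)) (X : Fin 3 → Alg k)
    (f : List (ℕ × ℕ) → ℕ → ℕ → List (ℕ × ℕ) → Homology k (Alg k) 0)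
    (h : ∀ (u v : List (ℕ+ × ℕ+)) (n m : ℕ+), l = u ++ (n, m) :: v →
      zeroHom (y ^ (n : ℕ) * (z ^ (m : ℕ) * (block (toNat (v ++ u)) * X 0)))
      + ∑ t ∈ Finset.Icc 1 (n : ℕ), zeroHom (y ^ (t - 1) * (X 1 * (y ^ (n - t) *
          (z ^ (m : ℕ) * (block (toNat (v ++ u)) * x)))))
      + ∑ s ∈ Finset.Icc 1 (m : ℕ), zeroHom (y ^ (n : ℕ) * (z ^ (s - 1) * (X 2 * (z ^ (m - s) *
          (block (toNat (v ++ u)) * x))))) = f (toNat u) n m (toNat v)) :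
    zeroHom (∑ i, thetaValue (toNat l) i * X i) = sumSplit (toNat l) f := by
  refine zeroHom_thetaValue _ _ _ fun u n m v hl => ?_
  obtain ⟨u, w, rfl, rfl, hw⟩ := List.map_eq_append_iff.1 hl
  obtain ⟨⟨n, m⟩, v, rfl, h', rfl⟩ := List.map_eq_cons_iff.1 hw
  cases h'
  have := h u v n m rfl
  rw [zeroHom_thetaSummand]
  simpa only [toNat, List.map_append] using this

/-- A cyclic word with a factor `x y^j x` and a factor `z` vanishes. -/
theorem zeroHom_y_pow_mul_x_mul (j : ℕ) (a : Alg k) (m : ℕ+) (r : List (ℕ+ × ℕ+)) :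
    zeroHom (y ^ j * (x * (a * (z ^ (m : ℕ) * (block (toNat r) * x))))) = 0 := by
  have h := z_block_x (k := k) m m.ne_zero r j
  have e : (y ^ j * (x * (a * (z ^ (m : ℕ) * (block (toNat r) * x)))) : Alg k) =
      (y ^ j * x * a) * (z ^ (m : ℕ) * block (toNat r) * x) := by simp only [mul_assoc]
  rw [e, zeroHom_mul_comm, ← mul_assoc, ← mul_assoc, h, zero_mul, map_zero]

theorem eps₀_append_append (u w v : List (ℕ × ℕ)) :
    (eps₀ (u ++ w ++ v) : Homology k (Alg k) 0) = eps₀ (w ++ (v ++ u)) := by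
  rw [List.append_assoc, eps₀_rotate List.isRotated_append, List.append_assoc]

theorem toNat_append (u v : List (ℕ+ × ℕ+)) : toNat (u ++ v) = toNat u ++ toNat v :=
  List.map_append

theorem sumSplit_zero (l : List (ℕ × ℕ)) :
    sumSplit l (fun _ _ _ _ => (0 : Homology k (Alg k) 0)) = 0 := by
  simp [sumSplit]

theorem pow_mul_pow_assoc (g a : Alg k) {s m : ℕ} (hs : s ∈ Finset.Icc 1 m) :
    g ^ (s - 1) * (g * (g ^ (m - s) * a)) = g ^ m * a := by
  rw [Finset.mem_Icc] at hs
  rw [← mul_assoc, ← mul_assoc, ← pow_succ, ← pow_add]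
  congr 2
  omega

theorem cyclicWord_cons_append (n m n' m' : ℕ) (l r : List (ℕ × ℕ)) :
    (y ^ n * (z ^ m * (block l * (x * (y ^ n' * (z ^ m' * (block r * x)))))) : Alg k) =
      cyclicWord ((n, m) :: (l ++ (n', m') :: r)) := by
  rw [cyclicWord_cons, block_append, block_cons]
  simp only [mul_assoc]

theorem block_addLast_cons (n p d : ℕ) (l : List (ℕ × ℕ)) :
    ∃ e l', addLast ((n, p) :: l) d = e :: l' ∧
      (y ^ e.1 * (z ^ e.2 * block l') : Alg k) = y ^ n * (z ^ p * (block l * z ^ d)) := by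
  cases l with
  | nil => exact ⟨_, _, rfl, by simp [block_nil, pow_add]⟩
  | cons e l => exact ⟨_, _, rfl, by rw [block_addLast]⟩

theorem zeroHom_thetaValue_coValue (X : CoLabel) (e : ℕ+ × ℕ+) (r : List (ℕ+ × ℕ+)) :
    zeroHom (∑ i, thetaValue (toNat (e :: r)) i * (coValue X i : Alg k)) =
      capTable X (.theta e r) := by
  cases X with
  | A =>
    rw [capTable]
    refine zeroHom_thetaValue_toNat _ _ _ fun u v n m hl => ?_
    simp only [coValue, Matrix.cons_val_zero, Matrix.cons_val_one, Matrix.cons_val, zero_mul,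
      mul_zero, map_zero, Finset.sum_const_zero, add_zero]
    rw [Finset.sum_congr rfl fun t ht => congrArg zeroHom (pow_mul_pow_assoc y _ ht)]
    have h : (eps₀ (toNat (e :: r)) : Homology k (Alg k) 0) =
        eps₀ (((n : ℕ), (m : ℕ)) :: toNat (v ++ u)) := by
      rw [hl, toNat_append, toNat_cons, eps₀_rotate List.isRotated_append, toNat_append,
        List.cons_append]
    rw [h, ← zeroHom_cyclicWord]
    simp [add_smul, add_comm]
  | B n' =>
    rw [capTable, ← sumSplit_zero]
    · refine zeroHom_thetaValue_toNat _ _ _ fun u v n m _ => ?_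
      have h1 : (z ^ (m : ℕ) * (block (toNat (v ++ u)) * (y ^ (n' : ℕ) * x)) : Alg k) = 0 := by
        obtain ⟨j, hj⟩ := Nat.exists_eq_succ_of_ne_zero n'.ne_zero
        rw [hj, pow_succ', ← mul_assoc, ← mul_assoc, ← mul_assoc,
          block_mul_y _ m.ne_zero, zero_mul, zero_mul]
      have h2 : ∀ t ∈ Finset.Icc 1 (n : ℕ),
          zeroHom (y ^ (t - 1) * (coValue (.B n') 1 * (y ^ (n - t) *
            (z ^ (m : ℕ) * (block (toNat (v ++ u)) * x)))) : Alg k) = 0 := fun t _ => by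
        have := zeroHom_y_pow_mul_x_mul (k := k) (t - 1 + n') (y ^ ((n : ℕ) - t)) m (v ++ u)
        simpa [coValue, pow_add, mul_assoc] using this
      rw [Finset.sum_congr rfl h2]
      simp [coValue, h1]
    all_goals simp
  | C n' =>
    rw [capTable]
    refine zeroHom_thetaValue_toNat _ _ _ fun u v n m _ => ?_
    have h2 : ∀ t ∈ Finset.Icc 1 (n : ℕ), zeroHom (y ^ (t - 1) * (coValue (.C n') 1 * (y ^ (n - t) *
        (z ^ (m : ℕ) * (block (toNat (v ++ u)) * x)))) : Alg k) = 0 := fun t _ => by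
      have h3 := zeroHom_y_pow_mul_x_mul (k := k) (t - 1 + (n' + 1)) (y ^ ((n : ℕ) - t)) m (v ++ u)
      have h4 := zeroHom_y_pow_mul_x_mul (k := k) (t - 1)
        (y ^ ((n' : ℕ) + 1) * y ^ ((n : ℕ) - t)) m (v ++ u)
      rw [pow_add] at h3
      simp only [mul_assoc] at h3 h4
      simp only [coValue, Matrix.cons_val_one, Matrix.cons_val_zero, sub_mul, mul_sub, mul_assoc,
        map_sub, h3, h4, sub_zero]
    rw [Finset.sum_congr rfl h2, Finset.sum_const_zero, add_zero]
    simp only [coValue, Matrix.cons_val_zero, mul_zero, map_zero, zero_add]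
    refine Finset.sum_congr rfl fun s hs => ?_
    rw [Finset.mem_Icc] at hs
    have h5 : (z ^ s : Alg k) = z ^ (s - 1) * z := by rw [← pow_succ, Nat.sub_add_cancel hs.1]
    rw [eps₀_append_append, eps₀, toNat_append, ← zeroHom_apply, List.cons_append,
      ← List.nil_append ([((n' : ℕ), (m : ℕ) - s)] ++ _), List.singleton_append,
      ← cyclicWord_cons_append, h5]
    simp [mul_assoc, block_nil]
  | E n' =>
    rw [capTable]
    refine zeroHom_thetaValue_toNat _ _ _ fun u v n m _ => ?_
    have h2 : ∀ t ∈ Finset.Icc 1 (n : ℕ), zeroHom (y ^ (t - 1) * (coValue (.E n') 1 * (y ^ (n - t) *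
        (z ^ (m : ℕ) * (block (toNat (v ++ u)) * x)))) : Alg k) =
        eps₀ (((n : ℕ) + n', (m : ℕ)) :: toNat (v ++ u)) := fun t ht => by
      have h3 := zeroHom_y_pow_mul_x_mul (k := k) (t - 1 + n') (y ^ ((n : ℕ) - t)) m (v ++ u)
      rw [pow_add] at h3
      simp only [mul_assoc] at h3
      simp only [coValue, Matrix.cons_val_one, Matrix.cons_val_zero, add_mul, mul_add, mul_assoc,
        map_add, h3, zero_add]
      rw [Finset.mem_Icc] at ht
      rw [← zeroHom_cyclicWord, ← mul_assoc, ← mul_assoc, ← pow_add, ← pow_add]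
      congr 3
      omega
    rw [Finset.sum_congr rfl h2, eps₀_append_append, toNat_append]
    simp [coValue]
  | G a b =>
    rw [capTable]
    refine zeroHom_thetaValue_toNat _ _ _ fun u v n m _ => ?_
    simp only [coValue, Matrix.cons_val_zero, Matrix.cons_val_one, Matrix.cons_val, mul_zero,
      zero_mul, map_zero, zero_add, Finset.sum_const_zero, add_zero]
    refine Finset.sum_congr rfl fun t ht => ?_
    rw [Finset.mem_Icc] at ht
    have h : t - 1 + (a.1 : ℕ) = t + a.1 - 1 := by omega
    rw [List.append_assoc _ (_ :: _), eps₀_append_append, eps₀, ← zeroHom_apply,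
      List.cons_append, List.append_assoc, ← toNat_append, List.singleton_append,
      ← cyclicWord_cons_append, ← h, pow_add, yzWord]
    simp only [mul_assoc]
  | I a b n' =>
    rw [capTable]
    refine zeroHom_thetaValue_toNat _ _ _ fun u v n m _ => ?_
    simp only [coValue, Matrix.cons_val_zero, Matrix.cons_val_one, Matrix.cons_val, mul_zero,
      zero_mul, map_zero, zero_add, Finset.sum_const_zero, add_zero]
    refine Finset.sum_congr rfl fun t ht => ?_
    rw [Finset.mem_Icc] at ht
    have h : t - 1 + (a.1 : ℕ) = t + a.1 - 1 := by omega
    have h' : (n : ℕ) + n' - t = n' + (n - t) := by omega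
    rw [List.append_assoc _ (_ :: _), eps₀_append_append, eps₀, ← zeroHom_apply,
      List.cons_append, List.append_assoc, ← toNat_append, List.singleton_append,
      ← cyclicWord_cons_append, ← h, h', pow_add, pow_add, yzWord]
    simp only [mul_assoc]
  | J a b n' =>
    rw [capTable]
    have hneg : ∀ (l : List (ℕ × ℕ)) (f : List (ℕ × ℕ) → ℕ → ℕ → List (ℕ × ℕ) →
        Homology k (Alg k) 0), -sumSplit l f = sumSplit l fun u n m v => -f u n m v := fun l f => by
      simp [sumSplit]
    rw [hneg]
    refine zeroHom_thetaValue_toNat _ _ _ fun u v n m _ => ?_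
    have h2 : ∀ t ∈ Finset.Icc 1 (n : ℕ), zeroHom (y ^ (t - 1) * (coValue (.J a b n') 1 *
        (y ^ (n - t) * (z ^ (m : ℕ) * (block (toNat (v ++ u)) * x)))) : Alg k) = 0 := fun t _ => by
      have h3 := zeroHom_y_pow_mul_x_mul (k := k) (t - 1)
        (yzWord a b * x * y ^ (n' : ℕ) * y ^ ((n : ℕ) - t)) m (v ++ u)
      simpa [coValue, mul_assoc] using h3
    rw [Finset.sum_congr rfl h2, Finset.sum_const_zero, add_zero, ← Finset.sum_neg_distrib]
    simp only [coValue, Matrix.cons_val_zero, Matrix.cons_val, mul_zero, map_zero, zero_add]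
    refine Finset.sum_congr rfl fun s hs => ?_
    rw [Finset.mem_Icc] at hs
    have h5 : (z ^ s : Alg k) = z ^ (s - 1) * z := by rw [← pow_succ, Nat.sub_add_cancel hs.1]
    rw [List.append_assoc (toNat u), List.append_assoc (toNat u), eps₀_append_append, eps₀,
      ← toNat_append, ← zeroHom_apply, List.append_assoc, List.append_assoc, List.singleton_append,
      List.singleton_append, ← cyclicWord_cons_append, h5, block_toNat_cons]
    simp only [neg_mul, mul_neg, map_neg, mul_assoc]
  | K s₁ b =>
    rw [capTable]
    refine zeroHom_thetaValue_toNat _ _ _ fun u v n m _ => ?_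
    simp only [coValue, Matrix.cons_val_zero, Matrix.cons_val_one, Matrix.cons_val, mul_zero,
      zero_mul, map_zero, zero_add, Finset.sum_const_zero]
    refine Finset.sum_congr rfl fun s hs => ?_
    rw [Finset.mem_Icc] at hs
    obtain ⟨f, l, h, h'⟩ := block_addLast_cons (k := k) n (s + (s₁ : ℕ) - 1) (m - s) (toNat b)
    have h5 : s - 1 + (s₁ : ℕ) = s + s₁ - 1 := by omega
    have h6 : (y ^ f.1 * (z ^ f.2 * (block l * (block (toNat (v ++ u)) * x))) : Alg k) =
        y ^ f.1 * (z ^ f.2 * block l) * (block (toNat (v ++ u)) * x) := by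
      simp only [mul_assoc]
    rw [eps₀_append_append, h, eps₀, ← toNat_append, ← zeroHom_apply, List.cons_append,
      cyclicWord_cons, block_append, mul_assoc (block l), h6, h', ← h5, pow_add]
    simp only [mul_assoc]
  | D n' i hi =>
    rw [capTable, ← sumSplit_zero]
    · refine zeroHom_thetaValue_toNat _ _ _ fun u v n m _ => ?_
      simp only [coValue, Matrix.cons_val_zero, Matrix.cons_val_one, Matrix.cons_val, mul_zero,
        zero_mul, map_zero, zero_add, Finset.sum_const_zero, add_zero]
      refine Finset.sum_eq_zero fun t _ => ?_
      have h3 := zeroHom_y_pow_mul_x_mul (k := k) (t - 1 + n') (y ^ ((n : ℕ) - t)) m (v ++ u)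
      have h4 := zeroHom_y_pow_mul_x_mul (k := k) (t - 1 + i)
        (y ^ ((n' : ℕ) - i) * y ^ ((n : ℕ) - t)) m (v ++ u)
      rw [pow_add] at h3 h4
      simp only [mul_assoc] at h3 h4
      simp only [sub_mul, mul_sub, mul_assoc, map_sub, h3, h4, sub_zero]
    all_goals simp
  | F n₀ a b =>
    rw [capTable, ← sumSplit_zero]
    · refine zeroHom_thetaValue_toNat _ _ _ fun u v n m _ => ?_
      simp only [coValue, Matrix.cons_val_zero, Matrix.cons_val_one, Matrix.cons_val, mul_zero,
        zero_mul, map_zero, zero_add, Finset.sum_const_zero, add_zero]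
      refine Finset.sum_eq_zero fun t _ => ?_
      have h3 := zeroHom_y_pow_mul_x_mul (k := k) (t - 1 + n₀)
        (yzWord a b * x * y ^ ((n : ℕ) - t)) m (v ++ u)
      rw [pow_add] at h3
      simpa only [mul_assoc] using h3
    all_goals simp
  | H n₀ a b n' =>
    rw [capTable, ← sumSplit_zero]
    · refine zeroHom_thetaValue_toNat _ _ _ fun u v n m _ => ?_
      simp only [coValue, Matrix.cons_val_zero, Matrix.cons_val_one, Matrix.cons_val, mul_zero,
        zero_mul, map_zero, zero_add, Finset.sum_const_zero, add_zero]
      refine Finset.sum_eq_zero fun t _ => ?_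
      have h3 := zeroHom_y_pow_mul_x_mul (k := k) (t - 1 + n₀)
        (yzWord a b * x * y ^ (n' : ℕ) * y ^ ((n : ℕ) - t)) m (v ++ u)
      rw [pow_add] at h3
      simpa only [mul_assoc] using h3
    all_goals simp

theorem cap_coClass_class₁ (X : CoLabel) (χ : Label₁) :
    cap k (n := 1) (m := 0) (p := 1) rfl (coClass X) (class₁ χ) =
      (capTable X χ : Homology k (Alg k) 0) := by
  rw [coClass, class₁, cap_derClass_oneClass]
  have hx : ∀ n : ℕ, (x * (y ^ n * x) : Alg k) = -(y ^ (n + 1) * x) := fun n => by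
    rw [← mul_assoc, x_mul_y_pow_mul_x]
  cases χ with
  | theta e r => exact zeroHom_thetaValue_coValue X e r
  | alpha =>
    cases X <;> simp [value₁, coValue, Fin.sum_univ_three, capTable, alpha₀, beta₀, ← zeroHom_apply]
  | beta =>
    cases X <;> simp [value₁, coValue, Fin.sum_univ_three, capTable, beta₀, ← zeroHom_apply,
      x_mul_x, hx]
  | gamma n =>
    cases X <;> simp [value₁, coValue, Fin.sum_univ_three, capTable, beta₀, ← zeroHom_apply,
      mul_assoc, x_mul_x, hx, pow_add]
  | delta =>
    have := zeroHom_y_pow_mul_coValue (k := k) X 0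
    rw [pow_zero, one_mul] at this
    simp only [value₁, Fin.sum_univ_three, Matrix.cons_val_zero, Matrix.cons_val_one,
      Matrix.cons_val, zero_mul, one_mul, zero_add, add_zero, this]
    cases X <;> simp [capPowY, capTable, toNat_cons]
  | eps n =>
    have := zeroHom_y_pow_mul_coValue (k := k) X n
    simp only [value₁, Fin.sum_univ_three, Matrix.cons_val_zero, Matrix.cons_val_one,
      Matrix.cons_val, zero_mul, zero_add, add_zero, this]
    cases X with
    | K m r => cases r <;> rfl
    | _ => rfl
  | zeta =>
    have := zeroHom_z_pow_mul_coValue (k := k) X 0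
    rw [pow_zero, one_mul] at this
    simp only [value₁, Fin.sum_univ_three, Matrix.cons_val_zero, Matrix.cons_val_one,
      Matrix.cons_val, zero_mul, one_mul, zero_add, this]
    cases X with
    | K m r => cases r <;> simp [capPowZ, capTable]
    | _ => simp [capPowZ, capTable]
  | eta n =>
    have := zeroHom_z_pow_mul_coValue (k := k) X n
    simp only [value₁, Fin.sum_univ_three, Matrix.cons_val_zero, Matrix.cons_val_one,
      Matrix.cons_val, zero_mul, zero_add, this]
    cases X with
    | K m r => cases r <;> rfl
    | _ => rfl

end CapTable

/-! ### Hochschild cohomology in degrees zero and one -/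

section Cohomology

variable {k : Type*} [Field k]

/-- The values `g a - a g` on the generators `g` of the inner derivation given by `a`. -/
def inner : Alg k →ₗ[k] Fin 3 → Alg k :=
  LinearMap.pi fun i => LinearMap.mulLeft k (gen i) - LinearMap.mulRight k (gen i)

theorem inner_apply (a : Alg k) (i : Fin 3) : inner a i = gen i * a - a * gen i := rfl

theorem eq_of_derivations {f g : Alg k → Alg k} (hf : IsLinearMap k f) (hg : IsLinearMap k g)
    (hf' : ∀ a b, f (a * b) = a * f b + f a * b) (hg' : ∀ a b, g (a * b) = a * g b + g a * b)
    (h : ∀ i, f (gen i) = g (gen i)) (a : Alg k) : f a = g a := by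
  refine alg_induction_left (LinearMap.eqLocus hf.mk' hg.mk') ?_ ?_ a
  · have h1 : ∀ f : Alg k → Alg k, (∀ a b, f (a * b) = a * f b + f a * b) → f 1 = 0 := by
      intro f hf
      have := hf 1 1
      rwa [mul_one, one_mul, mul_one, left_eq_add] at this
    exact (h1 f hf').trans (h1 g hg').symm
  · intro i a ha
    have ha' : f a = g a := ha
    change f (gen i * a) = g (gen i * a)
    rw [hf', hg', h, ha']

/-- The values of a `1`-cochain on the generators. -/
def genValues : Cochain k (Alg k) 1 →ₗ[k] Fin 3 → Alg k where
  toFun f i := f fun _ => gen i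
  map_add' _ _ := rfl
  map_smul' _ _ := rfl

theorem cocycle_mul {f : Cochain k (Alg k) 1} (hf : f ∈ cocycles k (Alg k) 1) (a b : Alg k) :
    f (fun _ => a * b) = a * f (fun _ => b) + f (fun _ => a) * b := by
  have h := congrArg (fun g : Cochain k (Alg k) 2 => g ![a, b])
    (show coboundary k (Alg k) 1 f = 0 from hf)
  have h1 : mulFace 0 ![a, b] = fun _ : Fin 1 => a * b := by
    ext i; fin_cases i; simp [mulFace]
  simp only [coboundary_apply, Fin.sum_univ_one, h1] at h
  have h2 : (fun i : Fin 1 => (![a, b] : Fin 2 → Alg k) i.succ) = fun _ => b := by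
    ext i; fin_cases i; rfl
  have h3 : (fun i : Fin 1 => (![a, b] : Fin 2 → Alg k) i.castSucc) = fun _ => a := by
    ext i; fin_cases i; rfl
  rw [h2, h3] at h
  simp at h
  rw [eq_comm, ← sub_eq_zero, ← h]
  abel

theorem cochain_isLinearMap (f : Cochain k (Alg k) 1) : IsLinearMap k fun a => f fun _ => a := by
  have h : ∀ a : Alg k, Function.update (0 : Fin 1 → Alg k) 0 a = fun _ => a := fun a => by
    ext i; fin_cases i; rfl
  constructor
  · intro a b
    simp only [← h, MultilinearMap.map_update_add]
  · intro r a
    simp only [← h, MultilinearMap.map_update_smul]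

theorem genValues_isDer {f : Cochain k (Alg k) 1} (hf : f ∈ cocycles k (Alg k) 1) :
    IsDer (genValues f) := by
  have hl := cochain_isLinearMap f
  have h0 : f (fun _ => 0) = 0 := hl.map_zero
  constructor
  · have h := congrArg (fun a : Alg k => f fun _ => a) (x_mul_x (k := k))
    simp only [cocycle_mul hf, hl.map_neg] at h
    change (x + y) * f (fun _ => x) + f (fun _ => x) * x + f (fun _ => y) * x = 0
    rw [add_mul, ← sub_eq_zero.2 h]
    abel
  · have h := congrArg (fun a : Alg k => f fun _ => a) (x_mul_z (k := k))
    simp only [cocycle_mul hf, h0] at h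
    exact h
  · have h := congrArg (fun a : Alg k => f fun _ => a) (z_mul_y (k := k))
    simp only [cocycle_mul hf, h0] at h
    exact h

theorem mem_coboundaries_of_genValues {f : Cochain k (Alg k) 1} (hf : f ∈ cocycles k (Alg k) 1)
    (a : Alg k) (h : genValues f = inner a) : f ∈ coboundaries k (Alg k) 1 := by
  refine ⟨MultilinearMap.constOfIsEmpty k _ a, ?_⟩
  ext v
  have hv : v = fun _ => v 0 := by ext i; fin_cases i; rfl
  have h1 : coboundary k (Alg k) 0 (MultilinearMap.constOfIsEmpty k _ a) v = v 0 * a - a * v 0 := by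
    simp [coboundary_apply, sub_eq_add_neg]
  rw [h1]
  conv_rhs => rw [hv]
  symm
  refine eq_of_derivations (f := fun b => f fun _ => b) (g := fun b => b * a - a * b)
    (cochain_isLinearMap f) ?_ (cocycle_mul hf) ?_ (fun i => congrFun h i) _
  · exact (LinearMap.mulRight k a - LinearMap.mulLeft k a).isLinear
  · intro b c
    noncomm_ring

theorem genValues_coboundary {f : Cochain k (Alg k) 1} (hf : f ∈ coboundaries k (Alg k) 1) :
    genValues f ∈ LinearMap.range (inner (k := k)) := by
  obtain ⟨g, rfl⟩ := hf
  refine ⟨g Fin.elim0, ?_⟩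
  ext i
  have h : ∀ v : Fin 0 → Alg k, v = Fin.elim0 := fun v => Subsingleton.elim _ _
  change _ = coboundary k (Alg k) 0 g _
  rw [coboundary_apply, inner_apply]
  simp [h, sub_eq_add_neg]

/-- The injective map from `HH^{-1}` to the space of values on the generators modulo inner
derivations. -/
def cohomologyValues : Cohomology k (Alg k) 1 →ₗ[k]
    (Fin 3 → Alg k) ⧸ LinearMap.range (inner (k := k)) :=
  Submodule.liftQ _ ((LinearMap.range inner).mkQ ∘ₗ genValues ∘ₗ Submodule.subtype _) fun _ hf =>
    (Submodule.Quotient.mk_eq_zero _).2 (genValues_coboundary hf)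

theorem cohomologyValues_mk (f : cocycles k (Alg k) 1) :
    cohomologyValues (Subquotient.mk _ _ f) = Submodule.Quotient.mk (genValues f.1) := rfl

theorem cohomologyValues_injective : Function.Injective (cohomologyValues (k := k)) := by
  rw [← LinearMap.ker_eq_bot, LinearMap.ker_eq_bot']
  intro ξ hξ
  obtain ⟨f, rfl⟩ := Subquotient.mk_surjective _ _ ξ
  rw [cohomologyValues_mk, Submodule.Quotient.mk_eq_zero] at hξ
  obtain ⟨a, ha⟩ := hξ
  exact (Subquotient.mk_eq_zero _ _ _).2 (mem_coboundaries_of_genValues f.2 a ha.symm)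

theorem cohomologyValues_coClass (X : CoLabel) :
    cohomologyValues (coClass X : Cohomology k (Alg k) 1) = Submodule.Quotient.mk (coValue X) := by
  rw [coClass, derClass, cohomologyValues_mk]
  congr 1
  ext i
  exact derivation_gen _ _ i

/-! ### The values of the basis in terms of words -/

/-- The gaps of the word `z^m x y^{n_1} z^{m_1} ⋯` after its first letter `z`. -/
def zGaps (m : ℕ+) (r : List (ℕ+ × ℕ+)) : List ℕ := List.replicate ((m : ℕ) - 1) 0 ++ pairGaps r

theorem gapDecode_zGaps (m : ℕ+) (r : List (ℕ+ × ℕ+)) : gapDecode (zGaps m r) = (m, r) :=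
  gapDecode_append m r

theorem zGaps_gapDecode (l : List ℕ) : zGaps (gapDecode l).1 (gapDecode l).2 = l :=
  append_pairGaps_gapDecode l

theorem zGaps_inj {m m' : ℕ+} {r r' : List (ℕ+ × ℕ+)} :
    zGaps m r = zGaps m' r' ↔ m = m' ∧ r = r' := by
  refine ⟨fun h => ?_, by rintro ⟨rfl, rfl⟩; rfl⟩
  have := congrArg gapDecode h
  simpa only [gapDecode_zGaps, Prod.mk.injEq] using this

theorem yzWord_eq (e : ℕ+ × ℕ+) (r : List (ℕ+ × ℕ+)) :
    (yzWord e r : Alg k) = y ^ (e.1 : ℕ) * (z * gapProd (zGaps e.2 r)) := by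
  rw [yzWord, zGaps, gapProd_pairGaps]

theorem gapZ_pnat (n : ℕ+) : (gapZ (n : ℕ) : Alg k) = x * (y ^ (n : ℕ) * z) := by
  obtain ⟨c, hc⟩ := Nat.exists_eq_succ_of_ne_zero n.ne_zero
  rw [hc, gapZ]

/-- The values of `coValue` in terms of words. -/
def coWord : CoLabel → Fin 3 → Alg k
  | .A => ![word (0, [], some 0), word (1, [], none), 0]
  | .B n => ![word (n, [], some 0), -word (n, [], some 0), 0]
  | .C n => ![0, word (n + 1, [], some 0) - word (0, [], some (n + 1)), word (0, [0], some n)]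
  | .D n i _ => ![0, word (n, [], some 0) - word (i, [], some (n - i)), 0]
  | .E n => ![0, word (n, [], some 0) + word (n + 1, [], none), 0]
  | .F n₀ e r => ![0, word (n₀, e.1 :: zGaps e.2 r, some 0), 0]
  | .G e r => ![0, word (e.1, 0 :: zGaps e.2 r, some 0), 0]
  | .H n₀ e r n' => ![0, word (n₀, e.1 :: zGaps e.2 r, some n'), 0]
  | .I e r n' => ![0, word (e.1, 0 :: zGaps e.2 r, some n'), 0]
  | .J e r n' => ![0, word (0, e.1 :: zGaps e.2 r, some n'),
      -word (0, 0 :: e.1 :: zGaps e.2 r, some (n' - 1))]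
  | .K m r => ![0, 0, word (0, 0 :: zGaps m r, none)]

theorem coValue_eq_coWord (X : CoLabel) : (coValue X : Fin 3 → Alg k) = coWord X := by
  have h0 : (gapZ 0 : Alg k) = z := rfl
  cases X with
  | K m r => simp [coValue, coWord, word, tailEnd, h0, zGaps, ← gapProd_pairGaps]
  | _ => simp [coValue, coWord, word, tailEnd, yzWord_eq, gapZ_pnat, mul_assoc, h0]

/-- The slot and the word that distinguish an element of the basis from all others. -/
def leadWord : CoLabel → Fin 3 × Word
  | .A => (0, (0, [], some 0))
  | .B n => (0, (n, [], some 0))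
  | .C n => (2, (0, [0], some n))
  | .D n i _ => (1, (i, [], some (n - i)))
  | .E n => (1, (n + 1, [], none))
  | .F n₀ e r => (1, (n₀, e.1 :: zGaps e.2 r, some 0))
  | .G e r => (1, (e.1, 0 :: zGaps e.2 r, some 0))
  | .H n₀ e r n' => (1, (n₀, e.1 :: zGaps e.2 r, some n'))
  | .I e r n' => (1, (e.1, 0 :: zGaps e.2 r, some n'))
  | .J e r n' => (2, (0, 0 :: e.1 :: zGaps e.2 r, some (n' - 1)))
  | .K m r => (2, (0, 0 :: zGaps m r, none))

theorem coef_leadWord_self (X : CoLabel) :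
    coef (leadWord X).2 (coValue X (leadWord X).1 : Alg k) ≠ 0 := by
  rw [coValue_eq_coWord]
  cases X with
  | D n i h =>
    have h0 : ¬(0 = (n : ℕ) - i) := by omega
    simp [leadWord, coWord, coef_word, h0]
  | _ => simp [leadWord, coWord, coef_word]

theorem coef_leadWord_of_ne {X Y : CoLabel}
    (h : coef (leadWord X).2 (coValue Y (leadWord X).1 : Alg k) ≠ 0) : X = Y := by
  rw [coValue_eq_coWord] at h
  have h0 : ∀ n : ℕ+, ¬(0 = (n : ℕ)) := fun n => n.ne_zero.symm
  cases X with
  | D n i hi =>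
    have h1 : ¬(0 = (n : ℕ) - i) := by omega
    cases Y with
    | D n' i' hi' =>
      simp [leadWord, coWord, coef_word, h1] at h ⊢
      obtain ⟨rfl, h⟩ := h
      exact ⟨PNat.coe_injective (by omega), rfl⟩
    | _ => simp [leadWord, coWord, coef_word, h0, h1] at h
  | J e r n =>
    have hn := n.pos
    cases Y with
    | J e' r' n' =>
      simp [leadWord, coWord, coef_word, zGaps_inj, Prod.ext_iff] at h ⊢
      have hn' := n'.pos
      obtain ⟨h1, h2, h3, h4⟩ := h
      exact ⟨⟨h1.symm, h2.symm⟩, h3.symm, PNat.coe_injective (by omega)⟩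
    | _ => simp [leadWord, coWord, coef_word] at h
  | _ =>
    cases Y <;> simp [leadWord, coWord, coef_word, zGaps_inj, Prod.ext_iff, h0] at h ⊢
    all_goals simp_all

/-- A word that begins with `z`. -/
def IsZWord : Word → Prop
  | (0, 0 :: _, _) => True
  | _ => False

theorem coef_z_mul_of_not (w : Word) (hw : ¬IsZWord w) (a : Alg k) : coef w (z * a) = 0 := by
  obtain ⟨n, L, e⟩ := w
  rcases L with _ | ⟨c, L⟩
  · exact coef_nil_z_mul _ _ _
  · refine coef_cons_z_mul _ _ ?_ _ _ _
    by_contra! h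
    obtain ⟨rfl, rfl⟩ := h
    exact hw trivial

/-- The triple of values vanishes in certain coordinates. These are chosen so that every `coValue X`
vanishes there, while an inner derivation that vanishes there is zero. -/
structure IsFree (v : Fin 3 → Alg k) : Prop where
  x_slot : ∀ n L e, ¬(L = [] ∧ e = some 0) → coef (n, L, e) (v 0) = 0
  y_slot : ∀ L e, coef (0, 0 :: L, e) (v 1) = 0
  y_slot' : ∀ n, coef (n + 1, [], some 1) (v 1) = 0
  z_slot : ∀ w, ¬IsZWord w → coef w (v 2) = 0
  z_slot' : coef (0, [0], some 0) (v 2) = 0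

theorem coValue_isFree (X : CoLabel) : IsFree (coValue X : Fin 3 → Alg k) := by
  rw [coValue_eq_coWord]
  have h0 : ∀ n : ℕ+, ¬((n : ℕ) = 0) := fun n => n.ne_zero
  constructor
  · intro n L e h
    cases X with
    | A =>
      simp [coWord, coef_word]
      grind
    | B m =>
      simp [coWord, coef_word]
      grind
    | _ => simp [coWord]
  · intro L e
    cases X <;> simp [coWord, coef_word, h0]
  · intro n
    cases X with
    | D m i h =>
      have h1 : (m : ℕ) - i ≠ 1 := by omega
      simp [coWord, coef_word, h1]
    | _ => simp [coWord, coef_word, h0]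
  · rintro w hw
    cases X with
    | C n =>
      have : (0, [0], some (n : ℕ)) ≠ w := by rintro rfl; exact hw trivial
      simp [coWord, coef_word, this]
    | J e r n =>
      have : (0, 0 :: (e.1 : ℕ) :: zGaps e.2 r, some ((n : ℕ) - 1)) ≠ w := by
        rintro rfl; exact hw trivial
      simp [coWord, coef_word, this]
    | K m r =>
      have : (0, 0 :: zGaps m r, none) ≠ w := by rintro rfl; exact hw trivial
      simp [coWord, coef_word, this]
    | _ => simp [coWord]
  · cases X <;> simp [coWord, coef_word, h0]

/-- An inner derivation that satisfies `IsFree` is given by a scalar. -/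
theorem coef_eq_zero_of_inner_isFree {a : Alg k} (h : IsFree (inner a)) {w : Word}
    (hw : w ≠ (0, [], none)) : coef w a = 0 := by
  have hz : ∀ n L c, ¬IsZWord (n, L ++ [c], none) → coef (n, L ++ [c], none) (a * z) = 0 := by
    intro n L c hw
    have := h.z_slot _ hw
    rwa [inner_apply, map_sub, coef_z_mul_of_not _ hw, zero_sub, neg_eq_zero] at this
  have hnone : ∀ n L, ¬IsZWord (n, L ++ [0], none) → coef (n, L, none) a = 0 := by
    intro n L hw
    rw [← coef_mul_z_zero]
    exact hz _ _ _ hw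
  have hsome : ∀ n b L, ¬IsZWord (n, L ++ [b + 1], none) → coef (n, L, some (b + 1)) a = 0 := by
    intro n b L hw
    rw [← coef_mul_z_succ]
    exact hz _ _ _ hw
  have hznone : ∀ L, coef (0, 0 :: L, none) a = 0 := by
    intro L
    have := h.x_slot 0 (0 :: L) (some 0) (by simp)
    rwa [inner_apply, map_sub, coef_x_mul_cons_zero, coef_mul_x_cons, zero_sub,
      neg_eq_zero] at this
  have hzsome : ∀ L b, coef (0, 0 :: L, some b) a = 0 := by
    intro L b
    have := h.y_slot L (some (b + 1))
    rwa [inner_apply, map_sub, coef_zero_y_mul, coef_mul_y_some, zero_sub, neg_eq_zero] at this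
  have hx : ∀ n L, coef (n, L, some 0) a = 0 := by
    intro n L
    rcases L with _ | ⟨_ | c, L⟩
    · rcases n with _ | n
      · have := h.z_slot'
        rwa [inner_apply, map_sub, coef_z_mul, coef_mul_z_some, sub_zero] at this
      · have := h.y_slot' n
        have h1 : coef (n, [], some (0 + 1)) a = 0 :=
          hsome _ _ _ (by rcases n with _ | n <;> simp [IsZWord])
        have h2 : coef (n + 1, [], some (0 + 1)) (a * y) = coef (n + 1, [], some 0) a :=
          coef_mul_y_some _ _ _ _
        rw [zero_add] at h1 h2
        rwa [inner_apply, map_sub, coef_succ_y_mul, h1, h2, zero_sub, neg_eq_zero] at this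
    · rcases n with _ | n
      · exact hzsome L 0
      · have := h.x_slot 0 ((n + 1) :: L) (some 0) (by simp)
        rwa [inner_apply, map_sub, coef_x_mul_zero_cons_succ, coef_mul_x_cons,
          hnone 0 ((n + 1) :: L) (by simp [IsZWord]), sub_zero] at this
    · have := h.x_slot (n + 1) ((c + 1) :: L) (some 0) (by simp)
      rwa [inner_apply, map_sub, coef_x_mul_succ_cons_succ, coef_mul_x_cons,
        hnone (n + 1) ((c + 1) :: L) (by simp [IsZWord]), sub_zero, neg_eq_zero] at this
  obtain ⟨n, L, _ | _ | b⟩ := w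
  · rcases n with _ | n
    · rcases L with _ | ⟨_ | c, L⟩
      · exact absurd rfl hw
      · exact hznone L
      · exact hnone _ _ (by simp [IsZWord])
    · exact hnone _ _ (by simp [IsZWord])
  · exact hx n L
  · rcases n with _ | n
    · rcases L with _ | ⟨_ | c, L⟩
      · exact hsome _ _ _ (by simp [IsZWord])
      · exact hzsome L _
      · exact hsome _ _ _ (by simp [IsZWord])
    · exact hsome _ _ _ (by simp [IsZWord])

theorem exists_smul_one_of_inner_isFree {a : Alg k} (h : IsFree (inner a)) :
    a = coef (0, [], none) a • 1 := by
  have h1 : (word (0, [], none) : Alg k) = 1 := by simp [word, tailEnd]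
  rw [← sub_eq_zero]
  refine eq_zero_of_coef fun w => ?_
  rw [map_sub, map_smul, ← h1, coef_word, smul_eq_mul]
  split_ifs with hw
  · rw [← hw, mul_one, sub_self]
  · rw [coef_eq_zero_of_inner_isFree h (Ne.symm hw), mul_zero, sub_zero]

theorem inner_smul_one (c : k) : inner (c • 1 : Alg k) = 0 := by
  ext i
  simp [inner_apply]

theorem IsFree.sum_smul {ι : Type*} (s : Finset ι) (c : ι → k) (v : ι → Fin 3 → Alg k)
    (h : ∀ i, IsFree (v i)) : IsFree (∑ i ∈ s, c i • v i) := by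
  constructor <;> intros <;> simp only [Finset.sum_apply, Pi.smul_apply, map_sum, map_smul] <;>
    refine Finset.sum_eq_zero fun i _ => ?_
  · rw [(h i).x_slot _ _ _ (by assumption), smul_zero]
  · rw [(h i).y_slot, smul_zero]
  · rw [(h i).y_slot', smul_zero]
  · rw [(h i).z_slot _ (by assumption), smul_zero]
  · rw [(h i).z_slot', smul_zero]

theorem linearIndependent_coClass : LinearIndependent k (coClass (k := k)) := by
  refine LinearIndependent.of_comp cohomologyValues ?_
  rw [linearIndependent_iff']
  intro s c hc X hX
  have h1 : ∑ Y ∈ s, c Y • coValue Y ∈ LinearMap.range (inner (k := k)) := by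
    rw [← Submodule.Quotient.mk_eq_zero, ← Submodule.mkQ_apply, map_sum, ← hc]
    refine Finset.sum_congr rfl fun Y _ => ?_
    rw [map_smul, Function.comp_apply, cohomologyValues_coClass, Submodule.mkQ_apply]
  obtain ⟨a, ha⟩ := h1
  have h2 : IsFree (inner a) := ha ▸ IsFree.sum_smul s c _ coValue_isFree
  rw [exists_smul_one_of_inner_isFree h2, inner_smul_one] at ha
  have h3 := congrArg (fun v : Fin 3 → Alg k => coef (leadWord X).2 (v (leadWord X).1)) ha
  simp only [Pi.zero_apply, map_zero, Finset.sum_apply, Pi.smul_apply, map_sum, map_smul] at h3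
  rw [Finset.sum_eq_single X] at h3
  · exact (smul_eq_zero.1 h3.symm).resolve_right (coef_leadWord_self X)
  · intro Y _ hY
    rw [not_ne_iff.1 (mt coef_leadWord_of_ne hY.symm), smul_zero]
  · exact fun h => absurd hX h

end Cohomology

/-! ### Normal forms of derivations -/

section CohomologySpan

variable {k : Type*} [Field k]

/-- The pairs of a slot and a word that do not occur in the normal form of a triple of values modulo
inner derivations and the labelled derivations. -/
def IsReducible : Fin 3 → Word → Prop
  | 0, (_, [], some 0) => True
  | 0, (0, 0 :: _, some 0) => True
  | 0, (_, (_ + 1) :: _, some 0) => True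
  | 1, (_ + 2, [], none) => True
  | 1, (_ + 1, [], some (_ + 1)) => True
  | 1, (_ + 1, _ :: _, some _) => True
  | 2, (0, 0 :: _, _) => True
  | 2, (_, _ :: _, none) => True
  | _, _ => False

/-- The space of triples of values in normal form. -/
def normalForms (k : Type*) [Field k] : Submodule k (Fin 3 → Alg k) where
  carrier := {v | ∀ i w, IsReducible i w → coef w (v i) = 0}
  add_mem' hv hw i w h := by rw [Pi.add_apply, map_add, hv i w h, hw i w h, add_zero]
  zero_mem' i w _ := by rw [Pi.zero_apply, map_zero]
  smul_mem' r v hv i w h := by rw [Pi.smul_apply, map_smul, hv i w h, smul_zero]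

/-- A triple of values in normal form that defines a derivation is zero. -/
theorem eq_zero_of_mem_normalForms {v : Fin 3 → Alg k} (hv : IsDer v) (h : v ∈ normalForms k) :
    v = 0 := by
  have hxz : ∀ w, coef w (x * v 2) + coef w (v 0 * z) = 0 := fun w => by
    rw [← map_add, hv.xz, map_zero]
  have hzy : ∀ w, coef w (z * v 1) + coef w (v 2 * y) = 0 := fun w => by
    rw [← map_add, hv.zy, map_zero]
  have hxx : ∀ w, coef w (x * v 0) + coef w (y * v 0) + coef w (v 0 * x) + coef w (v 1 * x) = 0 :=
    fun w => by rw [← map_add, ← map_add, ← map_add, ← add_mul, hv.xx, map_zero]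
  -- The relation `x v_z + v_x z = 0` gives `v_z = 0`.
  have hz : v 2 = 0 := by
    refine eq_zero_of_coef ?_
    rintro ⟨n, L, e⟩
    rcases L with _ | ⟨_ | c, L⟩
    · rcases e with _ | b
      · have := hxz (0, [], some n)
        rwa [coef_x_mul_zero_nil_some, coef_mul_z_some, add_zero] at this
      · have := hxz (n + 1, [], some b)
        rwa [coef_x_mul_succ_nil_some, coef_mul_z_some, add_zero, neg_eq_zero] at this
    · rcases n with _ | n
      · exact h 2 _ trivial
      rcases e with _ | b
      · exact h 2 _ trivial
      · have := hxz (0, (n + 1) :: L, some b)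
        rwa [coef_x_mul_zero_cons_succ, coef_mul_z_some, add_zero] at this
    · rcases e with _ | b
      · exact h 2 (n, (c + 1) :: L, none) (by rcases n with _ | n <;> trivial)
      · have := hxz (n + 1, (c + 1) :: L, some b)
        rwa [coef_x_mul_succ_cons_succ, coef_mul_z_some, add_zero, neg_eq_zero] at this
  simp only [hz, mul_zero, zero_mul, map_zero, zero_add, add_zero] at hxz hzy
  have hx0 : ∀ n L, coef (n, L, none) (v 0) = 0 := fun n L => by
    rw [← coef_mul_z_zero]
    exact hxz _
  have hx1 : ∀ n L b, coef (n, L, some (b + 1)) (v 0) = 0 := fun n L b => by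
    rw [← coef_mul_z_succ]
    exact hxz _
  have hy0 : ∀ L e, coef (0, L, e) (v 1) = 0 := fun L e => by
    rw [← coef_z_mul]
    exact hzy _
  have hx : v 0 = 0 := by
    refine eq_zero_of_coef ?_
    rintro ⟨n, L, _ | _ | b⟩
    · exact hx0 _ _
    · rcases L with _ | ⟨_ | c, L⟩
      · exact h 0 _ trivial
      · rcases n with _ | n
        · exact h 0 _ trivial
        · have := hxx (0, (n + 1) :: L, some 0)
          rwa [coef_x_mul_zero_cons_succ, coef_zero_y_mul, coef_mul_x_cons, coef_mul_x_cons, hx0,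
            hy0, add_zero, add_zero, add_zero] at this
      · exact h 0 (n, (c + 1) :: L, some 0) (by rcases n with _ | n <;> trivial)
    · exact hx1 _ _ _
  simp only [hx, mul_zero, zero_mul, map_zero, zero_add] at hxx
  have hy : v 1 = 0 := by
    have h1 : ∀ n b, coef (n, [], some (b + 1)) (v 1) = 0 := fun n b => by
      rcases n with _ | n
      · exact hy0 _ _
      · exact h 1 (n + 1, [], some (b + 1)) (by rcases n with _ | n <;> trivial)
    have h2 : ∀ n, coef (n + 1, [], none) (v 1) - coef (n, [], some 0) (v 1) = 0 := fun n => by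
      have := hxx (n + 1, [], some 0)
      rw [coef_mul_x_succ, Finset.sum_eq_single (n, 0)] at this
      · exact this
      · rintro ⟨a, b⟩ hab hne
        rw [Finset.HasAntidiagonal.mem_antidiagonal] at hab
        rcases b with _ | b
        · obtain rfl : a = n := hab
          exact absurd rfl hne
        · exact h1 _ _
      · intro hn
        exact absurd (Finset.HasAntidiagonal.mem_antidiagonal.2 (add_zero n)) hn
    have h3 : ∀ n, coef (n + 1, [], none) (v 1) = 0 := fun n => by
      rcases n with _ | n
      · have := h2 0
        rwa [hy0, sub_zero] at this
      · exact h 1 (n + 2, [], none) trivial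
    refine eq_zero_of_coef ?_
    rintro ⟨_ | n, L, e⟩
    · exact hy0 _ _
    rcases L with _ | ⟨c, L⟩
    · rcases e with _ | _ | b
      · exact h3 n
      · have := h2 (n + 1)
        rwa [h3, zero_sub, neg_eq_zero] at this
      · exact h1 _ _
    · rcases e with _ | b
      · rw [← coef_mul_x_cons]
        exact hxx _
      · exact h 1 (n + 1, c :: L, some b) (by rcases n with _ | n <;> trivial)
  ext i
  fin_cases i
  exacts [hx, hy, hz]

/-- The span of the labelled derivations and the inner derivations. -/
def derivationSpan (k : Type*) [Field k] : Submodule k (Fin 3 → Alg k) :=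
  Submodule.span k (Set.range coValue) ⊔ LinearMap.range inner

/-- The triple of values with `a` in one slot and zeros in the others. -/
def slot (i : Fin 3) : Alg k →ₗ[k] Fin 3 → Alg k := LinearMap.single k (fun _ => Alg k) i

theorem slot_word_mem {i : Fin 3} {w : Word} (h : ¬IsReducible i w) :
    slot i (word w) ∈ normalForms k := by
  intro j w' hw'
  by_cases hij : j = i
  · subst hij
    rw [slot, LinearMap.single_apply, Pi.single_eq_same, coef_word, if_neg]
    rintro rfl
    exact h hw'
  · rw [slot, LinearMap.single_apply, Pi.single_eq_of_ne hij, map_zero]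

theorem mem_of_slots (p : Submodule k (Fin 3 → Alg k)) (f : Alg k →ₗ[k] Fin 3 → Alg k)
    (h : ∀ n L e, f (word (n, L, e)) ∈ p) (a : Alg k) : f a ∈ p := by
  rw [← Submodule.Quotient.mk_eq_zero]
  refine word_ext (p.mkQ ∘ₗ f) 0 (fun n L e => ?_) a
  exact (Submodule.Quotient.mk_eq_zero _).2 (h n L e)

theorem eq_sum_slot (v : Fin 3 → Alg k) : v = slot 0 (v 0) + slot 1 (v 1) + slot 2 (v 2) := by
  ext i
  fin_cases i <;> simp [slot]

/-- Every triple of values has a normal form. -/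
theorem derivationSpan_sup_normalForms : derivationSpan k ⊔ normalForms k = ⊤ := by
  set M := derivationSpan k ⊔ normalForms k with hM
  have hN : ∀ {i w}, ¬IsReducible i w → slot i (word w) ∈ M := fun h =>
    Submodule.mem_sup_right (slot_word_mem h)
  have hC : ∀ X, slot 0 (coWord X 0) + slot 1 (coWord X 1) + slot 2 (coWord X 2) ∈ M := fun X => by
    rw [← eq_sum_slot, ← coValue_eq_coWord]
    exact Submodule.mem_sup_left (Submodule.mem_sup_left (Submodule.subset_span ⟨X, rfl⟩))
  have hI : ∀ a : Alg k, slot 0 (x * a - a * x) + slot 1 (y * a - a * y) + slot 2 (z * a - a * z)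
      ∈ M := fun a => by
    have : slot 0 (x * a - a * x) + slot 1 (y * a - a * y) + slot 2 (z * a - a * z) = inner a :=
      (eq_sum_slot (inner a)).symm
    rw [this]
    exact Submodule.mem_sup_left (Submodule.mem_sup_right ⟨a, rfl⟩)
  have hyx : ∀ n, slot 1 (word (n, [], some 0)) ∈ M := fun n =>
    hN (by rcases n with _ | _ | n <;> exact id)
  have hy0 : ∀ L e, slot 1 (word (0, L, e)) ∈ M := fun L e => hN id
  -- All values of `y` occur.
  have hy : ∀ a : Alg k, slot 1 a ∈ M := by
    refine mem_of_slots M _ ?_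
    rintro (_ | n) L e
    · exact hy0 L e
    rcases L with _ | ⟨c, L⟩
    · rcases e with _ | _ | _ | b
      · rcases n with _ | n
        · exact hN id
        · have := hC (.E n.succPNat)
          simp only [coWord, Matrix.cons_val_zero, Matrix.cons_val_one, Matrix.cons_val, map_zero,
            zero_add, add_zero, map_add] at this
          exact (M.add_mem_iff_right (hyx _)).1 this
      · exact hyx _
      · have := hI (word (n + 1, [], some 0))
        rw [x_mul_word_nil_some, word_nil_some_mul_x, y_mul_word, word_some_mul_y, z_mul_word_succ,
          word_some_zero_mul_z, add_zero, sub_self, sub_self, map_zero, map_zero, zero_add,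
          add_zero, map_sub] at this
        exact (M.sub_mem_iff_right (hyx _)).1 this
      · have := hC (.D (n + b + 2).succPNat n.succPNat (by simp only [Nat.succPNat_coe]; omega))
        have h1 : ((n + b + 2).succPNat : ℕ) - (n.succPNat : ℕ) = b + 2 := by
          simp only [Nat.succPNat_coe]; omega
        simp only [coWord, Matrix.cons_val_zero, Matrix.cons_val_one, Matrix.cons_val, map_zero,
          zero_add, add_zero, map_sub, h1] at this
        exact (M.sub_mem_iff_right (hyx _)).1 this
    · have hl := zGaps_gapDecode L
      rcases c with _ | c <;> rcases e with _ | _ | b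
      · exact hN (by rcases n with _ | n <;> exact id)
      · simpa [coWord, hl] using hC (.G (n.succPNat, (gapDecode L).1) (gapDecode L).2)
      · simpa [coWord, hl] using hC (.I (n.succPNat, (gapDecode L).1) (gapDecode L).2 b.succPNat)
      · exact hN (by rcases n with _ | n <;> exact id)
      · simpa [coWord, hl] using hC (.F n.succPNat (c.succPNat, (gapDecode L).1) (gapDecode L).2)
      · simpa [coWord, hl] using
          hC (.H n.succPNat (c.succPNat, (gapDecode L).1) (gapDecode L).2 b.succPNat)
  have hI' : ∀ a : Alg k, slot 0 (x * a - a * x) + slot 2 (z * a - a * z) ∈ M := fun a => by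
    have := hI a
    rw [add_right_comm] at this
    exact (M.add_mem_iff_left (hy _)).1 this
  -- All values of `z` occur that begin with `z`.
  have hK : ∀ L, slot 2 (word (0, 0 :: L, none)) ∈ M := fun L => by
    simpa [coWord, zGaps_gapDecode L] using hC (.K (gapDecode L).1 (gapDecode L).2)
  have hzz : ∀ a : Alg k, slot 2 (z * a) ∈ M := by
    refine mem_of_slots M (slot 2 ∘ₗ LinearMap.mulLeft k z) ?_
    rintro (_ | n) L e
    swap
    · rw [LinearMap.comp_apply, LinearMap.mulLeft_apply, z_mul_word_succ, map_zero]
      exact M.zero_mem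
    rw [LinearMap.comp_apply, LinearMap.mulLeft_apply, z_mul_word_zero]
    rcases e with _ | b
    · exact hK L
    rcases L with _ | ⟨_ | c, L⟩
    · rcases b with _ | b
      · have := hI' (word (0, [], some 0))
        rwa [x_mul_word_nil_some, word_nil_some_mul_x, z_mul_word_zero, word_some_zero_mul_z,
          add_zero, sub_self, map_zero, zero_add, sub_zero] at this
      · have := hC (.C b.succPNat)
        simp only [coWord, Matrix.cons_val_zero, Matrix.cons_val_one, Matrix.cons_val, map_zero,
          zero_add] at this
        exact (M.add_mem_iff_right (hy _)).1 this
    · have := hI' (word (0, 0 :: L, some b))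
      rw [x_mul_word_zero_cons, word_cons_some_mul_x, z_mul_word_zero, sub_self, map_zero, zero_add,
        map_sub] at this
      refine (M.sub_mem_iff_left ?_).1 this
      rcases b with _ | b
      · rw [word_some_zero_mul_z, map_zero]
        exact M.zero_mem
      · rw [word_some_succ_mul_z]
        exact hK _
    · have := hC (.J (c.succPNat, (gapDecode L).1) (gapDecode L).2 b.succPNat)
      simp only [coWord, Matrix.cons_val_zero, Matrix.cons_val_one, Matrix.cons_val, map_zero,
        zero_add, map_neg, zGaps_gapDecode, Nat.succPNat_coe] at this
      exact M.neg_mem_iff.1 ((M.add_mem_iff_right (hy _)).1 this)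
  have hI'' : ∀ a : Alg k, slot 0 (x * a - a * x) - slot 2 (a * z) ∈ M := fun a => by
    have := hI' a
    rw [map_sub (slot 2), add_sub_left_comm] at this
    exact (M.add_mem_iff_right (hzz _)).1 this
  -- All values of `x` occur.
  have hx : ∀ a : Alg k, slot 0 a ∈ M := by
    refine mem_of_slots M _ ?_
    have hcons : ∀ n c L, slot 0 (x * word (n, c :: L, some 0)) ∈ M := fun n c L => by
      have := hI'' (word (n, c :: L, some 0))
      rwa [word_cons_some_mul_x, word_some_zero_mul_z, sub_zero, map_zero, sub_zero] at this
    rintro n L (_ | _ | b)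
    · exact hN (by rcases n with _ | n <;> rcases L with _ | ⟨_ | c, L⟩ <;> exact id)
    · rcases L with _ | ⟨_ | c, L⟩
      · rcases n with _ | n
        · have := hC .A
          simp only [coWord, Matrix.cons_val_zero, Matrix.cons_val_one, Matrix.cons_val, map_zero,
            add_zero] at this
          exact (M.add_mem_iff_left (hy _)).1 this
        · have := hC (.B n.succPNat)
          simp only [coWord, Matrix.cons_val_zero, Matrix.cons_val_one, Matrix.cons_val, map_zero,
            add_zero] at this
          exact (M.add_mem_iff_left (hy _)).1 this
      · rcases n with _ | n
        · have := hI'' (word (0, 0 :: L, none))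
          rw [x_mul_word_zero_cons, word_none_mul_x, word_none_mul_z, zero_sub, map_neg] at this
          exact M.neg_mem_iff.1 ((M.sub_mem_iff_left (hK _)).1 this)
        · exact hN id
      · rcases n with _ | n
        · have := hcons (c + 1) 0 L
          rwa [x_mul_word_succ_cons] at this
        · have := hcons n (c + 1) L
          rwa [x_mul_word_cons_succ, map_neg, M.neg_mem_iff] at this
    · exact hN (by rcases n with _ | n <;> rcases L with _ | ⟨_ | c, L⟩ <;> exact id)
  have hz' : ∀ a : Alg k, slot 2 (a * z) ∈ M := fun a => (M.sub_mem_iff_right (hx _)).1 (hI'' a)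
  have hz : ∀ a : Alg k, slot 2 a ∈ M := by
    refine mem_of_slots M _ ?_
    rintro n L e
    rcases List.eq_nil_or_concat' L with rfl | ⟨L, c, rfl⟩
    · exact hN (by rcases n with _ | n <;> exact id)
    · rcases e with _ | b
      · rcases c with _ | c
        · rw [← word_none_mul_z]
          exact hz' _
        · rw [← word_some_succ_mul_z]
          exact hz' _
      · generalize L ++ [c] = L'
        by_cases h : IsZWord (n, L', some b)
        · rcases n with _ | n <;> rcases L' with _ | ⟨_ | d, L'⟩ <;> try exact h.elim
          rw [← z_mul_word_zero]
          exact hzz _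
        · refine hN fun h' => h ?_
          rcases n with _ | n <;> rcases L' with _ | ⟨_ | d, L'⟩ <;> exact h'
  rw [eq_top_iff]
  rintro v -
  rw [eq_sum_slot v]
  exact M.add_mem (M.add_mem (hx _) (hy _)) (hz _)

theorem IsDer.add {v w : Fin 3 → Alg k} (hv : IsDer v) (hw : IsDer w) : IsDer (v + w) where
  xx := by
    simp only [Pi.add_apply]
    rw [mul_add, add_mul (v 0), add_mul (v 1), ← add_zero (0 : Alg k)]
    nth_rw 1 [← hv.xx]
    rw [← hw.xx]
    abel
  xz := by
    simp only [Pi.add_apply]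
    rw [mul_add, add_mul, add_add_add_comm, hv.xz, hw.xz, add_zero]
  zy := by
    simp only [Pi.add_apply]
    rw [mul_add, add_mul, add_add_add_comm, hv.zy, hw.zy, add_zero]

theorem IsDer.smul {v : Fin 3 → Alg k} (hv : IsDer v) (r : k) : IsDer (r • v) where
  xx := by
    simp only [Pi.smul_apply, mul_smul_comm, smul_mul_assoc, ← smul_add, hv.xx, smul_zero]
  xz := by
    simp only [Pi.smul_apply, mul_smul_comm, smul_mul_assoc, ← smul_add, hv.xz, smul_zero]
  zy := by
    simp only [Pi.smul_apply, mul_smul_comm, smul_mul_assoc, ← smul_add, hv.zy, smul_zero]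

theorem inner_isDer (a : Alg k) : IsDer (inner a) where
  xx := by
    have h : ((x + y) * x : Alg k) = 0 := by rw [add_mul, x_mul_x, neg_add_cancel]
    have e : ((x + y) * (x * a - a * x) + (x * a - a * x) * x + (y * a - a * y) * x : Alg k) =
        (x + y) * x * a - a * ((x + y) * x) := by noncomm_ring
    simp only [inner_apply]
    rw [e, h, zero_mul, mul_zero, sub_zero]
  xz := by
    have e : (x * (z * a - a * z) + (x * a - a * x) * z : Alg k) = x * z * a - a * (x * z) := by
      noncomm_ring
    simp only [inner_apply]
    rw [e, x_mul_z, zero_mul, mul_zero, sub_zero]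
  zy := by
    have e : (z * (y * a - a * y) + (z * a - a * z) * y : Alg k) = z * y * a - a * (z * y) := by
      noncomm_ring
    simp only [inner_apply]
    rw [e, z_mul_y, zero_mul, mul_zero, sub_zero]

theorem isDer_of_mem_derivationSpan {v : Fin 3 → Alg k} (hv : v ∈ derivationSpan k) : IsDer v := by
  obtain ⟨u, hu, _, ⟨a, rfl⟩, rfl⟩ := Submodule.mem_sup.1 hv
  refine IsDer.add ?_ (inner_isDer a)
  clear hv
  induction hu using Submodule.span_induction with
  | mem v hv =>
    obtain ⟨X, rfl⟩ := hv
    exact coValue_isDer X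
  | zero => exact ⟨by simp, by simp, by simp⟩
  | add v w _ _ hv hw => exact hv.add hw
  | smul r v _ hv => exact hv.smul r

theorem IsDer.mem_derivationSpan {v : Fin 3 → Alg k} (hv : IsDer v) : v ∈ derivationSpan k := by
  have h : v ∈ derivationSpan k ⊔ normalForms k := by
    rw [derivationSpan_sup_normalForms]
    exact Submodule.mem_top
  obtain ⟨u, hu, w, hw, rfl⟩ := Submodule.mem_sup.1 h
  have h1 : IsDer w := by
    have := hv.add ((isDer_of_mem_derivationSpan hu).smul (-1))
    rwa [neg_one_smul, add_neg_cancel_comm] at this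
  rwa [eq_zero_of_mem_normalForms h1 hw, add_zero]

theorem span_coClass : Submodule.span k (Set.range (coClass (k := k))) = ⊤ := by
  rw [eq_top_iff]
  rintro ξ -
  obtain ⟨f, rfl⟩ := Subquotient.mk_surjective _ _ ξ
  obtain ⟨u, hu, _, ⟨a, rfl⟩, h⟩ := Submodule.mem_sup.1 (genValues_isDer f.2).mem_derivationSpan
  have h1 : (LinearMap.range inner).mkQ u ∈
      (Submodule.span k (Set.range (coClass (k := k)))).map cohomologyValues := by
    have h2 : cohomologyValues '' Set.range (coClass (k := k)) =
        (LinearMap.range inner).mkQ '' Set.range coValue := by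
      rw [← Set.range_comp, ← Set.range_comp]
      exact congrArg Set.range (funext cohomologyValues_coClass)
    rw [Submodule.map_span, h2, ← Submodule.map_span]
    exact Submodule.mem_map_of_mem hu
  obtain ⟨η, hη, h2⟩ := h1
  have h3 : cohomologyValues η = cohomologyValues (Subquotient.mk _ _ f) := by
    rw [h2, cohomologyValues_mk, ← h, Submodule.Quotient.mk_add, Submodule.mkQ_apply,
      (Submodule.Quotient.mk_eq_zero _).2 (LinearMap.mem_range_self inner a), add_zero]
  rwa [← cohomologyValues_injective h3]

theorem isBasisUpTo_coClass : IsBasisUpTo k Eq (coClass (k := k)) where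
  eq_iff _ _ := linearIndependent_coClass.injective.eq_iff
  linearIndependent := linearIndependent_coClass.linearIndepOn_id
  span_eq_top := span_coClass

/-- The center of the algebra consists of the scalars. -/
theorem existsUnique_smul_unitClass (φ : Cohomology k (Alg k) 0) : ∃! c : k, φ = c • unitClass := by
  obtain ⟨⟨f, hf⟩, rfl⟩ := Subquotient.mk_surjective _ _ φ
  have h1 : inner (f Fin.elim0) = 0 := by
    ext i
    have h := congrArg (fun g : Cochain k (Alg k) 1 => g fun _ => gen i)
      (show coboundary k (Alg k) 0 f = 0 from hf)
    have h' : ∀ v : Fin 0 → Alg k, v = Fin.elim0 := fun v => Subsingleton.elim _ _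
    simp only [coboundary_apply] at h
    simpa [h', sub_eq_add_neg, inner_apply] using h
  have h2 : IsFree (inner (f Fin.elim0)) := by
    rw [h1]
    constructor <;> simp
  have h3 := exists_smul_one_of_inner_isFree h2
  have h4 : (word (0, [], none) : Alg k) = 1 := by simp [word, tailEnd]
  have key : ∀ c : k, Subquotient.mk _ _ ⟨f, hf⟩ = c • (unitClass : Cohomology k (Alg k) 0) ↔
      f Fin.elim0 = c • 1 := by
    intro c
    rw [unitClass, ← map_smul, ← sub_eq_zero, ← map_sub, Subquotient.mk_eq_zero]
    change f - c • MultilinearMap.constOfIsEmpty k _ 1 = 0 ↔ _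
    rw [sub_eq_zero]
    constructor
    · intro h
      rw [h]
      rfl
    · intro h
      ext v
      rw [Subsingleton.elim v Fin.elim0, h]
      rfl
  refine ⟨_, (key _).2 h3, fun c hc => ?_⟩
  have := (key c).1 hc
  rw [this, map_smul, ← h4, coef_word, if_pos rfl, smul_eq_mul, mul_one]

theorem cap_unitClass (p : ℕ) (h : p = 0 + p) (ξ : Homology k (Alg k) p) :
    cap k h unitClass ξ = ξ := by
  obtain ⟨c, rfl⟩ := Subquotient.mk_surjective _ _ ξ
  rw [unitClass, cap, Subquotient.map₂_mk]
  congr 1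
  ext1
  have : capChain k h (MultilinearMap.constOfIsEmpty k (fun _ : Fin 0 => Alg k) (1 : Alg k)) =
      LinearMap.id := by
    ext v
    simp only [LinearMap.compMultilinearMap_apply, capChain_tprod, LinearMap.id_apply]
    congr 1
    ext j
    by_cases hj : (j : ℕ) = 0
    · obtain rfl : j = 0 := Fin.ext hj
      simp [capTuple]
    · simp only [capTuple, if_neg hj]
      congr 1
      ext
      simp
  exact DFunLike.congr_fun this c.1

end CohomologySpan

end IyuduShkarin

theorem mainTheorem9 (k : Type*) [Field k] [CharZero k] :
    -- the labelled classes form bases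
    IyuduShkarin.IsBasisUpTo k IyuduShkarin.Label₀.Same (IyuduShkarin.class₀ (k := k)) ∧
    IyuduShkarin.IsBasisUpTo k IyuduShkarin.Label₁.Same (IyuduShkarin.class₁ (k := k)) ∧
    IyuduShkarin.IsBasisUpTo k Eq (IyuduShkarin.coClass (k := k)) ∧
    -- the cap product on all pairs of basis elements
    (∀ (X : IyuduShkarin.CoLabel) (χ : IyuduShkarin.Label₁),
      Hochschild.cap k (A := IyuduShkarin.Alg k) (n := 1) (m := 0) (p := 1) rfl
        (IyuduShkarin.coClass X) (IyuduShkarin.class₁ χ) = IyuduShkarin.capTable X χ) ∧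
    -- the terms of the table with an exponent equal to zero vanish
    (∀ l : List (ℕ × ℕ), (∃ e ∈ l, 0 < e.2) → (∃ e ∈ l, e.1 = 0 ∨ e.2 = 0) →
      IyuduShkarin.eps₀ (k := k) l = 0) ∧
    -- this cap product is nonzero, and it is the only one in nonzero cohomological degree
    Hochschild.cap k (A := IyuduShkarin.Alg k) (n := 1) (m := 0) (p := 1) rfl ≠ 0 ∧
    (∀ (n m p : ℕ) (h : p = n + m), 1 ≤ n → ¬(n = 1 ∧ p = 1) →
      Hochschild.cap k (A := IyuduShkarin.Alg k) h = 0) ∧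
    -- in cohomological degree zero there are only the scalar multiples of the identity
    (∀ φ : Hochschild.Cohomology k (IyuduShkarin.Alg k) 0,
      ∃! c : k, φ = c • IyuduShkarin.unitClass) ∧
    (∀ (p : ℕ) (h : p = 0 + p) (ξ : Hochschild.Homology k (IyuduShkarin.Alg k) p),
      Hochschild.cap k h IyuduShkarin.unitClass ξ = ξ) := by
  refine ⟨IyuduShkarin.isBasisUpTo_class₀, IyuduShkarin.isBasisUpTo_class₁,
    IyuduShkarin.isBasisUpTo_coClass, IyuduShkarin.cap_coClass_class₁, IyuduShkarin.eps₀_eq_zero,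
    fun h => ?_, fun n m p h hn hnp => ?_, IyuduShkarin.existsUnique_smul_unitClass,
    IyuduShkarin.cap_unitClass⟩
  · have h1 := IyuduShkarin.cap_coClass_class₁ (k := k) .A .alpha
    have h2 := IyuduShkarin.zeroTrace_class₀ (k := k) .alpha
    rw [h, LinearMap.zero_apply, LinearMap.zero_apply] at h1
    rw [IyuduShkarin.class₀, ← show 0 = IyuduShkarin.alpha₀ from h1, map_zero, eq_comm,
      Finsupp.single_eq_zero] at h2
    exact one_ne_zero h2
  · obtain ⟨q, rfl⟩ : ∃ q, p = q + 2 := ⟨p - 2, by omega⟩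
    ext φ ξ
    obtain ⟨c, rfl⟩ := Hochschild.Subquotient.mk_surjective _ _ ξ
    rw [(Hochschild.Subquotient.mk_eq_zero _ _ _).2 (IyuduShkarin.cycles_le_boundaries q c.2),
      map_zero, LinearMap.zero_apply, LinearMap.zero_apply]
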